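/- Let $\alpha>0$. Given constants $a,b,x_0>0$ and a nonnegative random variable $W$ with $\mathbb P(W>x)=a x^{-\alpha}$ for all $x\ge x_0$, let $G(n,\alpha)$ be the random simple graph on $n$ labelled vertices obtained by giving the vertices i.i.d. weights $W_1,\dots,W_n$ distributed as $W$ and then, conditionally on the weights, joining each pair $i<j$ by an edge independently with probability $1-\exp(-bW_iW_j/n)$. Let $\omega(G)$ denote the size of the largest clique of $G$. Then for every $\alpha>0$ there exists a deterministic algorithm which, given any graph $G$ on $n$ vertices (by its adjacency matrix), outputs a set of vertices of $G$ in time at most polynomial in $n$, and which whp finds in $G(n,\alpha)$ a clique of size $(1+o(1))\,\omega(G(n,\alpha))$. That is, for all $a,b,x_0>0$, every distribution of $W$ as above and every $\varepsilon>0$, the probability that the output on $G(n,\alpha)$ is a clique of size at least $(1-\varepsilon)\,\omega(G(n,\alpha))$ tends to $1$ as $n\to\infty$. (The algorithm depends only on $\alpha$; it does not use the weights.) -/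

import Mathlib

open MeasureTheory Filter Topology

/-! ## Machine model

Programs for a random access machine with finitely many natural-number registers and finitely many
unbounded one-dimensional arrays (a program names only finitely many of each). The elementary
operations are loading a constant, addition, truncated subtraction, indirect reading and indirect
writing, control is by tests for zero; every elementary operation and every test costs one step.
There is no multiplication, so that the unit-cost polynomial time of this model is the usual
(Turing machine) polynomial time. -/

namespace RAM

/-- The contents of the registers and of the arrays. -/
structure State where
  reg : ℕ → ℕ
  arr : ℕ → ℕ → ℕ

/-- `s.setReg x v` : register `x` receives the value `v`. -/
def State.setReg (s : State) (x v : ℕ) : State :=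
  { s with reg := Function.update s.reg x v }

/-- `s.setArr a i v` : cell `i` of array `a` receives the value `v`. -/
def State.setArr (s : State) (a i v : ℕ) : State :=
  { s with arr := Function.update s.arr a (Function.update (s.arr a) i v) }

/-- Programs. The letters `x y z` are names of registers, `a` is the name of an array. -/
inductive Program where
  /-- `x := c` -/
  | const (x c : ℕ)
  /-- `x := y + z` -/
  | plus (x y z : ℕ)
  /-- `x := y - z`, truncated at `0` -/
  | minus (x y z : ℕ)
  /-- `x := a[y]` -/
  | load (x a y : ℕ)
  /-- `a[x] := y` -/
  | store (a x y : ℕ)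
  /-- first `P`, then `Q` -/
  | seq (P Q : Program)
  /-- if `x ≠ 0` then `P` else `Q` -/
  | cond (x : ℕ) (P Q : Program)
  /-- while `x ≠ 0` do `P` -/
  | loop (x : ℕ) (P : Program)

/-- `Exec P s t s'` : the program `P`, started in the state `s`, halts after exactly `t` steps, in
the state `s'`. -/
inductive Exec : Program → State → ℕ → State → Prop where
  | const (x c : ℕ) (s : State) : Exec (.const x c) s 1 (s.setReg x c)
  | plus (x y z : ℕ) (s : State) : Exec (.plus x y z) s 1 (s.setReg x (s.reg y + s.reg z))
  | minus (x y z : ℕ) (s : State) : Exec (.minus x y z) s 1 (s.setReg x (s.reg y - s.reg z))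
  | load (x a y : ℕ) (s : State) : Exec (.load x a y) s 1 (s.setReg x (s.arr a (s.reg y)))
  | store (a x y : ℕ) (s : State) : Exec (.store a x y) s 1 (s.setArr a (s.reg x) (s.reg y))
  | seq {P Q : Program} {s s' s'' : State} {t t' : ℕ} (hP : Exec P s t s')
      (hQ : Exec Q s' t' s'') : Exec (.seq P Q) s (t + t') s''
  | cond_true {x : ℕ} {P Q : Program} {s s' : State} {t : ℕ} (hx : s.reg x ≠ 0)
      (hP : Exec P s t s') : Exec (.cond x P Q) s (t + 1) s'
  | cond_false {x : ℕ} {P Q : Program} {s s' : State} {t : ℕ} (hx : s.reg x = 0)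
      (hQ : Exec Q s t s') : Exec (.cond x P Q) s (t + 1) s'
  | loop_step {x : ℕ} {P : Program} {s s' s'' : State} {t t' : ℕ} (hx : s.reg x ≠ 0)
      (hP : Exec P s t s') (hL : Exec (.loop x P) s' t' s'') :
      Exec (.loop x P) s (t + t' + 1) s''
  | loop_done {x : ℕ} {P : Program} {s : State} (hx : s.reg x = 0) :
      Exec (.loop x P) s 1 s

open Classical in
/-- The input `G`: register `0` holds the number `n` of vertices, array `0` holds the adjacency
matrix of `G`, row by row; everything else is `0`. -/
noncomputable def graphInput {n : ℕ} (G : SimpleGraph (Fin n)) : State where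
  reg x := if x = 0 then n else 0
  arr a k :=
    if a = 0 ∧ ∃ i j : Fin n, k = (i : ℕ) * n + (j : ℕ) ∧ G.Adj i j then 1 else 0

/-- The vertex set that is returned: its indicator is stored in array `1`. -/
def vertexSetOutput (n : ℕ) (s : State) : Finset (Fin n) :=
  Finset.univ.filter fun v : Fin n => s.arr 1 (v : ℕ) ≠ 0

/-- On every finite graph `G`, on vertices `0, …, n - 1`, the program `A` halts within a number of
steps that is bounded by a polynomial in `n`, and returns the vertex set `f n G`. -/
def ComputesInPolyTime (A : Program)
    (f : (n : ℕ) → SimpleGraph (Fin n) → Finset (Fin n)) : Prop :=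
  ∃ p : Polynomial ℕ, ∀ (n : ℕ) (G : SimpleGraph (Fin n)), ∃ (t : ℕ) (s : State),
    Exec A (graphInput G) t s ∧ t ≤ p.eval n ∧ vertexSetOutput n s = f n G

end RAM

/-! ## The random graph -/

namespace PowerLawGraph

/-- The law `μ` of a nonnegative weight `W` satisfies `P(W > x) = a x ^ (-α)` for all `x ≥ x₀`. -/
structure IsWeightLaw (μ : Measure ℝ) (α a x₀ : ℝ) : Prop where
  nonneg : ∀ᵐ x ∂μ, 0 ≤ x
  tail : ∀ x : ℝ, x₀ ≤ x → μ.real (Set.Ioi x) = a * x ^ (-α)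

/-- The sample space: a weight for every vertex, and an auxiliary number for every pair. -/
abbrev Sample (n : ℕ) : Type := (Fin n → ℝ) × (Sym2 (Fin n) → ℝ)

/-- Independent weights with law `μ`, and, independently of them, independent auxiliary numbers
that are uniform on `[0, 1]`. -/
noncomputable def sampleMeasure (μ : Measure ℝ) (n : ℕ) : Measure (Sample n) :=
  (Measure.pi fun _ : Fin n => μ).prod
    (Measure.pi fun _ : Sym2 (Fin n) => (volume : Measure ℝ).restrict (Set.Icc 0 1))

/-- The probability `1 - exp (-b W_i W_j / n)` of an edge between vertices of weights `x`, `y`. -/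
noncomputable def edgeProb (b : ℝ) (n : ℕ) (x y : ℝ) : ℝ :=
  1 - Real.exp (-(b * (x * y) / n))

/-- The random graph: distinct `i`, `j` are joined when the auxiliary number of the pair is less
than `edgeProb b n W_i W_j`. Hence, given the weights, the edges are independent and have the
probabilities `edgeProb b n W_i W_j`. -/
def randomGraph (b : ℝ) (n : ℕ) (ω : Sample n) : SimpleGraph (Fin n) where
  Adj i j := i ≠ j ∧ ω.2 s(i, j) < edgeProb b n (ω.1 i) (ω.1 j)
  symm := ⟨fun i j h => by
    refine ⟨h.1.symm, ?_⟩
    rw [Sym2.eq_swap, edgeProb, mul_comm (ω.1 j)]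
    exact h.2⟩
  loopless := ⟨fun _ h => h.1 rfl⟩

end PowerLawGraph

/-! The algorithm depends on whether `α < 2` or `α ≥ 2`.

Let `α < 2`. Put `t = √(κ n log n)` with `κ = (1 - α/2) / b`. About `N = n a t ^ (-α)` vertices have
weight above `t`, and `N` is `n ^ (1 - α/2)` up to a power of `log n`. Two vertices of weight `c t`
are nonadjacent with probability `n ^ (-c² (1 - α/2))`. If `c > 1`, the nonadjacent pairs above `c
t` are `o(N)` in number (`tendsto_numNonedges`). If `c < 1`, a union bound shows that the vertices
below `c t` contain no clique of size `y N`, for any fixed `y > 0` (`tendsto_light_clique`). Hence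
the clique number is at most `(1 + o(1)) N`.

Weights are not visible, but degrees are a substitute. The mean degree at weights of order `t` is
much larger than `log n` and grows by a constant factor when the weight does, so by Chernoff bounds
some degree threshold `d` separates weights below `(1 + δ) t` from those above `(1 + 2δ) t`
(`exists_tendsto_deg`). Let `C` be a maximal clique among the vertices of degree at least `d`. Every
heavy vertex outside `C` has a nonneighbour in `C`, which gives an injection into the few
nonadjacent pairs; so `C` has almost `N` vertices (`numAbove_le_card`). The algorithm tries all
thresholds, builds a maximal clique greedily for each, and keeps the largest.

Let `α ≥ 2`. Then `P(W > x) ≤ K / x²`. With `L` a small power of `log n`, whp all weights are at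
most `L √n`, fewer than `log₂ n` of them exceed `√n / L⁴`, and no complete graph on four vertices
contains a vertex of weight at most `√n / L⁴`. So every clique with at least four vertices lies in a
set with at most `n` subsets, and there are fewer than `(n + 2) ^ 4` cliques
(`tendsto_card_cliques`). Enumerating cliques up to this cap finds a largest one exactly.

Both algorithms are written as machine programs that store cliques in a forest (`IsForest`): a node
is its parent's clique with one vertex added. -/

namespace RAM

/-! ### A time-bounded program logic for the machine. -/

@[simp] theorem State.setReg_reg (s : State) (x v y : ℕ) :
    (s.setReg x v).reg y = if y = x then v else s.reg y := by
  simp [State.setReg, Function.update_apply]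

@[simp] theorem State.setReg_arr (s : State) (x v : ℕ) : (s.setReg x v).arr = s.arr := rfl

@[simp] theorem State.setArr_reg (s : State) (a i v : ℕ) : (s.setArr a i v).reg = s.reg := rfl

@[simp] theorem State.setArr_arr (s : State) (a i v b : ℕ) :
    (s.setArr a i v).arr b = if b = a then Function.update (s.arr a) i v else s.arr b := by
  simp [State.setArr, Function.update_apply]

/-- `P`, started in `s`, halts within `T` steps in a state that satisfies `Q`. -/
def Runs (P : Program) (s : State) (T : ℕ) (Q : State → Prop) : Prop :=
  ∃ t s', Exec P s t s' ∧ t ≤ T ∧ Q s'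

namespace Runs

variable {P P' : Program} {s : State} {T T' : ℕ} {Q R : State → Prop}

theorem mono (h : Runs P s T Q) (hT : T ≤ T') (hQ : ∀ s', Q s' → R s') : Runs P s T' R := by
  obtain ⟨t, s', h1, h2, h3⟩ := h
  exact ⟨t, s', h1, h2.trans hT, hQ _ h3⟩

theorem const {x c : ℕ} (h : Q (s.setReg x c)) : Runs (.const x c) s 1 Q :=
  ⟨_, _, .const x c s, le_rfl, h⟩

theorem plus {x y z : ℕ} (h : Q (s.setReg x (s.reg y + s.reg z))) : Runs (.plus x y z) s 1 Q :=
  ⟨_, _, .plus x y z s, le_rfl, h⟩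

theorem minus {x y z : ℕ} (h : Q (s.setReg x (s.reg y - s.reg z))) : Runs (.minus x y z) s 1 Q :=
  ⟨_, _, .minus x y z s, le_rfl, h⟩

theorem load {x a y : ℕ} (h : Q (s.setReg x (s.arr a (s.reg y)))) : Runs (.load x a y) s 1 Q :=
  ⟨_, _, .load x a y s, le_rfl, h⟩

theorem store {x a y : ℕ} (h : Q (s.setArr a (s.reg x) (s.reg y))) : Runs (.store a x y) s 1 Q :=
  ⟨_, _, .store a x y s, le_rfl, h⟩

theorem seq (hP : Runs P s T R) (h : ∀ s', R s' → Runs P' s' T' Q) :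
    Runs (.seq P P') s (T + T') Q := by
  obtain ⟨t, s', h1, h2, h3⟩ := hP
  obtain ⟨t', s'', h1', h2', h3'⟩ := h s' h3
  exact ⟨_, _, .seq h1 h1', add_le_add h2 h2', h3'⟩

/-- This rule and the next four execute a program symbolically: the state after an elementary
operation stays an explicit term that `simp` can evaluate. -/
theorem seq_const {x c : ℕ} (h : Runs P (s.setReg x c) T Q) :
    Runs (.seq (.const x c) P) s (1 + T) Q :=
  seq (R := fun s' => s' = s.setReg x c) (const rfl) (by rintro _ rfl; exact h)

theorem seq_plus {x y z : ℕ} (h : Runs P (s.setReg x (s.reg y + s.reg z)) T Q) :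
    Runs (.seq (.plus x y z) P) s (1 + T) Q :=
  seq (R := fun s' => s' = s.setReg x (s.reg y + s.reg z)) (plus rfl) (by rintro _ rfl; exact h)

theorem seq_minus {x y z : ℕ} (h : Runs P (s.setReg x (s.reg y - s.reg z)) T Q) :
    Runs (.seq (.minus x y z) P) s (1 + T) Q :=
  seq (R := fun s' => s' = s.setReg x (s.reg y - s.reg z)) (minus rfl) (by rintro _ rfl; exact h)

theorem seq_load {x a y : ℕ} (h : Runs P (s.setReg x (s.arr a (s.reg y))) T Q) :
    Runs (.seq (.load x a y) P) s (1 + T) Q :=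
  seq (R := fun s' => s' = s.setReg x (s.arr a (s.reg y))) (load rfl) (by rintro _ rfl; exact h)

theorem seq_store {x a y : ℕ} (h : Runs P (s.setArr a (s.reg x) (s.reg y)) T Q) :
    Runs (.seq (.store a x y) P) s (1 + T) Q :=
  seq (R := fun s' => s' = s.setArr a (s.reg x) (s.reg y)) (store rfl)
    (by rintro _ rfl; exact h)

theorem cond {x : ℕ} (h1 : s.reg x ≠ 0 → Runs P s T Q) (h0 : s.reg x = 0 → Runs P' s T Q) :
    Runs (.cond x P P') s (T + 1) Q := by
  by_cases hx : s.reg x = 0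
  · obtain ⟨t, s', h1, h2, h3⟩ := h0 hx
    exact ⟨_, _, .cond_false hx h1, by omega, h3⟩
  · obtain ⟨t, s', h1, h2, h3⟩ := h1 hx
    exact ⟨_, _, .cond_true hx h1, by omega, h3⟩

/-- The continuation is moved into both branches, so that each is executed on its own explicit state
and no common intermediate assertion is needed. -/
theorem seq_cond {x : ℕ} {P₀ : Program} (h1 : s.reg x ≠ 0 → Runs (.seq P P₀) s T Q)
    (h0 : s.reg x = 0 → Runs (.seq P' P₀) s T Q) :
    Runs (.seq (.cond x P P') P₀) s (1 + T) Q := by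
  by_cases hx : s.reg x = 0
  · obtain ⟨t, s', h1, h2, h3⟩ := h0 hx
    cases h1 with
    | seq hP hQ => exact ⟨_, _, .seq (.cond_false hx hP) hQ, by omega, h3⟩
  · obtain ⟨t, s', h1, h2, h3⟩ := h1 hx
    cases h1 with
    | seq hP hQ => exact ⟨_, _, .seq (.cond_true hx hP) hQ, by omega, h3⟩

/-- A loop whose body decreases the first argument of the invariant `I`. -/
theorem loop_of_variant {x : ℕ} {I : ℕ → State → Prop} (hdone : ∀ k s, I k s → s.reg x = 0 → Q s)
    (hstep : ∀ k s, I k s → s.reg x ≠ 0 → Runs P s T fun s' => ∃ k' < k, I k' s') {k : ℕ}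
    (h : I k s) : Runs (.loop x P) s (k * (T + 1) + 1) Q := by
  induction k using Nat.strong_induction_on generalizing s with
  | _ k ih =>
    by_cases hx : s.reg x = 0
    · exact ⟨_, _, .loop_done hx, by omega, hdone k s h hx⟩
    · obtain ⟨t, s', h1, h2, k', hk', h3⟩ := hstep k s h hx
      obtain ⟨t', s'', h1', h2', h3'⟩ := ih k' hk' h3
      refine ⟨_, _, .loop_step hx h1 h1', ?_, h3'⟩
      have : (k' + 1) * (T + 1) ≤ k * (T + 1) := Nat.mul_le_mul_right _ hk'
      nlinarith

end Runs

/-- Execute `P` with register `i` running through `0, …, m - 1`, where `m` is the value of a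
register; register `c` holds the number of remaining rounds, register `e` holds `1`. -/
def Program.forRange (i m c e : ℕ) (P : Program) : Program :=
  .seq (.const i 0) <| .seq (.minus c m i) <|
    .loop c <| .seq P <| .seq (.plus i i e) (.minus c m i)

/-- The body must preserve registers `i`, `m` and `e`, but may overwrite the counter `c`, which is
recomputed from `m` and `i` after each round. The hypothesis `hI` says that the invariant ignores
the two loop registers. -/
theorem Runs.forRange {i m c e : ℕ} {P : Program} {s : State} {T N : ℕ} (I : ℕ → State → Prop)
    (hic : i ≠ c) (him : i ≠ m) (hie : i ≠ e) (hcm : c ≠ m) (hce : c ≠ e)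
    (hI : ∀ k s v w, I k s → I k ((s.setReg i v).setReg c w))
    (hm : s.reg m = N) (he : s.reg e = 1) (h0 : I 0 s)
    (hstep : ∀ k < N, ∀ s, I k s → s.reg i = k → s.reg m = N → s.reg e = 1 →
      Runs P s T fun s' => I (k + 1) s' ∧ s'.reg i = k ∧ s'.reg m = N ∧ s'.reg e = 1) :
    Runs (.forRange i m c e P) s (N * (T + 3) + 3) (I N) := by
  -- The variant `j` is the number of rounds left, so the index is `N - j`; the budget `T + 2` pays
  -- for the body and the two updates.
  have key := Runs.loop_of_variant (x := c) (T := T + 2) (Q := I N)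
    (P := .seq P <| .seq (.plus i i e) (.minus c m i))
    (s := (s.setReg i 0).setReg c N) (k := N)
    (I := fun j s => j ≤ N ∧ I (N - j) s ∧ s.reg i = N - j ∧ s.reg c = j ∧ s.reg m = N ∧
      s.reg e = 1) ?_ ?_ ?_
  · unfold Program.forRange
    refine (Runs.seq_const <| Runs.seq_minus ?_).mono (T := 1 + (1 + (N * (T + 3) + 1)))
      (by omega) fun _ h => h
    simpa [him.symm, hm] using key
  · rintro k s ⟨h1, h2, h3, h4, -⟩ hx
    have : k = 0 := by omega
    subst this
    simpa using h2
  · rintro k s ⟨h1, h2, h3, h4, h5, h6⟩ hx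
    have hk : k ≠ 0 := by omega
    refine (Runs.seq (hstep (N - k) (by omega) s h2 h3 h5 h6) (T' := 1 + 1) ?_)
    rintro s' ⟨h7, h8, h9, h10⟩
    refine Runs.seq_plus (Runs.minus ⟨k - 1, by omega, by omega, ?_⟩)
    have e1 : N - (k - 1) = N - k + 1 := by omega
    refine ⟨?_, ?_, ?_, ?_, ?_⟩
    · rw [e1]; exact hI _ _ _ _ h7
    · simp [hic, h8, h10]; omega
    · simp [him.symm, h9, h8, h10]; omega
    · simp [hcm.symm, him.symm, h9]
    · simp [hce.symm, hie.symm, h10]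
  · refine ⟨le_rfl, ?_, ?_, ?_, ?_, ?_⟩
    · simpa using hI 0 s 0 N h0
    · simp [hic]
    · simp
    · simp [hcm.symm, him.symm, hm]
    · simp [hce.symm, hie.symm, he]

end RAM

/-! ### Cliques stored in a forest of parent pointers. -/

namespace RAM

/-- A forest of cliques of the graph with adjacency matrix `M`, stored in arrays `2` (parents),
`3` (last vertices) and `4` (sizes): node `k` stands for the clique `L k`, and `L 0 = ∅`. Register
`2` holds the number of nodes, register `4` a node of largest size, register `3` this size. -/
structure IsForest (n : ℕ) (M : ℕ → ℕ) (len : ℕ) (L : ℕ → Finset ℕ) (s : State) : Prop where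
  adj : s.arr 0 = M
  out : s.arr 1 = fun _ => 0
  reg_zero : s.reg 0 = n
  reg_one : s.reg 1 = 1
  reg_two : s.reg 2 = len
  root : L 0 = ∅
  parent_lt : ∀ k, 0 < k → k < len → s.arr 2 k < k
  node : ∀ k, 0 < k → k < len → L k = insert (s.arr 3 k) (L (s.arr 2 k))
  size : ∀ k < len, s.arr 4 k = (L k).card
  lt : ∀ k < len, ∀ u ∈ L k, u < n
  clique : ∀ k < len, ∀ u ∈ L k, ∀ w ∈ L k, u ≠ w → M (u * n + w) ≠ 0
  best_lt : s.reg 4 < len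
  best : s.reg 3 = (L (s.reg 4)).card
  le_best : ∀ k < len, (L k).card ≤ s.reg 3

variable {n : ℕ} {M : ℕ → ℕ} {len : ℕ} {L : ℕ → Finset ℕ} {s : State}

/-- Registers from `5` on are scratch space for the forest. -/
theorem IsForest.congr {s' : State} (h : IsForest n M len L s) (ha : s'.arr = s.arr)
    (hr : ∀ x < 5, s'.reg x = s.reg x) : IsForest n M len L s' := by
  obtain ⟨h1, h2, h3, h4, h5, h6, h7, h8, h9, h10, h11, h12, h13, h14⟩ := h
  constructor <;> (try rw [ha]) <;> (try rw [hr _ (by norm_num)]) <;>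
    (try rw [hr _ (by norm_num)]) <;> assumption

theorem IsForest.setReg {x v : ℕ} (hx : 5 ≤ x) (h : IsForest n M len L s) :
    IsForest n M len L (s.setReg x v) :=
  h.congr rfl fun y hy => by simp; omega

/-- Set register `12` to `1` or `0` according as the vertex in register `5` is adjacent or not to
all vertices of the node in register `7`; register `6` holds the offset of the vertex in the
adjacency matrix. -/
def Program.testAdjacent : Program :=
  -- Register `19` is kept at zero: adding it copies a register, and setting it to zero again serves
  -- as an empty instruction.
  .seq (.const 12 1) <| .seq (.const 19 0) <| .seq (.plus 13 7 19) <|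
    .loop 13 <| .seq (.load 14 3 13) <| .seq (.plus 15 6 14) <| .seq (.load 16 0 15) <|
      .seq (.cond 16 (.const 19 0) (.const 12 0)) (.load 13 2 13)

theorem IsForest.runs_testAdjacent (h : IsForest n M len L s) (hr : s.reg 7 < len) {v : ℕ}
    (h6 : s.reg 6 = v * n) :
    Runs .testAdjacent s (7 * len + 4) fun s' => IsForest n M len L s' ∧ s'.arr = s.arr ∧
      (∀ x, x < 12 ∨ 19 < x → s'.reg x = s.reg x) ∧
      (s'.reg 12 ≠ 0 ↔ ∀ u ∈ L (s.reg 7), M (v * n + u) ≠ 0) := by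
  let r := s.reg 7
  -- On the way to the root, register `12` records the verdict on the vertices already passed, while
  -- `L p` consists of those still ahead. Parents have smaller numbers, so `p` is a variant.
  let I : ℕ → State → Prop := fun p s' => s'.arr = s.arr ∧
    (∀ x, x < 12 ∨ 19 < x → s'.reg x = s.reg x) ∧ p ≤ r ∧ s'.reg 13 = p ∧
    ((s'.reg 12 ≠ 0 ∧ ∀ u ∈ L p, M (v * n + u) ≠ 0) ↔ ∀ u ∈ L r, M (v * n + u) ≠ 0)
  have key := Runs.loop_of_variant (x := 13) (T := 6)
    (P := .seq (.load 14 3 13) <| .seq (.plus 15 6 14) <| .seq (.load 16 0 15) <|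
      .seq (.cond 16 (.const 19 0) (.const 12 0)) (.load 13 2 13))
    (s := (((s.setReg 12 1).setReg 19 0).setReg 13 r)) (k := r) (I := I)
    (Q := fun s' => IsForest n M len L s' ∧ s'.arr = s.arr ∧
      (∀ x, x < 12 ∨ 19 < x → s'.reg x = s.reg x) ∧
      (s'.reg 12 ≠ 0 ↔ ∀ u ∈ L (s.reg 7), M (v * n + u) ≠ 0)) ?_ ?_ ?_
  · refine (Runs.seq_const <| Runs.seq_const <| Runs.seq_plus
      (T := r * (6 + 1) + 1) ?_).mono (T := 1 + (1 + (1 + (r * (6 + 1) + 1)))) ?_ fun _ h => h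
    · simpa [r] using key
    · have : r < len := hr
      omega
  · rintro p s' ⟨h1, h2, h3, h4, h7⟩ hp
    refine ⟨h.congr h1 fun x hx => h2 x (by omega), h1, h2, ?_⟩
    have : p = 0 := by omega
    subst this
    simpa [h.root] using h7
  · rintro p s' ⟨h1, h2, h3, h4, h7⟩ hp
    have hp' : 0 < p := by omega
    have hpl : p < len := lt_of_le_of_lt h3 hr
    have hlt := h.parent_lt p hp' hpl
    have hnode := h.node p hp' hpl
    have e6 : s'.reg 6 = v * n := by rw [h2 6 (by norm_num), h6]
    rw [hnode] at h7
    refine Runs.seq_load <| Runs.seq_plus <| Runs.seq_load <| Runs.seq_cond (T := 2) ?_ ?_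
    · intro hx
      simp [h1, h4, e6, h.adj] at hx
      refine Runs.seq_const <| Runs.load ⟨_, hlt, ?_⟩
      refine ⟨by simpa using h1, ?_, by omega, by simp [h1, h4], ?_⟩
      · intro x hx
        rw [← h2 x hx]
        have : x ≠ 12 ∧ x ≠ 13 ∧ x ≠ 14 ∧ x ≠ 15 ∧ x ≠ 16 ∧ x ≠ 19 := by omega
        simp [this]
      · rw [← h7]
        simp [hx]
    · intro hx
      simp [h1, h4, e6, h.adj] at hx
      refine Runs.seq_const <| Runs.load ⟨_, hlt, ?_⟩
      refine ⟨by simpa using h1, ?_, by omega, by simp [h1, h4], ?_⟩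
      · intro x hx
        rw [← h2 x hx]
        have : x ≠ 12 ∧ x ≠ 13 ∧ x ≠ 14 ∧ x ≠ 15 ∧ x ≠ 16 ∧ x ≠ 19 := by omega
        simp [this]
      · rw [← h7]
        simp [hx]
  · refine ⟨rfl, ?_, le_rfl, by simp, by simp⟩
    intro x hx
    have : x ≠ 12 ∧ x ≠ 13 ∧ x ≠ 19 := by omega
    simp [this]

/-- If the vertex in register `5`, whose offset in the adjacency matrix is in register `6`, is
adjacent to all vertices of the node in register `7`, add this extension to the forest. -/
def Program.extend : Program :=
  .seq .testAdjacent <| .cond 12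
    (.seq (.store 2 2 7) <| .seq (.store 3 2 5) <| .seq (.load 17 4 7) <| .seq (.plus 17 17 1) <|
      .seq (.store 4 2 17) <| .seq (.minus 18 17 3) <|
      .seq (.cond 18 (.seq (.const 19 0) <| .seq (.plus 3 17 19) (.plus 4 2 19)) (.const 19 0)) <|
      .plus 2 2 1)
    (.const 19 0)

/-- Vertices are only added in increasing order, so `v` is new to `L r` and the size grows by one.
Older nodes are untouched. The disjunction `r34` describes whether the new clique replaces the best
one. -/
theorem IsForest.push (h : IsForest n M len L s) {r v : ℕ} (hr : r < len) (hv : v < n)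
    (hlt : ∀ u ∈ L r, u < v) (hM : ∀ u ∈ L r, M (v * n + u) ≠ 0)
    (hsymm : ∀ u < n, ∀ w < n, M (u * n + w) ≠ 0 → M (w * n + u) ≠ 0)
    {s' : State} (h0 : s'.arr 0 = s.arr 0) (h1 : s'.arr 1 = s.arr 1)
    (h2 : s'.arr 2 = Function.update (s.arr 2) len r)
    (h3 : s'.arr 3 = Function.update (s.arr 3) len v)
    (h4 : s'.arr 4 = Function.update (s.arr 4) len ((L r).card + 1))
    (r0 : s'.reg 0 = n) (r1 : s'.reg 1 = 1) (r2 : s'.reg 2 = len + 1)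
    (r34 : (s.reg 3 < (L r).card + 1 ∧ s'.reg 3 = (L r).card + 1 ∧ s'.reg 4 = len) ∨
      ((L r).card + 1 ≤ s.reg 3 ∧ s'.reg 3 = s.reg 3 ∧ s'.reg 4 = s.reg 4)) :
    IsForest n M (len + 1) (Function.update L len (insert v (L r))) s' := by
  have hvr : v ∉ L r := fun hm => (hlt v hm).false
  have hcard : (insert v (L r)).card = (L r).card + 1 := Finset.card_insert_of_notMem hvr
  have hcases : ∀ k < len + 1, k = len ∨ (k < len ∧ k ≠ len) := by omega
  have hb := h.best_lt
  constructor
  · rw [h0, h.adj]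
  · rw [h1, h.out]
  · exact r0
  · exact r1
  · exact r2
  · rw [Function.update_of_ne (by omega), h.root]
  · intro k hk hk'
    rw [h2]
    obtain rfl | ⟨hk1, hk2⟩ := hcases k hk'
    · simpa using hr
    · simpa [hk2] using h.parent_lt k hk hk1
  · intro k hk hk'
    rw [h2, h3]
    obtain rfl | ⟨hk1, hk2⟩ := hcases k hk'
    · simp [hr.ne]
    · have := h.parent_lt k hk hk1
      rw [Function.update_of_ne hk2, Function.update_of_ne hk2, Function.update_of_ne hk2,
        Function.update_of_ne (by omega)]
      exact h.node k hk hk1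
  · intro k hk'
    rw [h4]
    obtain rfl | ⟨hk1, hk2⟩ := hcases k hk'
    · simp [hcard]
    · simpa [hk2] using h.size k hk1
  · intro k hk'
    obtain rfl | ⟨hk1, hk2⟩ := hcases k hk'
    · simp only [Function.update_self, Finset.mem_insert]
      rintro u (rfl | hu)
      · exact hv
      · exact h.lt r hr u hu
    · simpa [hk2] using h.lt k hk1
  · intro k hk'
    obtain rfl | ⟨hk1, hk2⟩ := hcases k hk'
    · simp only [Function.update_self, Finset.mem_insert]
      rintro u (rfl | hu) w (rfl | hw) huw
      · exact absurd rfl huw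
      · exact hM w hw
      · exact hsymm _ hv _ (h.lt r hr u hu) (hM u hu)
      · exact h.clique r hr u hu w hw huw
    · simpa [hk2] using h.clique k hk1
  · omega
  · rcases r34 with ⟨-, e3, e4⟩ | ⟨-, e3, e4⟩
    · simp [e3, e4, hcard]
    · rw [e3, e4, Function.update_of_ne (by omega), h.best]
  · intro k hk'
    obtain rfl | ⟨hk1, hk2⟩ := hcases k hk'
    · simp only [Function.update_self]
      omega
    · rw [Function.update_of_ne hk2]
      have := h.le_best k hk1
      omega

theorem IsForest.runs_extend (h : IsForest n M len L s) {r v : ℕ} (h7 : s.reg 7 = r)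
    (hr : r < len) (h5 : s.reg 5 = v) (hv : v < n) (h6 : s.reg 6 = v * n)
    (hlt : ∀ u ∈ L r, u < v)
    (hsymm : ∀ u < n, ∀ w < n, M (u * n + w) ≠ 0 → M (w * n + u) ≠ 0) :
    Runs .extend s (7 * len + 17) fun s' =>
      (∀ x, 5 ≤ x → x < 12 ∨ 19 < x → s'.reg x = s.reg x) ∧
      ((s'.reg 12 = 0 ∧ (¬ ∀ u ∈ L r, M (v * n + u) ≠ 0) ∧ IsForest n M len L s') ∨
       (s'.reg 12 ≠ 0 ∧ (∀ u ∈ L r, M (v * n + u) ≠ 0) ∧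
        IsForest n M (len + 1) (Function.update L len (insert v (L r))) s')) := by
  refine (Runs.seq (h.runs_testAdjacent (h7 ▸ hr) h6) (T' := 13) ?_).mono (by omega) fun _ h => h
  rintro s₁ ⟨hf, harr, hreg, hok⟩
  rw [h7] at hok
  have e5 : s₁.reg 5 = v := by rw [hreg 5 (by norm_num), h5]
  have e7 : s₁.reg 7 = r := by rw [hreg 7 (by norm_num), h7]
  have esize := hf.size r hr
  refine Runs.cond (T := 12) (fun hx => ?_) fun hx => ?_
  · have hrl : r ≠ len := hr.ne
    refine Runs.mono (T := 1 + (1 + (1 + (1 + (1 + (1 + (1 + 4))))))) (Runs.seq_store <|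
      Runs.seq_store <| Runs.seq_load <| Runs.seq_plus <| Runs.seq_store <| Runs.seq_minus <|
      Runs.seq_cond (T := 4) ?_ ?_) (by norm_num) fun _ h => h
    · intro hd
      refine Runs.seq (T := 3) (T' := 1) (Runs.seq_const <| Runs.seq_plus <| Runs.plus (Q :=
        fun s' => s' = _) rfl) ?_
      rintro _ rfl
      refine Runs.plus ⟨?_, Or.inr ⟨?_, hok.1 hx, ?_⟩⟩
      · intro x hx hx'
        rw [← hreg x hx']
        have : x ≠ 2 ∧ x ≠ 3 ∧ x ≠ 4 ∧ x ≠ 17 ∧ x ≠ 18 ∧ x ≠ 19 := by omega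
        simp [this]
      · simpa using hx
      · simp [hf.reg_one, hf.reg_two, e7, esize] at hd
        apply hf.push hr hv hlt (hok.1 hx) hsymm <;>
          simp [hf.reg_zero, hf.reg_one, hf.reg_two, e5, e7, esize]
        omega
    · intro hd
      refine Runs.mono (T := 1 + 1) (Runs.seq_const <| Runs.plus ⟨?_, Or.inr ⟨?_, hok.1 hx, ?_⟩⟩)
        (by norm_num) fun _ h => h
      · intro x hx hx'
        rw [← hreg x hx']
        have : x ≠ 2 ∧ x ≠ 3 ∧ x ≠ 4 ∧ x ≠ 17 ∧ x ≠ 18 ∧ x ≠ 19 := by omega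
        simp [this]
      · simpa using hx
      · simp [hf.reg_one, hf.reg_two, e7, esize] at hd
        apply hf.push hr hv hlt (hok.1 hx) hsymm <;>
          simp [hf.reg_zero, hf.reg_one, hf.reg_two, e5, e7, esize]
        right
        omega
  · refine Runs.mono (T := 1) (Runs.const ⟨?_, Or.inl ⟨by simpa using hx, ?_, ?_⟩⟩) (by norm_num)
      fun _ h => h
    · intro x hx hx'
      rw [← hreg x hx']
      have : x ≠ 19 := by omega
      simp [this]
    · rw [← hok]; simpa using hx
    · exact hf.setReg (by norm_num)

/-- Write the indicator of the node in register `4` to array `1`. -/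
def Program.output : Program :=
  .seq (.const 19 0) <| .seq (.plus 13 4 19) <|
    .loop 13 <| .seq (.load 14 3 13) <| .seq (.store 1 14 1) (.load 13 2 13)

theorem IsForest.runs_output (h : IsForest n M len L s) :
    Runs .output s (4 * len + 4) fun s' => ∀ u, s'.arr 1 u ≠ 0 ↔ u ∈ L (s.reg 4) := by
  let r := s.reg 4
  have hr : r < len := h.best_lt
  have key := Runs.loop_of_variant (x := 13) (T := 3)
    (P := .seq (.load 14 3 13) <| .seq (.store 1 14 1) (.load 13 2 13))
    (s := ((s.setReg 19 0).setReg 13 r)) (k := r)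
    -- A vertex of the best clique is either already marked in array `1` or still ahead on the path
    -- to the root.
    (I := fun p s' => s'.arr 2 = s.arr 2 ∧ s'.arr 3 = s.arr 3 ∧ s'.reg 1 = 1 ∧ p ≤ r ∧
      s'.reg 13 = p ∧ ∀ u, (s'.arr 1 u ≠ 0 ∨ u ∈ L p) ↔ u ∈ L r)
    (Q := fun s' => ∀ u, s'.arr 1 u ≠ 0 ↔ u ∈ L (s.reg 4)) ?_ ?_ ?_
  · refine (Runs.seq_const <| Runs.seq_plus
      (T := r * (3 + 1) + 1) ?_).mono (T := 1 + (1 + (r * (3 + 1) + 1))) ?_ fun _ h => h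
    · simpa [r] using key
    · omega
  · rintro p s' ⟨h1, h2, h3, h4, h5, h7⟩ hp
    have : p = 0 := by omega
    subst this
    simpa [h.root] using h7
  · rintro p s' ⟨h1, h2, h3, h4, h5, h7⟩ hp
    have hp' : 0 < p := by omega
    have hpl : p < len := by omega
    have hlt := h.parent_lt p hp' hpl
    have hnode := h.node p hp' hpl
    rw [hnode] at h7
    refine Runs.seq_load <| Runs.seq_store <| Runs.load ⟨_, hlt, ?_⟩
    refine ⟨by simpa using h1, by simpa using h2, by simpa using h3, by omega,
      by simp [h1, h5], fun u => ?_⟩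
    rw [← h7]
    by_cases hu : u = s.arr 3 p <;> simp [h2, h3, h5, hu]
  · exact ⟨rfl, rfl, by simpa using h.reg_one, le_rfl, by simp, by simp [h.out, r]⟩

end RAM

/-! ### Greedy maximal cliques for all degree thresholds. -/

namespace RAM

variable {n : ℕ} {M : ℕ → ℕ} {len : ℕ} {L : ℕ → Finset ℕ} {s : State}

/-- `C` is a maximal clique of the graph induced on the vertices below `v` of degree at least `d`
(provided that `C` is a clique). -/
def IsMaxAbove (n : ℕ) (M : ℕ → ℕ) (d v : ℕ) (C : Finset ℕ) : Prop :=
  (∀ u ∈ C, u < v ∧ d ≤ ∑ w ∈ Finset.range n, M (u * n + w)) ∧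
    ∀ u < v, d ≤ ∑ w ∈ Finset.range n, M (u * n + w) → u ∉ C → ∃ w ∈ C, M (u * n + w) = 0

/-- Compute the degree of the vertex with offset in register `6`. -/
def Program.degree : Program :=
  .seq (.const 20 0) <| .forRange 21 0 11 1 <|
    .seq (.plus 15 6 21) <| .seq (.load 16 0 15) (.plus 20 20 16)

theorem IsForest.runs_degree (h : IsForest n M len L s) {v : ℕ} (h6 : s.reg 6 = v * n) :
    Runs .degree s (6 * n + 4) fun s' => IsForest n M len L s' ∧
      (∀ x < 11, s'.reg x = s.reg x) ∧ s'.reg 20 = ∑ w ∈ Finset.range n, M (v * n + w) := by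
  refine (Runs.seq_const (Runs.mono (Runs.forRange (N := n) (T := 3) (fun k s' => s'.arr = s.arr ∧
      (∀ x < 11, s'.reg x = s.reg x) ∧ s'.reg 20 = ∑ w ∈ Finset.range k, M (v * n + w))
      (by norm_num) (by norm_num) (by norm_num) (by norm_num) (by norm_num) ?_
      (by simp [h.reg_zero]) (by simp [h.reg_one]) ?_ ?_) (T' := 6 * n + 3) (by omega) ?_)).mono
      (by omega) fun _ h => h
  · rintro k s' v w ⟨h1, h2, h3⟩
    refine ⟨by simpa using h1, fun x hx => ?_, by simpa using h3⟩
    have : x ≠ 11 ∧ x ≠ 21 := by omega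
    simp [this, h2 x hx]
  · refine ⟨rfl, fun x hx => ?_, by simp⟩
    have : x ≠ 20 := by omega
    simp [this]
  · rintro k hk s' ⟨h1, h2, h3⟩ hi hm he
    have e6 : s'.reg 6 = v * n := by rw [h2 6 (by norm_num), h6]
    refine Runs.seq_plus <| Runs.seq_load <| Runs.plus (Q := _) ⟨⟨?_, ?_, ?_⟩, ?_, ?_, ?_⟩
    · simpa using h1
    · intro x hx
      have : x ≠ 15 ∧ x ≠ 16 ∧ x ≠ 20 := by omega
      simp [this, h2 x hx]
    · simp [h1, h3, h.adj, e6, hi, Finset.sum_range_succ]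
    · simpa using hi
    · simpa using hm
    · simpa using he
  · rintro s' ⟨h1, h2, h3⟩
    exact ⟨h.congr h1 fun x hx => h2 x (by omega), h2, h3⟩

/-- Extend the node in register `7` by the vertex in register `5`, if this vertex has at least the
degree in register `8` and is adjacent to the node. -/
def Program.greedyStep : Program :=
  .seq .degree <| .seq (.minus 18 8 20) <|
    .seq (.cond 18 (.const 19 0) (.seq .extend (.cond 12 (.minus 7 2 1) (.const 19 0))))
      (.plus 6 6 0)

/-- The state during the greedy search: thresholds below `d` are finished, and for the threshold
`d` the vertices below `v` have been treated. -/
def GreedyInv (n : ℕ) (M : ℕ → ℕ) (d v : ℕ) (s : State) : Prop :=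
  ∃ len L, IsForest n M len L s ∧ len ≤ 1 + d * n + v ∧
    (∀ d' < d, ∃ k < len, IsMaxAbove n M d' n (L k)) ∧ s.reg 6 = v * n ∧ s.reg 8 = d ∧
    s.reg 7 < len ∧ IsMaxAbove n M d v (L (s.reg 7))

theorem GreedyInv.runs_greedyStep {d v : ℕ} (hv : v < n) (hd : d < n) (h5 : s.reg 5 = v)
    (hsymm : ∀ u < n, ∀ w < n, M (u * n + w) ≠ 0 → M (w * n + u) ≠ 0)
    (h : GreedyInv n M d v s) :
    Runs .greedyStep s (7 * (n ^ 2 + 1) + 6 * n + 26) fun s' => GreedyInv n M d (v + 1) s' ∧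
      s'.reg 5 = v ∧ s'.reg 0 = n ∧ s'.reg 1 = 1 ∧ s'.reg 9 = s.reg 9 := by
  obtain ⟨len, L, hf, hlen, hold, h6, h8, h7, hmax⟩ := h
  -- At most one node is created for each pair of a threshold and a vertex, and `d` and `v` are less
  -- than `n`.
  have hlenn : len ≤ n ^ 2 + 1 := by nlinarith
  refine (Runs.seq (hf.runs_degree h6) (T' := 7 * len + 22) ?_).mono (by omega) fun _ h => h
  rintro s₁ ⟨hf₁, hreg, hdeg⟩
  have e5 : s₁.reg 5 = v := by rw [hreg 5 (by norm_num), h5]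
  have e6 : s₁.reg 6 = v * n := by rw [hreg 6 (by norm_num), h6]
  have e7 : s₁.reg 7 = s.reg 7 := hreg 7 (by norm_num)
  have e8 : s₁.reg 8 = d := by rw [hreg 8 (by norm_num), h8]
  have e9 : s₁.reg 9 = s.reg 9 := hreg 9 (by norm_num)
  refine (Runs.seq_minus <| Runs.seq (T := 7 * len + 20) (T' := 1)
    (R := fun s' => ∃ len' L', IsForest n M len' L' s' ∧ len' ≤ 1 + d * n + (v + 1) ∧
    (∀ d' < d, ∃ k < len', IsMaxAbove n M d' n (L' k)) ∧ s'.reg 6 = v * n ∧ s'.reg 8 = d ∧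
    s'.reg 7 < len' ∧ IsMaxAbove n M d (v + 1) (L' (s'.reg 7)) ∧
    s'.reg 5 = v ∧ s'.reg 9 = s.reg 9) (Runs.cond (T := 7 * len + 19) (fun hx => ?_)
      (fun hx => ?_)) ?_).mono (by omega) fun _ h => h
  · refine (Runs.const ?_).mono (T' := 7 * len + 19) (by omega) fun _ h => h
    have hx : ∑ w ∈ Finset.range n, M (v * n + w) < d := by
      simp [hdeg, e8] at hx
      omega
    refine ⟨len, L, (hf₁.setReg (by norm_num)).setReg (by norm_num), by omega, hold, ?_, ?_, ?_,
      ?_, ?_, ?_⟩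
    all_goals simp [e5, e6, e7, e8, e9, h7]
    refine ⟨fun u hu => ⟨by have := hmax.1 u hu; omega, (hmax.1 u hu).2⟩, fun u hu hdu => ?_⟩
    obtain hu | rfl : u < v ∨ u = v := by omega
    · exact hmax.2 u hu hdu
    · omega
  · have hx : d ≤ ∑ w ∈ Finset.range n, M (v * n + w) := by
      simp [hdeg, e8] at hx
      omega
    refine (Runs.seq (T := 7 * len + 17) (T' := 2) ((hf₁.setReg (x := 18) (by norm_num)).runs_extend
      (r := s.reg 7) (v := v) (by simp [e7]) h7 (by simp [e5]) hv (by simp [e6])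
      (fun u hu => (hmax.1 u hu).1) hsymm) ?_)
    rintro s₂ ⟨hreg₂, h₂⟩
    have f5 : s₂.reg 5 = v := by rw [hreg₂ 5] <;> simp [e5]
    have f6 : s₂.reg 6 = v * n := by rw [hreg₂ 6] <;> simp [e6]
    have f7 : s₂.reg 7 = s.reg 7 := by rw [hreg₂ 7] <;> simp [e7]
    have f8 : s₂.reg 8 = d := by rw [hreg₂ 8] <;> simp [e8]
    have f9 : s₂.reg 9 = s.reg 9 := by rw [hreg₂ 9] <;> simp [e9]
    obtain ⟨h0, hno, hf₂⟩ | ⟨h0, hyes, hf₂⟩ := h₂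
    · refine Runs.cond (T := 1) (fun h => absurd h0 h) fun _ => Runs.const
        ⟨len, L, hf₂.setReg (by norm_num), by omega, hold, ?_, ?_, ?_, ?_, ?_, ?_⟩
      all_goals simp [f5, f6, f7, f8, f9, h7]
      refine ⟨fun u hu => ⟨by have := hmax.1 u hu; omega, (hmax.1 u hu).2⟩, fun u hu hdu => ?_⟩
      obtain hu | rfl : u < v ∨ u = v := by omega
      · exact hmax.2 u hu hdu
      · intro _
        push Not at hno
        exact hno
    · refine Runs.cond (T := 1) (fun _ => ?_) fun h => absurd h h0
      -- Register `2` now holds `len + 1`, so that register `7` receives `len`, the number of the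
      -- new node.
      refine Runs.minus ⟨len + 1, _, hf₂.setReg (by norm_num), by omega, ?_, ?_, ?_, ?_, ?_, ?_, ?_⟩
      · intro d' hd'
        obtain ⟨k, hk, hk'⟩ := hold d' hd'
        exact ⟨k, by omega, by rwa [Function.update_of_ne (by omega)]⟩
      all_goals simp [f5, f6, f8, f9, hf₂.reg_two, hf₂.reg_one]
      refine ⟨fun u hu => ?_, fun u hu hdu hun => ?_⟩
      · obtain rfl | hu := Finset.mem_insert.1 hu
        · exact ⟨by omega, hx⟩
        · have := hmax.1 u hu
          exact ⟨by omega, this.2⟩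
      · rw [Finset.mem_insert, not_or] at hun
        obtain ⟨w, hw, hw'⟩ := hmax.2 u (by omega) hdu hun.2
        exact ⟨w, Finset.mem_insert_of_mem hw, hw'⟩
  · rintro s' ⟨len', L', hf', hl', hd', r6, r8, r7, hm', r5, r9⟩
    refine Runs.plus ⟨⟨len', L', hf'.setReg (by norm_num), hl', hd', ?_, ?_, ?_, ?_⟩, ?_, ?_, ?_, ?_⟩
    · simp [r6, hf'.reg_zero]; ring
    all_goals simp [*, hf'.reg_zero, hf'.reg_one]

/-- For every threshold `d < n`, find greedily a maximal clique of the graph induced on the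
vertices of degree at least `d`; return the largest of these cliques. -/
def Program.greedyCliques : Program :=
  .seq (.const 1 1) <| .seq (.const 2 1) <|
    .seq (.forRange 8 0 9 1 <| .seq (.const 7 0) <| .seq (.const 6 0) <|
      .forRange 5 0 10 1 .greedyStep) .output

/-- Each threshold restarts from the root, the empty clique, and passes once through all vertices.
Finished nodes are never altered, so at the end the forest contains a maximal clique for every
threshold, and the best node is at least as large as each of them. -/
theorem runs_greedyCliques (h0 : s.arr 0 = M) (h : ∀ a, a ≠ 0 → s.arr a = fun _ => 0)
    (hn : s.reg 0 = n) (hreg : ∀ x, x ≠ 0 → s.reg x = 0)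
    (hsymm : ∀ u < n, ∀ w < n, M (u * n + w) ≠ 0 → M (w * n + u) ≠ 0) :
    Runs .greedyCliques s
      (n * (n * (7 * (n ^ 2 + 1) + 6 * n + 29) + 8) + 4 * (n ^ 2 + 1) + 9) fun s' =>
      ∃ C : Finset ℕ, (∀ u, s'.arr 1 u ≠ 0 ↔ u ∈ C) ∧ (∀ u ∈ C, u < n) ∧
        (∀ u ∈ C, ∀ w ∈ C, u ≠ w → M (u * n + w) ≠ 0) ∧
        ∀ d < n, ∃ C' : Finset ℕ, C'.card ≤ C.card ∧ IsMaxAbove n M d n C' ∧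
          (∀ u ∈ C', ∀ w ∈ C', u ≠ w → M (u * n + w) ≠ 0) := by
  refine (Runs.seq_const <| Runs.seq_const <| Runs.seq (T' := 4 * (n ^ 2 + 1) + 4)
    (Runs.forRange (N := n) (T := n * (7 * (n ^ 2 + 1) + 6 * n + 29) + 5) (fun d s' =>
      ∃ len L, IsForest n M len L s' ∧ len ≤ 1 + d * n ∧
        ∀ d' < d, ∃ k < len, IsMaxAbove n M d' n (L k))
      (by norm_num) (by norm_num) (by norm_num) (by norm_num) (by norm_num) ?_ (by simp [hn])
      (by simp) ?_ ?_) ?_).mono (T := 1 + (1 + (n * (n * (7 * (n ^ 2 + 1) + 6 * n + 29) + 5 + 3) +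
        3 + (4 * (n ^ 2 + 1) + 4)))) (le_of_eq (by ring)) fun _ h => h
  · rintro d s' v w ⟨len, L, hf, h1, h2⟩
    exact ⟨len, L, (hf.setReg (by norm_num)).setReg (by norm_num), h1, h2⟩
  · refine ⟨1, fun _ => ∅, ?_, by omega, by simp⟩
    constructor <;> simp [h0, h, hn, hreg]
    all_goals intros; omega
  · rintro d hd s₁ ⟨len, L, hf, hlen, hold⟩ r8 - r1
    refine (Runs.seq_const <| Runs.seq_const <| Runs.mono (T' := n * (7 * (n ^ 2 + 1) + 6 * n + 29)
      + 3) (Runs.forRange (N := n) (T := 7 * (n ^ 2 + 1) + 6 * n + 26)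
      (fun v s' => GreedyInv n M d v s' ∧ s'.reg 9 = s₁.reg 9)
      (by norm_num) (by norm_num) (by norm_num) (by norm_num) (by norm_num) ?_
      (by simp [hf.reg_zero]) (by simp [r1]) ?_ ?_) (le_of_eq (by ring)) ?_).mono (by omega) fun _ h => h
    · rintro v s' i c ⟨⟨len, L, hf, h1, h2, h3, h4, h5, h6⟩, h9⟩
      exact ⟨⟨len, L, (hf.setReg (by norm_num)).setReg (by norm_num), h1, h2, by simpa using h3,
        by simpa using h4, by simpa using h5, by simpa using h6⟩, by simpa using h9⟩
    · refine ⟨⟨len, L, (hf.setReg (by norm_num)).setReg (by norm_num), by omega, hold, ?_, ?_, ?_,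
        ?_⟩, ?_⟩
      all_goals simp [r8]
      · have := hf.best_lt
        omega
      · simp [hf.root, IsMaxAbove]
    · rintro v hv s₂ ⟨hg, h9⟩ h5 - -
      refine (hg.runs_greedyStep hv hd h5 hsymm).mono le_rfl ?_
      rintro s₃ ⟨g1, g2, g3, g4, g5⟩
      exact ⟨⟨g1, g5.trans h9⟩, g2, g3, g4⟩
    · rintro s₂ ⟨⟨len', L', hf', hl', hold', -, h8, h7, hm⟩, -⟩
      refine ⟨⟨len', L', hf', by nlinarith, fun d' hd' => ?_⟩, h8, hf'.reg_zero, hf'.reg_one⟩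
      obtain hd' | rfl : d' < d ∨ d' = d := by omega
      · exact hold' d' hd'
      · exact ⟨_, h7, hm⟩
  · rintro s₁ ⟨len, L, hf, hlen, hold⟩
    refine hf.runs_output.mono (by nlinarith) fun s' hs' => ?_
    refine ⟨L (s₁.reg 4), hs', hf.lt _ hf.best_lt, hf.clique _ hf.best_lt, fun d hd => ?_⟩
    obtain ⟨k, hk, hk'⟩ := hold d hd
    exact ⟨L k, hf.best ▸ hf.le_best k hk, hk', hf.clique k hk⟩

end RAM

/-! ### Enumeration of all cliques up to a cap. -/

namespace RAM

variable {n : ℕ} {M : ℕ → ℕ} {len : ℕ} {L : ℕ → Finset ℕ} {s : State}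

open Classical in
/-- The cliques of the graph with adjacency matrix `M`. -/
noncomputable def cliques (n : ℕ) (M : ℕ → ℕ) : Finset (Finset ℕ) :=
  (Finset.range n).powerset.filter fun C => ∀ u ∈ C, ∀ w ∈ C, u ≠ w → M (u * n + w) ≠ 0

theorem mem_cliques {C : Finset ℕ} : C ∈ cliques n M ↔ (∀ u ∈ C, u < n) ∧
    ∀ u ∈ C, ∀ w ∈ C, u ≠ w → M (u * n + w) ≠ 0 := by
  simp [cliques, Finset.subset_iff]

theorem IsForest.len_le (h : IsForest n M len L s)
    (hinj : ∀ k < len, ∀ l < len, L k = L l → k = l) : len ≤ (cliques n M).card := by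
  have := Finset.card_le_card_of_injOn (s := Finset.range len) (t := cliques n M) L
    (fun k hk => by
      have hk := Finset.mem_range.1 hk
      exact mem_cliques.2 ⟨h.lt k hk, h.clique k hk⟩)
    (fun k hk l hl => hinj k (Finset.mem_range.1 hk) l (Finset.mem_range.1 hl))
  simpa using this

/-- The state during the enumeration of cliques: all cliques on the vertices below `v` have been
found, unless there are too many cliques. -/
def EnumInv (n : ℕ) (M : ℕ → ℕ) (cap v : ℕ) (s : State) : Prop :=
  ∃ len L, IsForest n M len L s ∧ len ≤ cap ∧ (∀ k < len, ∀ l < len, L k = L l → k = l) ∧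
    (∀ k < len, ∀ u ∈ L k, u < v) ∧ s.reg 6 = v * n ∧ s.reg 26 = cap ∧
    ((cliques n M).card < cap → ∀ C ∈ cliques n M, (∀ u ∈ C, u < v) → ∃ k < len, L k = C)

/-- The state while the first `m` cliques, which are those below `v`, are extended by `v`. -/
def EnumStepInv (n : ℕ) (M : ℕ → ℕ) (cap v m r : ℕ) (s : State) : Prop :=
  ∃ len L, IsForest n M len L s ∧ m ≤ len ∧ len ≤ cap ∧
    (∀ k < len, ∀ l < len, L k = L l → k = l) ∧
    (∀ k < m, ∀ u ∈ L k, u < v) ∧ (∀ k < len, m ≤ k → ∃ r' < r, L k = insert v (L r')) ∧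
    s.reg 5 = v ∧ s.reg 6 = v * n ∧ s.reg 26 = cap ∧
    ((cliques n M).card < cap → ∀ C ∈ cliques n M, (∀ u ∈ C, u < v) → ∃ k < m, L k = C) ∧
    ((cliques n M).card < cap → ∀ l < r, insert v (L l) ∈ cliques n M →
      ∃ k < len, L k = insert v (L l))

/-- Extend the node in register `7` by the vertex in register `5`, if the number of nodes is less
than the value of register `26`. -/
def Program.enumStep : Program :=
  .seq (.minus 18 26 2) (.cond 18 .extend (.const 19 0))

theorem EnumStepInv.runs_enumStep {cap v m r : ℕ} (hv : v < n) (hr : r < m) (h7 : s.reg 7 = r)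
    (hsymm : ∀ u < n, ∀ w < n, M (u * n + w) ≠ 0 → M (w * n + u) ≠ 0)
    (h : EnumStepInv n M cap v m r s) :
    Runs .enumStep s (7 * cap + 19) fun s' => EnumStepInv n M cap v m (r + 1) s' ∧
      s'.reg 7 = r ∧ s'.reg 8 = s.reg 8 ∧ s'.reg 1 = 1 ∧ s'.reg 10 = s.reg 10 := by
  obtain ⟨len, L, hf, hml, hlen, hinj, hlt, hnew, h5, h6, h26, hall, hext⟩ := h
  refine Runs.mono (T := 1 + (7 * len + 17 + 1)) (Runs.seq_minus <| Runs.cond (fun hx => ?_)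
    (fun hx => ?_)) (by omega) fun _ h => h
  · have hx : len < cap := by
      simp [h26, hf.reg_two] at hx
      omega
    have hrl : r < len := by omega
    refine ((hf.setReg (x := 18) (by norm_num)).runs_extend
      (r := r) (v := v) (by simp [h7]) hrl (by simp [h5]) hv (by simp [h6])
      (fun u hu => hlt r hr u hu) hsymm).mono le_rfl ?_
    rintro s₂ ⟨hreg₂, h₂⟩
    have f5 : s₂.reg 5 = v := by rw [hreg₂ 5] <;> simp [h5]
    have f6 : s₂.reg 6 = v * n := by rw [hreg₂ 6] <;> simp [h6]
    have f7 : s₂.reg 7 = r := by rw [hreg₂ 7] <;> simp [h7]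
    have f8 : s₂.reg 8 = s.reg 8 := by rw [hreg₂ 8] <;> simp
    have f10 : s₂.reg 10 = s.reg 10 := by rw [hreg₂ 10] <;> simp
    have f26 : s₂.reg 26 = cap := by rw [hreg₂ 26] <;> simp [h26]
    obtain ⟨-, hno, hf₂⟩ | ⟨-, hyes, hf₂⟩ := h₂
    · refine ⟨⟨len, L, hf₂, hml, hlen, hinj, hlt, fun k hk hk' => ?_, f5, f6, f26, hall, ?_⟩,
        f7, f8, hf₂.reg_one, f10⟩
      · obtain ⟨r', h1, h2⟩ := hnew k hk hk'
        exact ⟨r', by omega, h2⟩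
      · intro hc l hl hlc
        obtain hl | rfl : l < r ∨ l = r := by omega
        · exact hext hc l hl hlc
        · refine absurd (fun u hu => ?_) hno
          exact (mem_cliques.1 hlc).2 v (Finset.mem_insert_self _ _) u
            (Finset.mem_insert_of_mem hu) (by have := hlt l hr u hu; omega)
    · have hold : ∀ k < len, Function.update L len (insert v (L r)) k = L k := fun k hk =>
        Function.update_of_ne (by omega) _ _
      -- Nodes below `m` do not contain `v`. Later nodes have the form `insert v (L r')` with `r' <
      -- r`, and distinct nodes below `m` remain distinct after adding `v`.
      have hne : ∀ k < len, L k ≠ insert v (L r) := by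
        intro k hk he
        by_cases hkm : k < m
        · exact (hlt k hkm v (he ▸ Finset.mem_insert_self _ _)).false
        · obtain ⟨r', h1, h2⟩ := hnew k hk (by omega)
          have hv1 : v ∉ L r := fun hh => (hlt r hr v hh).false
          have hv2 : v ∉ L r' := fun hh => (hlt r' (by omega) v hh).false
          have : L r' = L r := by
            rw [← Finset.erase_insert hv1, ← Finset.erase_insert hv2, ← h2, he]
          have := hinj r' (by omega) r hrl this
          omega
      refine ⟨⟨len + 1, _, hf₂, by omega, by omega, ?_, ?_, ?_, f5, f6, f26, ?_, ?_⟩,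
        f7, f8, hf₂.reg_one, f10⟩
      · intro k hk l hl hkl
        rcases Nat.lt_succ_iff_lt_or_eq.1 hk with hk | rfl <;>
          rcases Nat.lt_succ_iff_lt_or_eq.1 hl with hl | rfl
        · rw [hold k hk, hold l hl] at hkl
          exact hinj k hk l hl hkl
        · rw [hold k hk, Function.update_self] at hkl
          exact absurd hkl (hne k hk)
        · rw [hold l hl, Function.update_self] at hkl
          exact absurd hkl.symm (hne l hl)
        · rfl
      · intro k hk
        rw [hold k (by omega)]
        exact hlt k hk
      · intro k hk hk'
        obtain hk | rfl : k < len ∨ k = len := by omega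
        · obtain ⟨r', h1, h2⟩ := hnew k hk hk'
          exact ⟨r', by omega, by rw [hold k hk, hold r' (by omega), h2]⟩
        · exact ⟨r, by omega, by rw [Function.update_self, hold r (by omega)]⟩
      · intro hc C hC hCv
        obtain ⟨k, hk, hk'⟩ := hall hc C hC hCv
        exact ⟨k, hk, by rw [hold k (by omega), hk']⟩
      · intro hc l hl hlc
        rw [hold l (by omega)] at hlc ⊢
        obtain hl | rfl : l < r ∨ l = r := by omega
        · obtain ⟨k, hk, hk'⟩ := hext hc l hl hlc
          exact ⟨k, by omega, by rw [hold k hk, hk']⟩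
        · exact ⟨len, by omega, by rw [Function.update_self]⟩
  · have hx : cap ≤ len := by
      simp [h26, hf.reg_two] at hx
      omega
    -- Distinct nodes are distinct cliques, so a full forest means that there are at least `cap`
    -- cliques, and the completeness clauses become vacuous.
    have hcap : ¬ (cliques n M).card < cap := by
      have := hf.len_le hinj
      omega
    refine (Runs.const ?_).mono (T' := 7 * len + 17) (by omega) fun _ h => h
    refine ⟨⟨len, L, (hf.setReg (by norm_num)).setReg (by norm_num), hml, hlen, hinj, hlt,
      fun k hk hk' => ?_, by simpa using h5, by simpa using h6, by simpa using h26,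
      fun hc => absurd hc hcap, fun hc => absurd hc hcap⟩, by simpa using h7, by simp,
      by simpa using hf.reg_one, by simp⟩
    obtain ⟨r', h1, h2⟩ := hnew k hk hk'
    exact ⟨r', by omega, h2⟩

/-- Extend all nodes by the vertex in register `5`. -/
def Program.enumVertex : Program :=
  .seq (.const 19 0) <| .seq (.plus 8 2 19) <| .seq (.forRange 7 8 9 1 .enumStep) (.plus 6 6 0)

/-- The number of nodes is frozen in register `8` before the round, so only cliques below `v` are
extended. A clique with largest vertex `v` is obtained from the clique left after deleting `v`,
which is already present. -/
theorem EnumInv.runs_enumVertex {cap v : ℕ} (hv : v < n) (h5 : s.reg 5 = v)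
    (hsymm : ∀ u < n, ∀ w < n, M (u * n + w) ≠ 0 → M (w * n + u) ≠ 0)
    (h : EnumInv n M cap v s) :
    Runs .enumVertex s (cap * (7 * cap + 22) + 6) fun s' => EnumInv n M cap (v + 1) s' ∧
      s'.reg 5 = v ∧ s'.reg 0 = n ∧ s'.reg 1 = 1 := by
  obtain ⟨len, L, hf, hlen, hinj, hlt, h6, h26, hall⟩ := h
  have hT : len * (7 * cap + 19 + 3) ≤ cap * (7 * cap + 22) := Nat.mul_le_mul hlen (by omega)
  refine (Runs.seq_const <| Runs.seq_plus <| Runs.seq (T := len * (7 * cap + 19 + 3) + 3) (T' := 1)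
    (Runs.forRange (EnumStepInv n M cap v len)
    (by norm_num) (by norm_num) (by norm_num) (by norm_num) (by norm_num) ?_
      (by simp [hf.reg_two]) (by simp [hf.reg_one]) ?_ ?_) ?_).mono (by omega) fun _ h => h
  · rintro k s' i c ⟨len, L, hf, g1, g2, g3, g4, g5, g6, g7, g8, g9, g10⟩
    exact ⟨len, L, (hf.setReg (by norm_num)).setReg (by norm_num), g1, g2, g3, g4, g5,
      by simpa using g6, by simpa using g7, by simpa using g8, g9, g10⟩
  · exact ⟨len, L, (hf.setReg (by norm_num)).setReg (by norm_num), le_rfl, hlen, hinj, hlt,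
      fun k hk hk' => by omega, by simpa using h5, by simpa using h6, by simpa using h26, hall,
      by simp⟩
  · rintro r hr s₁ hs₁ h7 h8 -
    refine (hs₁.runs_enumStep hv hr h7 hsymm).mono le_rfl ?_
    rintro s₂ ⟨g1, g2, g3, g4, -⟩
    exact ⟨g1, g2, g3.trans h8, g4⟩
  · rintro s₁ ⟨len₁, L₁, hf₁, g1, g2, g3, g4, g5, g6, g7, g8, g9, g10⟩
    refine Runs.plus ⟨⟨len₁, L₁, hf₁.setReg (by norm_num), g2, g3, ?_, ?_, by simpa using g8,
      fun hc C hC hCv => ?_⟩, by simpa using g6, by simpa using hf₁.reg_zero,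
      by simpa using hf₁.reg_one⟩
    · intro k hk u hu
      by_cases hkl : k < len
      · have := g4 k hkl u hu
        omega
      · obtain ⟨r, hr, hr'⟩ := g5 k hk (by omega)
        rw [hr'] at hu
        obtain rfl | hu := Finset.mem_insert.1 hu
        · omega
        · have := g4 r hr u hu
          omega
    · simp [g7, hf₁.reg_zero]; ring
    · by_cases hvC : v ∈ C
      · have hC' := mem_cliques.1 hC
        obtain ⟨l, hl, hl'⟩ := g9 hc (C.erase v) (mem_cliques.2
          ⟨fun u hu => hC'.1 u (Finset.mem_of_mem_erase hu), fun u hu w hw =>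
            hC'.2 u (Finset.mem_of_mem_erase hu) w (Finset.mem_of_mem_erase hw)⟩) (by
          intro u hu
          have := hCv u (Finset.mem_of_mem_erase hu)
          have := Finset.ne_of_mem_erase hu
          omega)
        have := g10 hc l hl
        rw [hl', Finset.insert_erase hvC] at this
        exact this hC
      · obtain ⟨k, hk, hk'⟩ := g9 hc C hC (by
          intro u hu
          have := hCv u hu
          have : u ≠ v := by rintro rfl; exact hvC hu
          omega)
        exact ⟨k, by omega, hk'⟩

/-- Register `z` receives the product of the registers `x` and `y`. -/
def Program.times (z x y : ℕ) : Program :=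
  .seq (.const z 0) <| .forRange 24 y 25 1 (.plus z z x)

/-- Multiplication is repeated addition and costs time linear in the value of the second factor;
this is harmless because that value is polynomial in `n`. -/
theorem runs_times {z x y : ℕ} (hx : x < 24) (hy : y < 24) (hz : 26 ≤ z ∨ z < 24) (hzx : z ≠ x)
    (hzy : z ≠ y) (hz1 : z ≠ 1) (h1 : s.reg 1 = 1) :
    Runs (.times z x y) s (4 * s.reg y + 4) fun s' => s'.arr = s.arr ∧
      s'.reg z = s.reg x * s.reg y ∧ ∀ w, w ≠ z → w < 24 → s'.reg w = s.reg w := by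
  have hz2 : z ≠ 24 ∧ z ≠ 25 := by omega
  refine (Runs.seq_const <| Runs.mono (Runs.forRange (N := s.reg y) (T := 1)
    (fun k s' => s'.arr = s.arr ∧
      s'.reg z = s.reg x * k ∧ ∀ w, w ≠ z → w < 24 → s'.reg w = s.reg w)
    (by norm_num) (by omega) (by norm_num) (by omega) (by norm_num) ?_
    (by simp [hzy.symm]) (by simp [hz1.symm, h1]) ?_ ?_) (T' := 4 * s.reg y + 3) (by omega)
    fun _ h => h).mono (by omega) fun _ h => h
  · rintro k s' v w ⟨g1, g2, g3⟩
    refine ⟨by simpa using g1, by simpa [hz2] using g2, fun w hw hw' => ?_⟩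
    have : w ≠ 24 ∧ w ≠ 25 := by omega
    simpa [this] using g3 w hw hw'
  · exact ⟨rfl, by simp, fun w hw hw' => by simp [hw]⟩
  · rintro k hk s' ⟨g1, g2, g3⟩ hi hm he
    refine Runs.plus ⟨⟨by simpa using g1, ?_, fun w hw hw' => ?_⟩, ?_, ?_, ?_⟩
    · simp [g2, g3 x hzx.symm hx]; ring
    · simpa [hw] using g3 w hw hw'
    · simpa [hz2.1.symm] using hi
    · simpa [hzy.symm] using hm
    · simpa [hz1.symm] using he

/-- Enumerate the cliques, stopping when there are more than `(n + 2) ^ 4` of them, and return the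
largest one found. -/
def Program.enumCliques : Program :=
  .seq (.const 1 1) <| .seq (.const 2 1) <| .seq (.plus 22 0 1) <| .seq (.plus 22 22 1) <|
    .seq (.times 23 22 22) <| .seq (.times 26 23 23) <|
    .seq (.const 6 0) <| .seq (.forRange 5 0 10 1 .enumVertex) .output

/-- The cap bounds the number of nodes on every input, hence also the running time. Only the claim
that the output is a largest clique requires few cliques. -/
theorem runs_enumCliques (h0 : s.arr 0 = M) (h : ∀ a, a ≠ 0 → s.arr a = fun _ => 0)
    (hn : s.reg 0 = n) (hreg : ∀ x, x ≠ 0 → s.reg x = 0)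
    (hsymm : ∀ u < n, ∀ w < n, M (u * n + w) ≠ 0 → M (w * n + u) ≠ 0) :
    Runs .enumCliques s
      (n * ((n + 2) ^ 4 * (7 * (n + 2) ^ 4 + 22) + 9) + 4 * (n + 2) ^ 4 + 4 * (n + 2) ^ 2 +
        4 * (n + 2) + 20) fun s' =>
      ∃ C : Finset ℕ, (∀ u, s'.arr 1 u ≠ 0 ↔ u ∈ C) ∧ (∀ u ∈ C, u < n) ∧
        (∀ u ∈ C, ∀ w ∈ C, u ≠ w → M (u * n + w) ≠ 0) ∧
        ((cliques n M).card < (n + 2) ^ 4 → ∀ C' ∈ cliques n M, C'.card ≤ C.card) := by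
  have hT : n * ((n + 2) ^ 4 * (7 * (n + 2) ^ 4 + 22) + 6 + 3) =
    n * ((n + 2) ^ 4 * (7 * (n + 2) ^ 4 + 22) + 9) := by ring
  refine (Runs.seq_const <| Runs.seq_const <| Runs.seq_plus <| Runs.seq_plus <|
    Runs.seq (T := 4 * (n + 2) + 4) (T' := 4 * (n + 2) ^ 2 + 4 + (1 + (n * ((n + 2) ^ 4 *
      (7 * (n + 2) ^ 4 + 22) + 6 + 3) + 3 + (4 * (n + 2) ^ 4 + 4))))
    ((runs_times (by norm_num) (by norm_num) (by norm_num) (by norm_num) (by norm_num)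
      (by norm_num) (by simp)).mono (by simp [hn]) fun _ h => h) ?_).mono (by omega) fun _ h => h
  rintro s₁ ⟨g1, g2, g3⟩
  simp [hn] at g1 g2
  have e1 : s₁.reg 1 = 1 := by simp [g3 1]
  have e23 : s₁.reg 23 = (n + 2) ^ 2 := by rw [g2]; ring
  refine Runs.seq ((runs_times (by norm_num) (by norm_num) (by norm_num) (by norm_num)
    (by norm_num) (by norm_num) e1).mono (by simp [e23]) fun _ h => h) ?_
  rintro s₂ ⟨k1, k2, k3⟩
  rw [e23] at k2
  refine Runs.seq_const <| Runs.seq (R := EnumInv n M ((n + 2) ^ 4) n) (Runs.forRange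
    (fun v s' => EnumInv n M ((n + 2) ^ 4) v s')
    (by norm_num) (by norm_num) (by norm_num) (by norm_num) (by norm_num) ?_
      (by simp [k3 0, g3 0, hn]) (by simp [k3 1, e1]) ?_ ?_) ?_
  · rintro v s' i c ⟨len, L, hf, h1, h2, h3, h4, h5, h6⟩
    exact ⟨len, L, (hf.setReg (by norm_num)).setReg (by norm_num), h1, h2, h3, by simpa using h4,
        by simpa using h5, h6⟩
  · refine ⟨1, fun _ => ∅, ?_, Nat.one_le_pow _ _ (by omega), by omega, by simp, by simp, ?_, ?_⟩
    · constructor <;> simp [k1, g1, h0, h, hn, hreg, k3, g3]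
      all_goals intros; omega
    · simp [k2]; ring
    · rintro - C - hC
      refine ⟨0, by norm_num, ?_⟩
      rw [eq_comm, Finset.eq_empty_iff_forall_notMem]
      exact fun u hu => by simpa using hC u hu
  · rintro v hv s₃ hs₃ h5 - -
    exact hs₃.runs_enumVertex hv h5 hsymm
  · rintro s₃ ⟨len, L, hf, h1, h2, h3, h4, h5, h6⟩
    refine hf.runs_output.mono (by omega) fun s' hs' => ?_
    refine ⟨L (s₃.reg 4), hs', hf.lt _ hf.best_lt, hf.clique _ hf.best_lt, fun hc C hC => ?_⟩
    obtain ⟨k, hk, rfl⟩ := h6 hc C hC (mem_cliques.1 hC).1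
    exact hf.best ▸ hf.le_best k hk

end RAM

/-! ### From programs to polynomial time graph algorithms. -/

namespace RAM

/-- The program is specified by a relation `R` only; the function `f` is read off from the halting
states. -/
theorem exists_computesInPolyTime (P : Program) (p : Polynomial ℕ)
    (R : (n : ℕ) → SimpleGraph (Fin n) → Finset (Fin n) → Prop)
    (h : ∀ n G, Runs P (graphInput G) (p.eval n) fun s => R n G (vertexSetOutput n s)) :
    ∃ f, ComputesInPolyTime P f ∧ ∀ n G, R n G (f n G) := by
  choose t s h1 h2 h3 using h
  exact ⟨fun n G => vertexSetOutput n (s n G), ⟨p, fun n G => ⟨_, _, h1 n G, h2 n G, rfl⟩⟩, h3⟩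

section graphInput

variable {n : ℕ} (G : SimpleGraph (Fin n))

open Classical in
theorem graphInput_arr_zero (u w : Fin n) :
    (graphInput G).arr 0 (u * n + w) = if G.Adj u w then 1 else 0 := by
  have : (∃ i j : Fin n, (u * n + w : ℕ) = (i : ℕ) * n + (j : ℕ) ∧ G.Adj i j) ↔ G.Adj u w := by
    constructor
    · rintro ⟨i, j, h, hA⟩
      have hn : 0 < n := u.pos
      -- Division by `n` recovers the row, since columns are less than `n`.
      have h1 : (u : ℕ) = i := by
        have := congrArg (· / n) h
        simpa [Nat.mul_comm _ n, Nat.mul_add_div hn, Nat.div_eq_of_lt] using this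
      have h2 : (w : ℕ) = j := by
        rw [h1] at h
        omega
      rwa [Fin.ext h1, Fin.ext h2]
    · exact fun h => ⟨u, w, rfl, h⟩
  simp [graphInput, this]

theorem graphInput_arr_zero_ne {u w : ℕ} (hu : u < n) (hw : w < n) :
    (graphInput G).arr 0 (u * n + w) ≠ 0 ↔ G.Adj ⟨u, hu⟩ ⟨w, hw⟩ := by
  classical
  rw [graphInput_arr_zero G ⟨u, hu⟩ ⟨w, hw⟩]
  simp

theorem graphInput_symm (u : ℕ) (hu : u < n) (w : ℕ) (hw : w < n)
    (h : (graphInput G).arr 0 (u * n + w) ≠ 0) : (graphInput G).arr 0 (w * n + u) ≠ 0 := by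
  rw [graphInput_arr_zero_ne G hu hw] at h
  rw [graphInput_arr_zero_ne G hw hu]
  exact h.symm

theorem graphInput_arr_ne (a : ℕ) (ha : a ≠ 0) : (graphInput G).arr a = fun _ => 0 := by
  ext; simp [graphInput, ha]

theorem graphInput_reg_ne (x : ℕ) (hx : x ≠ 0) : (graphInput G).reg x = 0 := by
  simp [graphInput, hx]

open Classical in
theorem sum_graphInput (u : Fin n) : ∑ w ∈ Finset.range n, (graphInput G).arr 0 (u * n + w) =
    (Finset.univ.filter fun w => G.Adj u w).card := by
  rw [Finset.sum_range, Finset.card_filter]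
  exact Finset.sum_congr rfl fun w _ => graphInput_arr_zero G u w

/-- The vertices of a graph on `Fin n` whose numbers lie in a given set. -/
def toFin (n : ℕ) (C : Finset ℕ) : Finset (Fin n) := Finset.univ.filter fun v => (v : ℕ) ∈ C

@[simp] theorem mem_toFin {C : Finset ℕ} {v : Fin n} : v ∈ toFin n C ↔ (v : ℕ) ∈ C := by
  simp [toFin]

theorem card_toFin {C : Finset ℕ} (h : ∀ u ∈ C, u < n) : (toFin n C).card = C.card := by
  rw [← Finset.card_map Fin.valEmbedding]
  congr 1
  ext u
  simp only [Finset.mem_map, mem_toFin, Fin.valEmbedding_apply]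
  exact ⟨by rintro ⟨a, ha, rfl⟩; exact ha, fun hu => ⟨⟨u, h u hu⟩, hu, rfl⟩⟩

theorem isClique_toFin {C : Finset ℕ}
    (h : ∀ u ∈ C, ∀ w ∈ C, u ≠ w → (graphInput G).arr 0 (u * n + w) ≠ 0) :
    G.IsClique (toFin n C : Set (Fin n)) := by
  intro u hu w hw huw
  exact (graphInput_arr_zero_ne G u.2 w.2).1 (h u (by simpa using hu) w (by simpa using hw)
    (by simpa [Fin.ext_iff] using huw))

theorem vertexSetOutput_eq {s : State} {C : Finset ℕ} (h : ∀ u, s.arr 1 u ≠ 0 ↔ u ∈ C) :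
    vertexSetOutput n s = toFin n C := by
  ext v; simp [vertexSetOutput, h]

end graphInput

open Classical in
/-- A polynomial time algorithm that finds a clique which is at least as large as some maximal
clique of the graph induced on the vertices of degree at least `d`, for every `d`. -/
theorem exists_greedyCliques : ∃ A f, ComputesInPolyTime A f ∧
    ∀ n (G : SimpleGraph (Fin n)), G.IsClique (f n G : Set (Fin n)) ∧
      ∀ d : ℕ, ∃ C : Finset (Fin n), C.card ≤ (f n G).card ∧
        (∀ u ∈ C, d ≤ (Finset.univ.filter fun w => G.Adj u w).card) ∧
        ∀ u, d ≤ (Finset.univ.filter fun w => G.Adj u w).card → u ∉ C → ∃ w ∈ C, ¬ G.Adj u w := by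
  refine ⟨.greedyCliques, exists_computesInPolyTime .greedyCliques
    (.X * (.X * (7 * (.X ^ 2 + 1) + 6 * .X + 29) + 8) + 4 * (.X ^ 2 + 1) + 9)
    (fun n G F => G.IsClique (F : Set (Fin n)) ∧
      ∀ d : ℕ, ∃ C : Finset (Fin n), C.card ≤ F.card ∧
        (∀ u ∈ C, d ≤ (Finset.univ.filter fun w => G.Adj u w).card) ∧
        ∀ u, d ≤ (Finset.univ.filter fun w => G.Adj u w).card → u ∉ C → ∃ w ∈ C, ¬ G.Adj u w)
    fun n G => ?_⟩
  refine (runs_greedyCliques (n := n) rfl (graphInput_arr_ne G) rfl (graphInput_reg_ne G)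
    (graphInput_symm G)).mono (by simp) ?_
  rintro s ⟨C, h1, h2, h3, h4⟩
  rw [vertexSetOutput_eq h1, card_toFin h2]
  refine ⟨isClique_toFin G h3, fun d => ?_⟩
  by_cases hd : d < n
  · obtain ⟨C', g1, g2, g3⟩ := h4 d hd
    refine ⟨toFin n C', by rwa [card_toFin fun u hu => (g2.1 u hu).1], fun u hu => ?_,
      fun u hu huC => ?_⟩
    · rw [← sum_graphInput]
      exact (g2.1 u (by simpa using hu)).2
    · rw [← sum_graphInput] at hu
      obtain ⟨w, hw, hw'⟩ := g2.2 u u.2 hu (by simpa using huC)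
      have hwn := (g2.1 w hw).1
      refine ⟨⟨w, hwn⟩, by simpa using hw, ?_⟩
      rw [← graphInput_arr_zero_ne G u.2 hwn]
      simpa using hw'
  -- A degree is less than `n`, so for `d ≥ n` no vertex qualifies and the empty clique is maximal.
  · refine ⟨∅, by simp, by simp, fun u hu => ?_⟩
    have : (Finset.univ.filter fun w => G.Adj u w).card < (Finset.univ : Finset (Fin n)).card :=
      Finset.card_lt_card ⟨Finset.subset_univ _, fun h => by simpa using h (Finset.mem_univ u)⟩
    simp at this
    omega

open Classical in
/-- A polynomial time algorithm that finds a clique which is of largest size if there are less than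
`(n + 2) ^ 4` cliques. -/
theorem exists_enumCliques : ∃ A f, ComputesInPolyTime A f ∧
    ∀ n (G : SimpleGraph (Fin n)), G.IsClique (f n G : Set (Fin n)) ∧
      ((Finset.univ.filter fun C : Finset (Fin n) => G.IsClique (C : Set (Fin n))).card <
        (n + 2) ^ 4 → G.cliqueNum ≤ (f n G).card) := by
  refine ⟨.enumCliques, exists_computesInPolyTime .enumCliques
    (.X * ((.X + 2) ^ 4 * (7 * (.X + 2) ^ 4 + 22) + 9) + 4 * (.X + 2) ^ 4 + 4 * (.X + 2) ^ 2 +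
        4 * (.X + 2) + 20)
    (fun n G F => G.IsClique (F : Set (Fin n)) ∧
      ((Finset.univ.filter fun C : Finset (Fin n) => G.IsClique (C : Set (Fin n))).card <
        (n + 2) ^ 4 → G.cliqueNum ≤ F.card)) fun n G => ?_⟩
  refine (runs_enumCliques (n := n) rfl (graphInput_arr_ne G) rfl (graphInput_reg_ne G)
    (graphInput_symm G)).mono (by simp) ?_
  rintro s ⟨C, h1, h2, h3, h4⟩
  rw [vertexSetOutput_eq h1, card_toFin h2]
  refine ⟨isClique_toFin G h3, fun hc => ?_⟩
  have hcard : (cliques n ((graphInput G).arr 0)).card ≤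
      (Finset.univ.filter fun C : Finset (Fin n) => G.IsClique (C : Set (Fin n))).card := by
    refine Finset.card_le_card_of_injOn (toFin n) (fun C hC => ?_) (fun C hC C' hC' he => ?_)
    · simpa using isClique_toFin G (mem_cliques.1 hC).2
    · ext u
      have e (h : u < n) := congrArg (fun S => (⟨u, h⟩ : Fin n) ∈ S) he
      simp only [mem_toFin, eq_iff_iff] at e
      exact ⟨fun h => (e ((mem_cliques.1 hC).1 u h)).1 h,
        fun h => (e ((mem_cliques.1 hC').1 u h)).2 h⟩
  obtain ⟨K, hK⟩ := G.exists_isNClique_cliqueNum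
  rw [← hK.card_eq, ← Finset.card_map Fin.valEmbedding]
  refine h4 (hcard.trans_lt hc) _ (mem_cliques.2 ⟨fun u hu => ?_, ?_⟩)
  · obtain ⟨u, -, rfl⟩ := Finset.mem_map.1 hu
    exact u.2
  · rintro u hu w hw huw
    obtain ⟨u, hu', rfl⟩ := Finset.mem_map.1 hu
    obtain ⟨w, hw', rfl⟩ := Finset.mem_map.1 hw
    exact (graphInput_arr_zero_ne G u.2 w.2).2 (hK.isClique hu' hw' fun h => huw (by rw [h]))

end RAM

/-! ### Independence, Chernoff bounds and limits of probabilities. -/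

namespace PowerLawGraph

open ProbabilityTheory ENNReal

/-- The uniform distribution on `[0, 1]`. -/
noncomputable abbrev unif : Measure ℝ := (volume : Measure ℝ).restrict (Set.Icc 0 1)

instance : IsProbabilityMeasure unif := ⟨by simp [unif]⟩

instance (μ : Measure ℝ) [IsProbabilityMeasure μ] (n : ℕ) :
    IsProbabilityMeasure (sampleMeasure μ n) := by
  unfold sampleMeasure
  infer_instance

theorem unif_real_Iio {p : ℝ} (h0 : 0 ≤ p) (h1 : p ≤ 1) : unif.real (Set.Iio p) = p := by
  rw [measureReal_def, Measure.restrict_apply measurableSet_Iio]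
  have : Set.Iio p ∩ Set.Icc 0 1 = Set.Ico 0 p := by
    ext x; simp only [Set.mem_inter_iff, Set.mem_Iio, Set.mem_Icc, Set.mem_Ico]
    constructor
    · tauto
    · rintro ⟨h2, h3⟩; exact ⟨h3, h2, by linarith⟩
  rw [this]
  simp [h0]

theorem unif_Iio {p : ℝ} (h0 : 0 ≤ p) (h1 : p ≤ 1) : unif (Set.Iio p) = ENNReal.ofReal p := by
  rw [← ofReal_measureReal, unif_real_Iio h0 h1]

theorem unif_Ici {p : ℝ} (h0 : 0 ≤ p) (h1 : p ≤ 1) :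
    unif (Set.Ici p) = ENNReal.ofReal (1 - p) := by
  rw [← Set.compl_Iio, prob_compl_eq_one_sub measurableSet_Iio, unif_Iio h0 h1,
    ENNReal.ofReal_sub _ h0, ofReal_one]

theorem edgeProb_nonneg {b : ℝ} (hb : 0 ≤ b) (n : ℕ) {x y : ℝ} (hx : 0 ≤ x) (hy : 0 ≤ y) :
    0 ≤ edgeProb b n x y := by
  have : 0 ≤ b * (x * y) / n := by positivity
  simp only [edgeProb, sub_nonneg, Real.exp_le_one_iff]
  linarith

theorem edgeProb_le_one (b : ℝ) (n : ℕ) (x y : ℝ) : edgeProb b n x y ≤ 1 := by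
  simp only [edgeProb]
  linarith [Real.exp_pos (-(b * (x * y) / n))]

theorem edgeProb_mono {b : ℝ} (hb : 0 ≤ b) (n : ℕ) {x y x' y' : ℝ} (hx : 0 ≤ x) (hy : 0 ≤ y)
    (hxx : x ≤ x') (hyy : y ≤ y') : edgeProb b n x y ≤ edgeProb b n x' y' := by
  simp only [edgeProb]
  gcongr
  linarith

theorem edgeProb_le (b : ℝ) (n : ℕ) (x y : ℝ) : edgeProb b n x y ≤ b * (x * y) / n := by
  simp only [edgeProb]
  linarith [Real.add_one_le_exp (-(b * (x * y) / n))]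

@[fun_prop]
theorem measurable_edgeProb {Ω : Type*} [MeasurableSpace Ω] (b : ℝ) (n : ℕ) {f g : Ω → ℝ}
    (hf : Measurable f) (hg : Measurable g) : Measurable fun ω => edgeProb b n (f ω) (g ω) := by
  unfold edgeProb
  fun_prop

theorem measurableSet_adj (b : ℝ) (n : ℕ) (i j : Fin n) :
    MeasurableSet {ω : Sample n | (randomGraph b n ω).Adj i j} := by
  by_cases hij : i = j
  · simp [hij]
  · simp only [randomGraph, ne_eq, hij, not_false_eq_true, true_and]
    exact measurableSet_lt (by fun_prop) (by fun_prop)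

/-- Integrals of products of functions of distinct coordinates. -/
theorem lintegral_pi_prod {ι κ : Type*} [Fintype ι] (ρ : Measure ℝ) [IsProbabilityMeasure ρ]
    {g : κ → ι} (hg : g.Injective) (f : κ → ℝ → ℝ≥0∞) (hf : ∀ j, Measurable (f j))
    (s : Finset κ) :
    ∫⁻ u : ι → ℝ, ∏ j ∈ s, f j (u (g j)) ∂(Measure.pi fun _ => ρ) =
      ∏ j ∈ s, ∫⁻ x, f j x ∂ρ := by
  have h1 : iIndepFun (fun (i : ι) (u : ι → ℝ) => u i) (Measure.pi fun _ => ρ) :=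
    iIndepFun_pi (X := fun _ x => x) fun _ => aemeasurable_id'
  have h2 := (h1.precomp hg).comp f hf
  have h3 := lintegral_prod_eq_prod_lintegral_of_indepFun s _ h2 fun j =>
    (hf j).comp (measurable_pi_apply _)
  simp only [Function.comp_def] at h3
  rw [h3]
  refine Finset.prod_congr rfl fun j _ => ?_
  have := (measurePreserving_eval (fun _ : ι => ρ) (g j)).lintegral_comp (hf j)
  simpa [Function.eval] using this

/-- Tonelli's theorem: a bound on the conditional probability given the weights is integrated over
the weights. -/
theorem sampleMeasure_le_lintegral (μ : Measure ℝ) [IsProbabilityMeasure μ] {n : ℕ}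
    {E : Set (Sample n)} (hE : MeasurableSet E) (g : (Fin n → ℝ) → ℝ≥0∞)
    (h : ∀ᵐ x ∂(Measure.pi fun _ : Fin n => μ),
      (Measure.pi fun _ : Sym2 (Fin n) => unif) {u | (x, u) ∈ E} ≤ g x) :
    sampleMeasure μ n E ≤ ∫⁻ x, g x ∂(Measure.pi fun _ => μ) := by
  rw [sampleMeasure, Measure.prod_apply hE]
  exact lintegral_mono_ae h

theorem sampleMeasure_fst (μ : Measure ℝ) [IsProbabilityMeasure μ] {n : ℕ}
    {A : Set (Fin n → ℝ)} :
    sampleMeasure μ n {ω | ω.1 ∈ A} = (Measure.pi fun _ => μ) A := by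
  have : {ω : Sample n | ω.1 ∈ A} = A ×ˢ Set.univ := by ext; simp
  rw [this, sampleMeasure, Measure.prod_prod, measure_univ, mul_one]

theorem ae_pi_nonneg {μ : Measure ℝ} [IsProbabilityMeasure μ] (h : ∀ᵐ x ∂μ, 0 ≤ x) (n : ℕ) :
    ∀ᵐ x ∂(Measure.pi fun _ : Fin n => μ), ∀ i, 0 ≤ x i :=
  ae_all_iff.2 fun i => Measure.tendsto_eval_ae_ae (i := i) h

/-- A Chernoff bound for the upper tail. -/
theorem chernoff_upper {Ω : Type*} [MeasurableSpace Ω] (P : Measure Ω) {Z : Ω → ℝ} {m γ : ℝ}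
    (hZ : Measurable Z) (h0 : 0 < γ) (h1 : γ ≤ 1) (hm : 0 ≤ m)
    (h : ∀ r : ℝ, 0 < r → ∫⁻ ω, ENNReal.ofReal (Real.exp (r * Z ω)) ∂P ≤
      ENNReal.ofReal (Real.exp ((Real.exp r - 1) * m))) :
    P {ω | (1 + γ) * m ≤ Z ω} ≤ ENNReal.ofReal (Real.exp (-(γ ^ 2 / 4 * m))) := by
  -- By hypothesis the exponential moments are at most those of a Poisson variable of mean `m`. With
  -- `exp r - 1 ≤ r + r²` the exponent is at most `(r² - γ r) m`, and `r = γ / 2` minimises it,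
  -- giving `-γ² m / 4`.
  set r := γ / 2 with hr
  have hr0 : 0 < r := by positivity
  have key : P {ω | (1 + γ) * m ≤ Z ω} ≤
      P {ω | ENNReal.ofReal (Real.exp (r * ((1 + γ) * m))) ≤
        ENNReal.ofReal (Real.exp (r * Z ω))} := by
    refine measure_mono fun ω hω => ?_
    simp only [Set.mem_ofPred_eq] at hω ⊢
    gcongr
  refine key.trans ?_
  refine (meas_ge_le_lintegral_div (by fun_prop) (by simp [Real.exp_pos]) (by simp)).trans ?_
  rw [ENNReal.div_le_iff (by simp [Real.exp_pos]) (by simp), ← ENNReal.ofReal_mul (Real.exp_nonneg _),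
    ← Real.exp_add]
  refine (h r hr0).trans ?_
  gcongr
  have := Real.abs_exp_sub_one_sub_id_le (x := r) (by rw [abs_of_pos hr0]; linarith)
  have := (abs_le.1 this).2
  calc (Real.exp r - 1) * m ≤ (r + r ^ 2) * m := by gcongr; linarith
    _ = _ := by rw [hr]; ring

/-- A Chernoff bound for the lower tail. -/
theorem chernoff_lower {Ω : Type*} [MeasurableSpace Ω] (P : Measure Ω) {Z : Ω → ℝ} {m γ : ℝ}
    (hZ : Measurable Z) (h0 : 0 < γ) (h1 : γ ≤ 1) (hm : 0 ≤ m)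
    (h : ∀ r : ℝ, r < 0 → ∫⁻ ω, ENNReal.ofReal (Real.exp (r * Z ω)) ∂P ≤
      ENNReal.ofReal (Real.exp ((Real.exp r - 1) * m))) :
    P {ω | Z ω ≤ (1 - γ) * m} ≤ ENNReal.ofReal (Real.exp (-(γ ^ 2 / 4 * m))) := by
  set r := -(γ / 2) with hr
  have hr0 : r < 0 := by rw [hr]; linarith
  have key : P {ω | Z ω ≤ (1 - γ) * m} ≤
      P {ω | ENNReal.ofReal (Real.exp (r * ((1 - γ) * m))) ≤
        ENNReal.ofReal (Real.exp (r * Z ω))} := by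
    refine measure_mono fun ω hω => ?_
    simp only [Set.mem_ofPred_eq] at hω ⊢
    refine ENNReal.ofReal_le_ofReal (Real.exp_le_exp.2 ?_)
    exact mul_le_mul_of_nonpos_left hω hr0.le
  refine key.trans ?_
  refine (meas_ge_le_lintegral_div (by fun_prop) (by simp [Real.exp_pos]) (by simp)).trans ?_
  rw [ENNReal.div_le_iff (by simp [Real.exp_pos]) (by simp), ← ENNReal.ofReal_mul (Real.exp_nonneg _),
    ← Real.exp_add]
  refine (h r hr0).trans ?_
  gcongr
  have := Real.abs_exp_sub_one_sub_id_le (x := r) (by rw [abs_of_neg hr0]; linarith)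
  have := (abs_le.1 this).2
  calc (Real.exp r - 1) * m ≤ (r + r ^ 2) * m := by gcongr; linarith
    _ = _ := by rw [hr]; ring

/-- The exponential moment of an indicator. -/
theorem lintegral_exp_indicator (ρ : Measure ℝ) [IsProbabilityMeasure ρ] {A : Set ℝ}
    (hA : MeasurableSet A) (r : ℝ) :
    ∫⁻ x, ENNReal.ofReal (Real.exp (r * A.indicator 1 x)) ∂ρ =
      ENNReal.ofReal (1 + (Real.exp r - 1) * ρ.real A) := by
  have e : ∀ x, Real.exp (r * A.indicator 1 x) = 1 + A.indicator (fun _ => Real.exp r - 1) x := by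
    intro x
    by_cases hx : x ∈ A <;> simp [hx]
  simp_rw [e]
  have hi : Integrable (A.indicator fun _ => Real.exp r - 1) ρ :=
    (integrable_const _).indicator hA
  rw [← ofReal_integral_eq_lintegral_ofReal (f := fun x => 1 + _) ((integrable_const _).add hi)
    (ae_of_all _ fun x => by simp only [Pi.zero_apply]; rw [← e]; positivity)]
  congr 1
  rw [integral_add (integrable_const _) hi, integral_indicator hA]
  simp [mul_comm]

/-- Markov's inequality for the number of events that occur. -/
theorem measure_le_sum_indicator {Ω ι : Type*} [MeasurableSpace Ω] (P : Measure Ω) (s : Finset ι)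
    (E : ι → Set Ω) (hE : ∀ i, MeasurableSet (E i)) {c : ℝ} (hc : 0 < c) :
    P {ω | c ≤ ∑ i ∈ s, (E i).indicator 1 ω} ≤ (∑ i ∈ s, P (E i)) / ENNReal.ofReal c := by
  have key : P {ω | c ≤ ∑ i ∈ s, (E i).indicator (1 : Ω → ℝ) ω} ≤
      P {ω | ENNReal.ofReal c ≤ ∑ i ∈ s, (E i).indicator (1 : Ω → ℝ≥0∞) ω} := by
    refine measure_mono fun ω hω => ?_
    simp only [Set.mem_ofPred_eq] at hω ⊢
    refine (ENNReal.ofReal_le_ofReal hω).trans ?_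
    rw [ENNReal.ofReal_sum_of_nonneg fun i _ => Set.indicator_nonneg (by simp) _]
    refine Finset.sum_le_sum fun i _ => ?_
    by_cases h : ω ∈ E i <;> simp [h]
  refine key.trans ((meas_ge_le_lintegral_div (Measurable.aemeasurable ?_)
    (by simpa using hc) (by simp)).trans ?_)
  · exact Finset.measurable_sum _ fun i _ => measurable_one.indicator (hE i)
  · rw [lintegral_finsetSum _ fun i _ => measurable_one.indicator (hE i)]
    simp [hE]

/-- Only monotonicity and subadditivity are used, so the sets `A n` need not be measurable. -/
theorem tendsto_measure_one {Ω : ℕ → Type*} [∀ n, MeasurableSpace (Ω n)]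
    (P : (n : ℕ) → Measure (Ω n)) [∀ n, IsProbabilityMeasure (P n)] (A B : (n : ℕ) → Set (Ω n))
    (h : ∀ᶠ n in atTop, (A n)ᶜ ⊆ B n) (hB : Tendsto (fun n => P n (B n)) atTop (𝓝 0)) :
    Tendsto (fun n => P n (A n)) atTop (𝓝 1) := by
  have h1 : Tendsto (fun n => 1 - P n (B n)) atTop (𝓝 1) := by
    simpa using ENNReal.Tendsto.sub tendsto_const_nhds hB (Or.inl one_ne_top)
  refine tendsto_of_tendsto_of_tendsto_of_le_of_le' h1 tendsto_const_nhds ?_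
    (Eventually.of_forall fun n => prob_le_one)
  filter_upwards [h] with n hn
  rw [tsub_le_iff_right]
  calc 1 = P n Set.univ := measure_univ.symm
    _ ≤ P n (A n ∪ B n) := measure_mono fun ω _ => by
        by_cases hω : ω ∈ A n
        · exact Or.inl hω
        · exact Or.inr (hn hω)
    _ ≤ _ := measure_union_le _ _

theorem tendsto_measure_union {Ω : ℕ → Type*} [∀ n, MeasurableSpace (Ω n)]
    (P : (n : ℕ) → Measure (Ω n)) {A B : (n : ℕ) → Set (Ω n)}
    (hA : Tendsto (fun n => P n (A n)) atTop (𝓝 0))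
    (hB : Tendsto (fun n => P n (B n)) atTop (𝓝 0)) :
    Tendsto (fun n => P n (A n ∪ B n)) atTop (𝓝 0) :=
  tendsto_of_tendsto_of_tendsto_of_le_of_le tendsto_const_nhds (by simpa using hA.add hB)
    (fun _ => zero_le) fun _ => measure_union_le _ _

theorem tendsto_measure_of_le_ofReal {Ω : ℕ → Type*} [∀ n, MeasurableSpace (Ω n)]
    (P : (n : ℕ) → Measure (Ω n)) {A : (n : ℕ) → Set (Ω n)} {f : ℕ → ℝ}
    (h : ∀ᶠ n in atTop, P n (A n) ≤ ENNReal.ofReal (f n)) (hf : Tendsto f atTop (𝓝 0)) :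
    Tendsto (fun n => P n (A n)) atTop (𝓝 0) := by
  refine tendsto_of_tendsto_of_tendsto_of_le_of_le' tendsto_const_nhds ?_
    (Eventually.of_forall fun _ => zero_le) h
  simpa using ENNReal.tendsto_ofReal hf

end PowerLawGraph

/-! ### Complete graphs on four vertices under a quadratic tail bound. -/

namespace PowerLawGraph

open ProbabilityTheory ENNReal

/-- The probability of an edge as a function of the pair. -/
noncomputable def pairProb (b : ℝ) {n : ℕ} (x : Fin n → ℝ) : Sym2 (Fin n) → ℝ :=
  Sym2.lift ⟨fun i j => edgeProb b n (x i) (x j), fun i j => by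
    simp only [edgeProb, mul_comm]⟩

@[simp] theorem pairProb_mk (b : ℝ) {n : ℕ} (x : Fin n → ℝ) (i j : Fin n) :
    pairProb b x s(i, j) = edgeProb b n (x i) (x j) := rfl

theorem measure_forall_lt_pairProb {b : ℝ} (hb : 0 ≤ b) {n : ℕ} {x : Fin n → ℝ}
    (hx : ∀ i, 0 ≤ x i) (T : Finset (Sym2 (Fin n))) :
    (Measure.pi fun _ : Sym2 (Fin n) => unif) {u | ∀ e ∈ T, u e < pairProb b x e} =
      ∏ e ∈ T, ENNReal.ofReal (pairProb b x e) := by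
  have : {u : Sym2 (Fin n) → ℝ | ∀ e ∈ T, u e < pairProb b x e} =
      (T : Set (Sym2 (Fin n))).pi fun e => Set.Iio (pairProb b x e) := by
    ext u; simp [Set.mem_pi]
  rw [this, Measure.pi_pi_finset]
  refine Finset.prod_congr rfl fun e _ => ?_
  induction e with
  | _ i j => exact unif_Iio (edgeProb_nonneg hb n (hx i) (hx j)) (edgeProb_le_one _ _ _ _)

/-- The third power of the weight, cut off at `c`. -/
noncomputable def cube (c : ℝ) : ℝ → ℝ≥0∞ := (Set.Iic c).indicator fun x => ENNReal.ofReal (x ^ 3)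

theorem measurable_cube (c : ℝ) : Measurable (cube c) :=
  Measurable.indicator (by fun_prop) measurableSet_Iic

/-- The layer cake formula bounds the integral by `∫ 3 t² P(W > t) dt` over `0 < t < c`, and the
tail bound makes the integrand at most `3 A`. -/
theorem lintegral_cube_le {μ : Measure ℝ} (h0 : ∀ᵐ x ∂μ, 0 ≤ x) {A : ℝ}
    (hA : 0 ≤ A) (htail : ∀ x : ℝ, 0 < x → μ (Set.Ioi x) ≤ ENNReal.ofReal (A / x ^ 2)) {c : ℝ}
    (hc : 0 < c) : ∫⁻ x, cube c x ∂μ ≤ ENNReal.ofReal (3 * A * c) := by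
  have h1 : ∀ᵐ x ∂μ, cube c x ≤ ENNReal.ofReal (min x c ^ (3 : ℝ)) := by
    filter_upwards [h0] with x hx
    by_cases hxc : x ≤ c
    · simp [cube, hxc]
    · simp [cube, hxc]
  refine (lintegral_mono_ae h1).trans ?_
  rw [lintegral_rpow_eq_lintegral_meas_lt_mul μ (f := fun x => min x c)
    (by filter_upwards [h0] with x hx using le_min hx hc.le) (by fun_prop) (by norm_num)]
  have h2 : ∫⁻ t in Set.Ioi (0 : ℝ), μ {a | t < min a c} * ENNReal.ofReal (t ^ ((3 : ℝ) - 1)) ≤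
      ∫⁻ t in Set.Ioi (0 : ℝ), (Set.Iio c).indicator (fun _ => ENNReal.ofReal A) t := by
    refine setLIntegral_mono (Measurable.indicator (by fun_prop) measurableSet_Iio) fun t ht => ?_
    have ht : 0 < t := ht
    by_cases htc : t < c
    · have e : {a | t < min a c} = Set.Ioi t := by ext a; simp [htc]
      have e2 : t ^ ((3 : ℝ) - 1) = t ^ 2 := by norm_num
      rw [e, e2, Set.indicator_of_mem (by exact htc)]
      calc _ ≤ ENNReal.ofReal (A / t ^ 2) * ENNReal.ofReal (t ^ 2) := by gcongr; exact htail t ht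
        _ = _ := by
          rw [← ENNReal.ofReal_mul (by positivity)]
          congr 1
          field_simp
    · have e : {a | t < min a c} = ∅ := by ext a; simp; intro _; linarith
      rw [e]
      simp
  calc _ ≤ ENNReal.ofReal 3 * ∫⁻ t in Set.Ioi (0 : ℝ),
        (Set.Iio c).indicator (fun _ => ENNReal.ofReal A) t := by gcongr
    _ = _ := by
      rw [lintegral_indicator measurableSet_Iio, setLIntegral_const, Measure.restrict_apply
        measurableSet_Iio, Set.inter_comm, Set.Ioi_inter_Iio, Real.volume_Ioo,
        ← ENNReal.ofReal_mul hA, ← ENNReal.ofReal_mul (by norm_num)]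
      ring_nf

theorem measurableSet_coord_le {n : ℕ} (i : Fin n) (c : ℝ) :
    MeasurableSet {ω : Sample n | ω.1 i ≤ c} :=
  measurableSet_le (by fun_prop) (by fun_prop)

theorem measurableSet_coord_gt {n : ℕ} (i : Fin n) (c : ℝ) :
    MeasurableSet {ω : Sample n | c < ω.1 i} :=
  measurableSet_lt (by fun_prop) (by fun_prop)

theorem sampleMeasure_coord_gt (μ : Measure ℝ) [IsProbabilityMeasure μ] {n : ℕ} (i : Fin n)
    (c : ℝ) : sampleMeasure μ n {ω | c < ω.1 i} = μ (Set.Ioi c) := by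
  refine (sampleMeasure_fst μ (A := {x | c < x i})).trans ?_
  exact (measurePreserving_eval (fun _ : Fin n => μ) i).measure_preimage
    measurableSet_Ioi.nullMeasurableSet

/-- The vertices `v 0, …, v 3` form a complete graph, their weights are at most `c`, and the weight
of `v 0` is at most `c₀`. -/
def completeFour (b : ℝ) {n : ℕ} (c₀ c : ℝ) (v : Fin 4 → Fin n) : Set (Sample n) :=
  {ω | ((randomGraph b n ω).Adj (v 0) (v 1) ∧ (randomGraph b n ω).Adj (v 0) (v 2) ∧
      (randomGraph b n ω).Adj (v 0) (v 3) ∧ (randomGraph b n ω).Adj (v 1) (v 2) ∧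
      (randomGraph b n ω).Adj (v 1) (v 3) ∧ (randomGraph b n ω).Adj (v 2) (v 3)) ∧
    ω.1 (v 0) ≤ c₀ ∧ ω.1 (v 1) ≤ c ∧ ω.1 (v 2) ≤ c ∧ ω.1 (v 3) ≤ c}

theorem measurableSet_completeFour (b : ℝ) {n : ℕ} (c₀ c : ℝ) (v : Fin 4 → Fin n) :
    MeasurableSet (completeFour b c₀ c v) := by
  unfold completeFour
  refine MeasurableSet.inter (MeasurableSet.inter (measurableSet_adj b n _ _) <|
    .inter (measurableSet_adj b n _ _) <| .inter (measurableSet_adj b n _ _) <|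
    .inter (measurableSet_adj b n _ _) <| .inter (measurableSet_adj b n _ _) <|
    (measurableSet_adj b n _ _)) (.inter (measurableSet_coord_le _ _) <|
    .inter (measurableSet_coord_le _ _) <| .inter (measurableSet_coord_le _ _)
    (measurableSet_coord_le _ _))

/-- Given the weights, the six edges are independent and each has probability at most `b W_i W_j /
n`. Each vertex lies on three edges, so the product is `(b / n) ^ 6` times the cubes of the four
weights, and these are integrated separately. -/
theorem sampleMeasure_completeFour {μ : Measure ℝ} [IsProbabilityMeasure μ]
    (h0 : ∀ᵐ x ∂μ, 0 ≤ x) {A : ℝ} (hA : 0 ≤ A)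
    (htail : ∀ x : ℝ, 0 < x → μ (Set.Ioi x) ≤ ENNReal.ofReal (A / x ^ 2)) {b : ℝ} (hb : 0 ≤ b)
    {n : ℕ} {c₀ c : ℝ} (hc₀ : 0 < c₀) (hc : 0 < c) (v : Fin 4 → Fin n) :
    sampleMeasure μ n (completeFour b c₀ c v) ≤
      ENNReal.ofReal ((b / n) ^ 6 * ((3 * A * c₀) * (3 * A * c) ^ 3)) := by
  -- If the event is not empty, adjacency forces four distinct vertices; hence the six pairs in `T`
  -- are distinct and the weights independent.
  by_cases hv : ∃ ω, ω ∈ completeFour b c₀ c v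
  swap
  · push Not at hv
    rw [Set.eq_empty_iff_forall_notMem.2 hv]
    simp
  obtain ⟨ω₀, ⟨h01, h02, h03, h12, h13, h23⟩, -⟩ := hv
  replace h01 := h01.ne
  replace h02 := h02.ne
  replace h03 := h03.ne
  replace h12 := h12.ne
  replace h13 := h13.ne
  replace h23 := h23.ne
  have hinj : v.Injective := by
    intro i j hij
    fin_cases i <;> fin_cases j <;> simp_all
  let f : Fin 4 → ℝ → ℝ≥0∞ := fun i => if i = 0 then cube c₀ else cube c
  have hf : ∀ i, Measurable (f i) := by
    intro i
    simp only [f]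
    split_ifs <;> exact measurable_cube _
  refine (sampleMeasure_le_lintegral μ (measurableSet_completeFour b c₀ c v)
    (fun x => ENNReal.ofReal ((b / n) ^ 6) * ∏ i, f i (x (v i))) ?_).trans ?_
  · filter_upwards [ae_pi_nonneg h0 n] with x hx
    by_cases hxc : x (v 0) ≤ c₀ ∧ x (v 1) ≤ c ∧ x (v 2) ≤ c ∧ x (v 3) ≤ c
    swap
    · refine (measure_mono_null (t := ∅) ?_ (by simp)).trans_le zero_le
      exact fun u hu => hxc hu.2
    let T : Finset (Sym2 (Fin n)) :=
      {s(v 0, v 1), s(v 0, v 2), s(v 0, v 3), s(v 1, v 2), s(v 1, v 3), s(v 2, v 3)}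
    calc _ ≤ (Measure.pi fun _ : Sym2 (Fin n) => unif) {u | ∀ e ∈ T, u e < pairProb b x e} := by
          refine measure_mono ?_
          rintro u ⟨⟨g1, g2, g3, g4, g5, g6⟩, -⟩
          simp only [T, Finset.mem_insert, Finset.mem_singleton, Set.mem_ofPred_eq]
          rintro e (rfl | rfl | rfl | rfl | rfl | rfl)
          exacts [g1.2, g2.2, g3.2, g4.2, g5.2, g6.2]
      _ = ∏ e ∈ T, ENNReal.ofReal (pairProb b x e) := measure_forall_lt_pairProb hb hx T
      _ = ENNReal.ofReal (edgeProb b n (x (v 0)) (x (v 1))) *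
          (ENNReal.ofReal (edgeProb b n (x (v 0)) (x (v 2))) *
          (ENNReal.ofReal (edgeProb b n (x (v 0)) (x (v 3))) *
          (ENNReal.ofReal (edgeProb b n (x (v 1)) (x (v 2))) *
          (ENNReal.ofReal (edgeProb b n (x (v 1)) (x (v 3))) *
          (ENNReal.ofReal (edgeProb b n (x (v 2)) (x (v 3)))))))) := by
          simp only [T]
          rw [Finset.prod_insert, Finset.prod_insert, Finset.prod_insert, Finset.prod_insert,
            Finset.prod_insert, Finset.prod_singleton]
          · rfl
          all_goals simp [h01, h02, h03, h12, h13, h23, h01.symm, h02.symm, h12.symm,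
            h13.symm, h23.symm]
      _ ≤ ENNReal.ofReal (b * (x (v 0) * x (v 1)) / n) *
          (ENNReal.ofReal (b * (x (v 0) * x (v 2)) / n) *
          (ENNReal.ofReal (b * (x (v 0) * x (v 3)) / n) *
          (ENNReal.ofReal (b * (x (v 1) * x (v 2)) / n) *
          (ENNReal.ofReal (b * (x (v 1) * x (v 3)) / n) *
          (ENNReal.ofReal (b * (x (v 2) * x (v 3)) / n)))))) := by
          gcongr <;> exact edgeProb_le _ _ _ _
      _ = ENNReal.ofReal ((b / n) ^ 6) * ∏ i, f i (x (v i)) := by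
          have := hx (v 0)
          have := hx (v 1)
          have := hx (v 2)
          have := hx (v 3)
          simp only [Fin.prod_univ_four, f, cube]
          simp only [↓reduceIte, Set.mem_Iic, hxc, Set.indicator_of_mem, one_ne_zero,
            Fin.reduceEq]
          rw [← ENNReal.ofReal_mul (by positivity), ← ENNReal.ofReal_mul (by positivity),
            ← ENNReal.ofReal_mul (by positivity), ← ENNReal.ofReal_mul (by positivity),
            ← ENNReal.ofReal_mul (by positivity), ← ENNReal.ofReal_mul (by positivity),
            ← ENNReal.ofReal_mul (by positivity), ← ENNReal.ofReal_mul (by positivity),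
            ← ENNReal.ofReal_mul (by positivity)]
          congr 1
          ring
  · rw [lintegral_const_mul _ (by fun_prop), lintegral_pi_prod μ hinj f hf, Fin.prod_univ_four,
      ENNReal.ofReal_mul (by positivity)]
    gcongr
    simp only [f, ↓reduceIte, one_ne_zero, Fin.reduceEq]
    have e0 := lintegral_cube_le h0 hA htail hc₀
    have e1 := lintegral_cube_le h0 hA htail hc
    calc _ ≤ ENNReal.ofReal (3 * A * c₀) * ENNReal.ofReal (3 * A * c) *
          ENNReal.ofReal (3 * A * c) * ENNReal.ofReal (3 * A * c) := by gcongr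
      _ = _ := by
          rw [← ENNReal.ofReal_mul (by positivity), ← ENNReal.ofReal_mul (by positivity),
            ← ENNReal.ofReal_mul (by positivity)]
          congr 1
          ring

end PowerLawGraph

/-! ### Few cliques when the tail is at most quadratic. -/

namespace PowerLawGraph

open ProbabilityTheory ENNReal

-- A clique of at least four vertices that leaves `H` would contain a forbidden quadruple starting
-- outside `H`. So every clique has at most three vertices or is one of the at most `n` subsets of
-- `H`.
open Classical in
theorem card_cliques_lt {n : ℕ} (G : SimpleGraph (Fin n)) (H : Finset (Fin n))
    (h4 : ∀ v : Fin 4 → Fin n, v 0 ∉ H → ¬ (G.Adj (v 0) (v 1) ∧ G.Adj (v 0) (v 2) ∧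
      G.Adj (v 0) (v 3) ∧ G.Adj (v 1) (v 2) ∧ G.Adj (v 1) (v 3) ∧ G.Adj (v 2) (v 3)))
    (hH : 2 ^ H.card ≤ n) :
    (Finset.univ.filter fun C : Finset (Fin n) => G.IsClique (C : Set (Fin n))).card <
      (n + 2) ^ 4 := by
  have hsub : (Finset.univ.filter fun C : Finset (Fin n) => G.IsClique (C : Set (Fin n))) ⊆
      ((Finset.range 4).biUnion fun k => Finset.powersetCard k Finset.univ) ∪ H.powerset := by
    intro C hC
    have hC : G.IsClique (C : Set (Fin n)) := by simpa using hC
    rw [Finset.mem_union]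
    by_cases h3 : C.card < 4
    · left
      simp [h3]
    · right
      rw [Finset.mem_powerset]
      intro i hi
      by_contra hiH
      have : 2 < (C.erase i).card := by rw [Finset.card_erase_of_mem hi]; omega
      obtain ⟨j, hj, k, hk, l, hl, hjk, hjl, hkl⟩ := Finset.two_lt_card.1 this
      rw [Finset.mem_erase] at hj hk hl
      exact h4 ![i, j, k, l] hiH ⟨hC hi hj.2 hj.1.symm, hC hi hk.2 hk.1.symm,
        hC hi hl.2 hl.1.symm, hC hj.2 hk.2 hjk, hC hj.2 hl.2 hjl, hC hk.2 hl.2 hkl⟩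
  calc _ ≤ _ := Finset.card_le_card hsub
    _ ≤ _ := Finset.card_union_le _ _
    _ ≤ (∑ k ∈ Finset.range 4, n ^ k) + n := by
      rw [Finset.card_powerset]
      refine add_le_add (Finset.card_biUnion_le.trans (Finset.sum_le_sum fun k _ => ?_)) hH
      rw [Finset.card_powersetCard, Finset.card_univ, Fintype.card_fin]
      exact Nat.choose_le_pow n k
    _ < (n + 2) ^ 4 := by
      simp only [Finset.sum_range_succ, Finset.sum_range_zero]
      nlinarith [Nat.zero_le (n ^ 4), Nat.zero_le (n ^ 3), Nat.zero_le (n ^ 2)]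

open Classical in
theorem tendsto_card_cliques {μ : Measure ℝ} [IsProbabilityMeasure μ]
    (h0 : ∀ᵐ x ∂μ, 0 ≤ x) {A : ℝ} (hA : 0 ≤ A)
    (htail : ∀ x : ℝ, 0 < x → μ (Set.Ioi x) ≤ ENNReal.ofReal (A / x ^ 2)) {b : ℝ} (hb : 0 ≤ b) :
    Tendsto (fun n : ℕ => sampleMeasure μ n {ω |
      (Finset.univ.filter fun C : Finset (Fin n) =>
        (randomGraph b n ω).IsClique (C : Set (Fin n))).card < (n + 2) ^ 4}) atTop (𝓝 1) := by
  -- With maximal weight scale `L √n` and light weights at most `√n / L⁴`, the failure bounds are of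
  -- order `1 / L²` for a too large weight, `L⁸ / log n = 1 / L²` for too many heavy vertices, and
  -- `L³ / L⁴ = 1 / L` for a quadruple with a light vertex.
  let L : ℕ → ℝ := fun n => Real.log n ^ (1 / 10 : ℝ)
  have hL : Tendsto L atTop atTop :=
    (tendsto_rpow_atTop (by norm_num)).comp (Real.tendsto_log_atTop.comp tendsto_natCast_atTop_atTop)
  have hL10 : ∀ n : ℕ, L n ^ 10 = Real.log n := by
    intro n
    simp only [L]
    rw [← Real.rpow_natCast, ← Real.rpow_mul (Real.log_natCast_nonneg n)]
    norm_num
  have hev : ∀ᶠ n in atTop, 0 < L n ∧ 0 < n :=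
    (hL.eventually_gt_atTop 0).and (eventually_gt_atTop 0)
  have hlog2 : 0 < Real.log 2 := Real.log_pos (by norm_num)
  let c : ℕ → ℝ := fun n => L n * √n
  let c₀ : ℕ → ℝ := fun n => √n / L n ^ 4
  let B₁ : (n : ℕ) → Set (Sample n) := fun n => ⋃ i, {ω | c n < ω.1 i}
  let B₂ : (n : ℕ) → Set (Sample n) := fun n => {ω | Real.log n / Real.log 2 ≤
    ∑ i, Set.indicator {ω : Sample n | c₀ n < ω.1 i} 1 ω}
  let B₃ : (n : ℕ) → Set (Sample n) := fun n =>
    ⋃ v : Fin 4 → Fin n, completeFour b (c₀ n) (c n) v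
  have h1 : Tendsto (fun n => sampleMeasure μ n (B₁ n)) atTop (𝓝 0) := by
    refine tendsto_measure_of_le_ofReal _ (f := fun n => A / L n ^ 2) ?_
      (tendsto_const_nhds.div_atTop ((tendsto_pow_atTop (by norm_num)).comp hL))
    filter_upwards [hev] with n ⟨hLn, hn⟩
    have hn' : (0 : ℝ) < n := by exact_mod_cast hn
    have hc : 0 < c n := by positivity
    refine (measure_iUnion_fintype_le _ _).trans ?_
    calc _ ≤ ∑ i : Fin n, ENNReal.ofReal (A / c n ^ 2) := Finset.sum_le_sum fun i _ => by
          rw [sampleMeasure_coord_gt]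
          exact htail _ hc
      _ = _ := by
          rw [Finset.sum_const, Finset.card_univ, Fintype.card_fin, nsmul_eq_mul,
            ← ENNReal.ofReal_natCast n, ← ENNReal.ofReal_mul (by positivity)]
          congr 1
          simp only [c]
          rw [mul_pow, Real.sq_sqrt hn'.le]
          field_simp
  have h2 : Tendsto (fun n => sampleMeasure μ n (B₂ n)) atTop (𝓝 0) := by
    refine tendsto_measure_of_le_ofReal _ (f := fun n => A * Real.log 2 / L n ^ 2) ?_
      (tendsto_const_nhds.div_atTop ((tendsto_pow_atTop (by norm_num)).comp hL))
    filter_upwards [hev] with n ⟨hLn, hn⟩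
    have hn' : (0 : ℝ) < n := by exact_mod_cast hn
    have hc : 0 < c₀ n := by positivity
    have hH : 0 < Real.log n / Real.log 2 := by rw [← hL10]; positivity
    refine (measure_le_sum_indicator _ _ _ (fun i => measurableSet_coord_gt i _) hH).trans ?_
    rw [ENNReal.div_le_iff (by simpa using hH) (by simp)]
    calc _ ≤ ∑ i : Fin n, ENNReal.ofReal (A / c₀ n ^ 2) := Finset.sum_le_sum fun i _ => by
          rw [sampleMeasure_coord_gt]
          exact htail _ hc
      _ = _ := by
          rw [Finset.sum_const, Finset.card_univ, Fintype.card_fin, nsmul_eq_mul,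
            ← ENNReal.ofReal_natCast n, ← ENNReal.ofReal_mul (by positivity),
            ← ENNReal.ofReal_mul (by positivity)]
          congr 1
          simp only [c₀]
          rw [div_pow, Real.sq_sqrt hn'.le, ← hL10]
          field_simp
  have h3 : Tendsto (fun n => sampleMeasure μ n (B₃ n)) atTop (𝓝 0) := by
    refine tendsto_measure_of_le_ofReal _ (f := fun n => 81 * A ^ 4 * b ^ 6 / L n) ?_
      (tendsto_const_nhds.div_atTop hL)
    filter_upwards [hev] with n ⟨hLn, hn⟩
    have hn' : (0 : ℝ) < n := by exact_mod_cast hn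
    refine (measure_iUnion_fintype_le _ _).trans ?_
    calc _ ≤ ∑ v : Fin 4 → Fin n, _ := Finset.sum_le_sum fun v _ =>
          sampleMeasure_completeFour h0 hA htail hb (c₀ := c₀ n) (c := c n) (by positivity)
            (by positivity) v
      _ = _ := by
          rw [Finset.sum_const, Finset.card_univ, nsmul_eq_mul, ← ENNReal.ofReal_natCast,
            ← ENNReal.ofReal_mul (by positivity)]
          congr 1
          simp only [c, c₀, Fintype.card_fun, Fintype.card_fin, Nat.cast_pow]
          have e : √(n : ℝ) ^ 4 = n ^ 2 := by
            rw [show (4 : ℕ) = 2 * 2 from rfl, pow_mul, Real.sq_sqrt hn'.le]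
          field_simp
          rw [e]
          ring
  refine tendsto_measure_one _ _ _ ?_ (tendsto_measure_union _ (tendsto_measure_union _ h1 h2) h3)
  filter_upwards [hev] with n ⟨hLn, hn⟩
  have hn' : (0 : ℝ) < n := by exact_mod_cast hn
  intro ω hω
  by_contra hB
  simp only [B₁, B₂, B₃, Set.mem_union, Set.mem_iUnion, Set.mem_ofPred_eq, not_or, not_exists,
    not_lt, not_le] at hB
  obtain ⟨⟨g1, g2⟩, g3⟩ := hB
  refine hω (card_cliques_lt _ (Finset.univ.filter fun i => c₀ n < ω.1 i) (fun v hv hadj => ?_) ?_)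
  · exact g3 v ⟨hadj, by simpa using hv, g1 _, g1 _, g1 _⟩
  · have e : ∑ i, Set.indicator {ω : Sample n | c₀ n < ω.1 i} (1 : Sample n → ℝ) ω =
        (Finset.univ.filter fun i => c₀ n < ω.1 i).card := by
      simp [Set.indicator_apply, Finset.sum_boole]
    rw [e, lt_div_iff₀ hlog2, ← Real.log_pow] at g2
    have := (Real.log_lt_log_iff (by positivity) hn').1 g2
    exact_mod_cast this.le

end PowerLawGraph

/-! ### Concentration of degrees and of the number of heavy vertices. -/

namespace PowerLawGraph

open ProbabilityTheory ENNReal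

/-- The average of `1 - exp (-s W)`. -/
noncomputable def meanProb (μ : Measure ℝ) (s : ℝ) : ℝ := ∫ x, (1 - Real.exp (-(s * x))) ∂μ

theorem integrable_one_sub_exp {μ : Measure ℝ} [IsProbabilityMeasure μ] (h0 : ∀ᵐ x ∂μ, 0 ≤ x)
    {s : ℝ} (hs : 0 ≤ s) : Integrable (fun x => 1 - Real.exp (-(s * x))) μ := by
  refine Integrable.of_bound (by fun_prop) 1 ?_
  filter_upwards [h0] with x hx
  have h1 : Real.exp (-(s * x)) ≤ 1 := Real.exp_le_one_iff.2 (by have := mul_nonneg hs hx; linarith)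
  have h2 := Real.exp_pos (-(s * x))
  rw [Real.norm_eq_abs, abs_le]
  constructor <;> linarith

theorem meanProb_nonneg {μ : Measure ℝ} (h0 : ∀ᵐ x ∂μ, 0 ≤ x) {s : ℝ} (hs : 0 ≤ s) :
    0 ≤ meanProb μ s := by
  refine integral_nonneg_of_ae ?_
  filter_upwards [h0] with x hx
  have h1 : Real.exp (-(s * x)) ≤ 1 := Real.exp_le_one_iff.2 (by have := mul_nonneg hs hx; linarith)
  simpa using h1

/-- On the event `W > 1 / s` the integrand is at least `1 - exp (-1)`. -/
theorem le_meanProb {μ : Measure ℝ} [IsProbabilityMeasure μ] {α a x₀ : ℝ}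
    (hμ : IsWeightLaw μ α a x₀) {s : ℝ} (hs : 0 < s) (hx₀ : x₀ ≤ 1 / s) :
    (1 - Real.exp (-1)) * (a * s ^ α) ≤ meanProb μ s := by
  have e : a * s ^ α = μ.real (Set.Ioi (1 / s)) := by
    rw [hμ.tail _ hx₀, one_div, Real.inv_rpow hs.le, Real.rpow_neg hs.le, inv_inv]
  rw [e, mul_comm, ← smul_eq_mul, ← integral_indicator_const _ measurableSet_Ioi, meanProb]
  refine integral_mono_ae ((integrable_const _).indicator measurableSet_Ioi)
    (integrable_one_sub_exp hμ.nonneg hs.le) ?_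
  filter_upwards [hμ.nonneg] with x hx
  by_cases h : x ∈ Set.Ioi (1 / s)
  · rw [Set.indicator_of_mem h]
    have : 1 < x * s := (div_lt_iff₀ hs).1 h
    gcongr
    linarith
  · rw [Set.indicator_of_notMem h]
    have : Real.exp (-(s * x)) ≤ 1 :=
      Real.exp_le_one_iff.2 (by have := mul_nonneg hs.le hx; linarith)
    linarith

/-- The part `g = s W` on `W ≤ 1 / s` controls everything. The remaining mass beyond `1 / s` is
comparable, by the power law, to the mass between `1 / (2 s)` and `1 / s`, where `g ≥ 1/2`; so
`meanProb μ s` is at most a constant times the integral of `g`. Replacing `s` by `k s` raises the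
integrand by at least a constant times `g`. -/
theorem exists_meanProb_growth {μ : Measure ℝ} [IsProbabilityMeasure μ] {α a x₀ : ℝ} (hα : 0 < α)
    (hμ : IsWeightLaw μ α a x₀) {k : ℝ} (hk : 1 < k) :
    ∃ γ > 0, ∀ s > 0, x₀ ≤ 1 / (2 * s) → (1 + γ) * meanProb μ s ≤ meanProb μ (k * s) := by
  have h2α : 1 < (2 : ℝ) ^ α := Real.one_lt_rpow (by norm_num) hα
  set K : ℝ := 1 + 2 / (2 ^ α - 1) with hK
  have hKpos : 0 < K := by
    have : 0 < (2 : ℝ) ^ α - 1 := by linarith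
    positivity
  set c : ℝ := Real.exp (-1) * (1 - Real.exp (-(k - 1))) with hc
  have hcpos : 0 < c := by
    have : Real.exp (-(k - 1)) < 1 := Real.exp_lt_one_iff.2 (by linarith)
    have : 0 < 1 - Real.exp (-(k - 1)) := by linarith
    positivity
  refine ⟨c / K, by positivity, fun s hs hx₀ => ?_⟩
  have hx₁ : x₀ ≤ 1 / s := hx₀.trans (one_div_le_one_div_of_le hs (by linarith))
  let g : ℝ → ℝ := (Set.Iic (1 / s)).indicator fun x => s * x
  have hg : Integrable g μ := by
    refine Integrable.of_bound
      ((by fun_prop : Measurable fun x : ℝ => s * x).indicator measurableSet_Iic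
        ).aestronglyMeasurable 1 ?_
    filter_upwards [hμ.nonneg] with x hx
    by_cases h : x ∈ Set.Iic (1 / s)
    · have : x * s ≤ 1 := (le_div_iff₀ hs).1 h
      have := mul_nonneg hs.le hx
      simp only [g, Set.indicator_of_mem h, Real.norm_eq_abs]
      rw [abs_of_nonneg this]
      linarith
    · simp only [g, Set.indicator_of_notMem h]
      simp
  have hχ (y : ℝ) : Integrable ((Set.Ioi y).indicator (fun _ => (1 : ℝ))) μ :=
    (integrable_const _).indicator measurableSet_Ioi
  have hχ' (y : ℝ) : ∫ x, (Set.Ioi y).indicator (fun _ => (1 : ℝ)) x ∂μ = μ.real (Set.Ioi y) := by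
    rw [integral_indicator_const _ measurableSet_Ioi]
    simp
  have t1 : μ.real (Set.Ioi (1 / s)) = a * s ^ α := by
    rw [hμ.tail _ hx₁, one_div, Real.inv_rpow hs.le, Real.rpow_neg hs.le, inv_inv]
  have t2 : μ.real (Set.Ioi (1 / (2 * s))) = 2 ^ α * (a * s ^ α) := by
    rw [hμ.tail _ hx₀, one_div, Real.inv_rpow (by positivity), Real.rpow_neg (by positivity),
      inv_inv, Real.mul_rpow (by norm_num) hs.le]
    ring
  have i1 : meanProb μ s ≤ ∫ x, g x ∂μ + a * s ^ α := by
    rw [← t1, ← hχ', ← integral_add hg (hχ _), meanProb]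
    refine integral_mono_ae (integrable_one_sub_exp hμ.nonneg hs.le) (hg.add (hχ _)) ?_
    filter_upwards [hμ.nonneg] with x hx
    by_cases h : x ≤ 1 / s
    · have := Real.add_one_le_exp (-(s * x))
      simp only [one_div] at h
      simp [g, h, not_lt.2 h]
      linarith
    · have := Real.exp_pos (-(s * x))
      simp only [one_div] at h
      simp [g, h, not_le.1 h]
      linarith
  have i2 : 2⁻¹ * (2 ^ α * (a * s ^ α) - a * s ^ α) ≤ ∫ x, g x ∂μ := by
    rw [← t2, ← t1, ← hχ', ← hχ', ← integral_sub (hχ _) (hχ _), ← integral_const_mul]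
    refine integral_mono_ae (((hχ _).sub (hχ _)).const_mul _) hg ?_
    filter_upwards [hμ.nonneg] with x hx
    by_cases h : x ≤ 1 / s
    · by_cases h' : 1 / (2 * s) < x
      · have h'' : 1 < x * (2 * s) := (div_lt_iff₀ (by positivity)).1 h'
        have e1 : x ∈ Set.Iic (1 / s) := h
        have e2 : x ∈ Set.Ioi (1 / (2 * s)) := h'
        have e3 : x ∉ Set.Ioi (1 / s) := not_lt.2 h
        simp only [g, Set.indicator_of_mem e1, Set.indicator_of_mem e2, Set.indicator_of_notMem e3]
        linarith
      · have e1 : x ∈ Set.Iic (1 / s) := h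
        have e2 : x ∉ Set.Ioi (1 / (2 * s)) := h'
        have e3 : x ∉ Set.Ioi (1 / s) := not_lt.2 h
        have := mul_nonneg hs.le hx
        simp only [g, Set.indicator_of_mem e1, Set.indicator_of_notMem e2,
          Set.indicator_of_notMem e3]
        linarith
    · have e1 : x ∉ Set.Iic (1 / s) := h
      have e3 : x ∈ Set.Ioi (1 / s) := not_le.1 h
      have e2 : x ∈ Set.Ioi (1 / (2 * s)) :=
        lt_of_le_of_lt (one_div_le_one_div_of_le hs (by linarith)) e3
      simp only [g, Set.indicator_of_mem e2, Set.indicator_of_notMem e1, Set.indicator_of_mem e3]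
      linarith
  have i3 : c * ∫ x, g x ∂μ ≤ meanProb μ (k * s) - meanProb μ s := by
    rw [meanProb, meanProb, ← integral_sub (integrable_one_sub_exp hμ.nonneg (by positivity))
      (integrable_one_sub_exp hμ.nonneg hs.le), ← integral_const_mul]
    refine integral_mono_ae (hg.const_mul _) ((integrable_one_sub_exp hμ.nonneg
      (by positivity)).sub (integrable_one_sub_exp hμ.nonneg hs.le)) ?_
    filter_upwards [hμ.nonneg] with x hx
    set y := s * x with hy
    have hy0 : 0 ≤ y := mul_nonneg hs.le hx
    have e : Real.exp (-(k * s * x)) = Real.exp (-y) * Real.exp (-((k - 1) * y)) := by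
      rw [← Real.exp_add]; congr 1; rw [hy]; ring
    have e' : 1 - Real.exp (-(k * s * x)) - (1 - Real.exp (-y)) =
        Real.exp (-y) * (1 - Real.exp (-((k - 1) * y))) := by rw [e]; ring
    rw [e']
    by_cases h : x ∈ Set.Iic (1 / s)
    · simp only [g, Set.indicator_of_mem h]
      have hy1 : y ≤ 1 := by
        have := (le_div_iff₀ hs).1 h
        rw [hy]; linarith
      -- Convexity of `exp` between `-(k - 1)` and `0` bounds `1 - exp (-(k - 1) y)` below by a
      -- multiple of `y` for `0 ≤ y ≤ 1`.
      have hconv := convexOn_exp.2 (Set.mem_univ 0) (Set.mem_univ (-(k - 1)))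
        (sub_nonneg.2 hy1) hy0 (by ring)
      simp only [smul_eq_mul, mul_zero, zero_add, Real.exp_zero, mul_one] at hconv
      have e2 : y * -(k - 1) = -((k - 1) * y) := by ring
      rw [e2] at hconv
      have hk1 : Real.exp (-(k - 1)) ≤ 1 := Real.exp_le_one_iff.2 (by linarith)
      calc c * y = Real.exp (-1) * (y * (1 - Real.exp (-(k - 1)))) := by rw [hc]; ring
        _ ≤ Real.exp (-y) * (1 - Real.exp (-((k - 1) * y))) := by
          have : 0 ≤ y * (1 - Real.exp (-(k - 1))) := mul_nonneg hy0 (by linarith)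
          gcongr
          linarith
    · simp only [g, Set.indicator_of_notMem h, mul_zero]
      have : Real.exp (-((k - 1) * y)) ≤ 1 :=
        Real.exp_le_one_iff.2 (by have := mul_nonneg (sub_nonneg.2 hk.le) hy0; linarith)
      exact mul_nonneg (Real.exp_nonneg _) (by linarith)
  have i4 : a * s ^ α ≤ 2 / (2 ^ α - 1) * ∫ x, g x ∂μ := by
    have h3 : 0 < (2 : ℝ) ^ α - 1 := by linarith
    rw [div_mul_eq_mul_div, le_div_iff₀ h3]
    linarith
  have i5 : meanProb μ s ≤ K * ∫ x, g x ∂μ := by rw [hK]; linarith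
  have i6 : c / K * meanProb μ s ≤ c * ∫ x, g x ∂μ := by
    rw [div_mul_eq_mul_div, div_le_iff₀ hKpos]
    nlinarith
  linarith

theorem edgeProb_eq (b : ℝ) (n : ℕ) (w x : ℝ) :
    edgeProb b n w x = 1 - Real.exp (-(b * w / n * x)) := by
  rw [edgeProb]; ring_nf

open Classical in
/-- The degree of `v`. -/
noncomputable def deg (b : ℝ) {n : ℕ} (v : Fin n) (ω : Sample n) : ℝ :=
  ((Finset.univ.filter fun w => (randomGraph b n ω).Adj v w).card : ℝ)

theorem deg_eq (b : ℝ) {n : ℕ} (v : Fin n) (ω : Sample n) :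
    deg b v ω = ∑ j ∈ Finset.univ.erase v,
      (Set.Iio (edgeProb b n (ω.1 v) (ω.1 j))).indicator 1 (ω.2 s(v, j)) := by
  classical
  simp only [Set.indicator_apply, Pi.one_apply, Finset.sum_boole, deg]
  congr 2
  ext j
  simp only [Finset.mem_filter, Finset.mem_univ, Finset.mem_erase]
  simp [randomGraph, eq_comm]

theorem measurable_deg (b : ℝ) {n : ℕ} (v : Fin n) : Measurable (deg b v) := by
  have : deg b v = fun ω => ∑ j ∈ Finset.univ.erase v,
      Set.indicator {ω : Sample n | ω.2 s(v, j) < edgeProb b n (ω.1 v) (ω.1 j)} 1 ω := by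
    ext ω
    rw [deg_eq]
    rfl
  rw [this]
  exact Finset.measurable_sum _ fun j _ => measurable_one.indicator
    (measurableSet_lt (by fun_prop) (by fun_prop))

theorem one_add_mul_nonneg (r : ℝ) {p : ℝ} (h0 : 0 ≤ p) (h1 : p ≤ 1) :
    0 ≤ 1 + (Real.exp r - 1) * p := by
  nlinarith [mul_nonneg (Real.exp_nonneg r) h0]

/-- Given the weights, the degree of `v` is a sum of independent indicators. The hypothesis `h` lets
weight `w` dominate all weights of `v` in `D`; then the other weights are averaged independently and
`1 + x ≤ exp x` is applied to each factor. It is used with weights below `w` for `r > 0` and above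
`w` for `r < 0`. -/
theorem lintegral_exp_deg_le {μ : Measure ℝ} [IsProbabilityMeasure μ] (h0 : ∀ᵐ x ∂μ, 0 ≤ x)
    {b : ℝ} (hb : 0 ≤ b) {n : ℕ} (v : Fin n) {w : ℝ} (hw : 0 ≤ w) (r : ℝ) {D : Set ℝ}
    (hD : MeasurableSet D) (h : ∀ x ∈ D, 0 ≤ x → ∀ y, 0 ≤ y →
      (Real.exp r - 1) * edgeProb b n x y ≤ (Real.exp r - 1) * edgeProb b n w y) :
    ∫⁻ ω, ENNReal.ofReal (Real.exp (r * deg b v ω))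
        ∂((sampleMeasure μ n).restrict {ω | ω.1 v ∈ D}) ≤
      ENNReal.ofReal (Real.exp ((Real.exp r - 1) * ((n - 1) * meanProb μ (b * w / n)))) := by
  have hset : {ω : Sample n | ω.1 v ∈ D} = {x | x v ∈ D} ×ˢ Set.univ := by ext; simp
  have hDm : MeasurableSet {x : Fin n → ℝ | x v ∈ D} := measurable_pi_apply v hD
  have hm := measurable_deg b v
  rw [hset, sampleMeasure, ← Measure.prod_restrict, Measure.restrict_univ,
    lintegral_prod _ (by fun_prop)]
  let f : ℝ → ℝ≥0∞ := fun y => ENNReal.ofReal (1 + (Real.exp r - 1) * edgeProb b n w y)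
  have hf : Measurable f := by fun_prop
  calc _ ≤ ∫⁻ x in {x : Fin n → ℝ | x v ∈ D}, ∏ j ∈ Finset.univ.erase v, f (x j)
        ∂(Measure.pi fun _ => μ) := by
        refine lintegral_mono_ae ?_
        filter_upwards [ae_restrict_of_ae (ae_pi_nonneg h0 n), ae_restrict_mem hDm] with x hx hxD
        have e : ∀ u : Sym2 (Fin n) → ℝ, ENNReal.ofReal (Real.exp (r * deg b v (x, u))) =
            ∏ j ∈ Finset.univ.erase v, ENNReal.ofReal (Real.exp (r *
              (Set.Iio (edgeProb b n (x v) (x j))).indicator 1 (u s(v, j)))) := by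
          intro u
          rw [deg_eq, Finset.mul_sum, Real.exp_sum,
            ENNReal.ofReal_prod_of_nonneg fun _ _ => Real.exp_nonneg _]
        simp_rw [e]
        rw [lintegral_pi_prod (κ := Fin n) unif (g := fun j => s(v, j))
          (fun j j' hj => by
            rcases (by simpa using hj : j = j' ∨ v = j' ∧ j = v) with h | ⟨h1, h2⟩
            exacts [h, h2.trans h1]) (fun j y => ENNReal.ofReal (Real.exp (r *
              (Set.Iio (edgeProb b n (x v) (x j))).indicator 1 y)))
          (fun j => by
            have := measurable_one.indicator (f := (1 : ℝ → ℝ))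
              (measurableSet_Iio (a := edgeProb b n (x v) (x j)))
            fun_prop)]
        refine Finset.prod_le_prod' fun j _ => ?_
        rw [lintegral_exp_indicator _ measurableSet_Iio, unif_real_Iio
          (edgeProb_nonneg hb n (hx v) (hx j)) (edgeProb_le_one _ _ _ _)]
        have := h (x v) hxD (hx v) (x j) (hx j)
        exact ENNReal.ofReal_le_ofReal (by linarith)
    _ ≤ ∫⁻ x : Fin n → ℝ, ∏ j ∈ Finset.univ.erase v, f (x j) ∂(Measure.pi fun _ => μ) :=
        setLIntegral_le_lintegral _ _
    _ = ∏ j ∈ Finset.univ.erase v, ∫⁻ y, f y ∂μ :=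
        lintegral_pi_prod (κ := Fin n) μ (g := fun j => j) (fun _ _ h => h) (fun _ => f)
          (fun _ => hf) _
    _ = (∫⁻ y, f y ∂μ) ^ (n - 1) := by
        rw [Finset.prod_const, Finset.card_erase_of_mem (Finset.mem_univ _), Finset.card_univ,
          Fintype.card_fin]
    _ ≤ (ENNReal.ofReal (Real.exp ((Real.exp r - 1) * meanProb μ (b * w / n)))) ^ (n - 1) := by
        gcongr
        have hi : Integrable (fun y => edgeProb b n w y) μ := by
          simp_rw [edgeProb_eq]
          exact integrable_one_sub_exp h0 (by positivity)
        rw [← ofReal_integral_eq_lintegral_ofReal (f := fun y => 1 + (Real.exp r - 1) *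
          edgeProb b n w y) ((integrable_const _).add (hi.const_mul _))]
        · refine ENNReal.ofReal_le_ofReal ?_
          rw [integral_add (integrable_const _) (hi.const_mul _), integral_const_mul]
          simp_rw [edgeProb_eq]
          have := Real.add_one_le_exp ((Real.exp r - 1) * meanProb μ (b * w / n))
          simp only [integral_const, probReal_univ, smul_eq_mul, mul_one]
          rw [meanProb] at *
          linarith
        · filter_upwards [h0] with y hy
          exact one_add_mul_nonneg r (edgeProb_nonneg hb n hw hy) (edgeProb_le_one _ _ _ _)
    _ = _ := by
        rw [← ENNReal.ofReal_pow (Real.exp_nonneg _), ← Real.exp_nat_mul, Nat.cast_sub v.pos]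
        congr 2
        push_cast
        ring

theorem measure_deg_large {μ : Measure ℝ} [IsProbabilityMeasure μ] (h0 : ∀ᵐ x ∂μ, 0 ≤ x)
    {b : ℝ} (hb : 0 ≤ b) {n : ℕ} (v : Fin n) {w : ℝ} (hw : 0 ≤ w) {γ : ℝ} (hγ0 : 0 < γ)
    (hγ1 : γ ≤ 1) :
    sampleMeasure μ n {ω | (1 + γ) * ((n - 1) * meanProb μ (b * w / n)) ≤ deg b v ω ∧
      ω.1 v ≤ w} ≤
      ENNReal.ofReal (Real.exp (-(γ ^ 2 / 4 * ((n - 1) * meanProb μ (b * w / n))))) := by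
  have hn : (1 : ℝ) ≤ n := by exact_mod_cast v.pos
  have hm : 0 ≤ (n - 1) * meanProb μ (b * w / n) :=
    mul_nonneg (by linarith) (meanProb_nonneg h0 (by positivity))
  have := chernoff_upper ((sampleMeasure μ n).restrict {ω | ω.1 v ∈ Set.Iic w})
    (measurable_deg b v) hγ0 hγ1 hm fun r hr =>
      lintegral_exp_deg_le h0 hb v hw r measurableSet_Iic fun x hx hx0 y hy => by
        have : 1 < Real.exp r := Real.one_lt_exp_iff.2 hr
        exact mul_le_mul_of_nonneg_left (edgeProb_mono hb n hx0 hy hx le_rfl) (by linarith)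
  rwa [Measure.restrict_apply (measurableSet_le (by fun_prop) (measurable_deg b v))] at this

theorem measure_deg_small {μ : Measure ℝ} [IsProbabilityMeasure μ] (h0 : ∀ᵐ x ∂μ, 0 ≤ x)
    {b : ℝ} (hb : 0 ≤ b) {n : ℕ} (v : Fin n) {w : ℝ} (hw : 0 ≤ w) {γ : ℝ} (hγ0 : 0 < γ)
    (hγ1 : γ ≤ 1) :
    sampleMeasure μ n {ω | deg b v ω ≤ (1 - γ) * ((n - 1) * meanProb μ (b * w / n)) ∧
      w ≤ ω.1 v} ≤
      ENNReal.ofReal (Real.exp (-(γ ^ 2 / 4 * ((n - 1) * meanProb μ (b * w / n))))) := by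
  have hn : (1 : ℝ) ≤ n := by exact_mod_cast v.pos
  have hm : 0 ≤ (n - 1) * meanProb μ (b * w / n) :=
    mul_nonneg (by linarith) (meanProb_nonneg h0 (by positivity))
  have := chernoff_lower ((sampleMeasure μ n).restrict {ω | ω.1 v ∈ Set.Ici w})
    (measurable_deg b v) hγ0 hγ1 hm fun r hr =>
      lintegral_exp_deg_le h0 hb v hw r measurableSet_Ici fun x hx hx0 y hy => by
        have : Real.exp r < 1 := Real.exp_lt_one_iff.2 hr
        exact mul_le_mul_of_nonpos_left (edgeProb_mono hb n hw hy hx le_rfl) (by linarith)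
  rwa [Measure.restrict_apply (measurableSet_le (measurable_deg b v) (by fun_prop))] at this

/-- The number of vertices of weight larger than `c`. -/
noncomputable def numAbove {n : ℕ} (c : ℝ) (ω : Sample n) : ℝ :=
  ((Finset.univ.filter fun i => c < ω.1 i).card : ℝ)

theorem numAbove_eq {n : ℕ} (c : ℝ) (ω : Sample n) :
    numAbove c ω = ∑ i, (Set.Ioi c).indicator 1 (ω.1 i) := by
  simp [Set.indicator_apply, Finset.sum_boole, numAbove]

theorem measurable_numAbove {n : ℕ} (c : ℝ) : Measurable (numAbove (n := n) c) := by
  have : numAbove (n := n) c = fun ω => ∑ i, (Set.Ioi c).indicator 1 (ω.1 i) := by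
    ext ω; rw [numAbove_eq]
  rw [this]
  have := measurable_one.indicator (f := (1 : ℝ → ℝ)) (measurableSet_Ioi (a := c))
  fun_prop

theorem lintegral_exp_numAbove_le (μ : Measure ℝ) [IsProbabilityMeasure μ] {n : ℕ} (c r : ℝ) :
    ∫⁻ ω, ENNReal.ofReal (Real.exp (r * numAbove c ω)) ∂(sampleMeasure μ n) ≤
      ENNReal.ofReal (Real.exp ((Real.exp r - 1) * (n * μ.real (Set.Ioi c)))) := by
  have hm := measurable_numAbove (n := n) c
  have hi := measurable_one.indicator (f := (1 : ℝ → ℝ)) (measurableSet_Ioi (a := c))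
  have e : ∀ ω : Sample n, ENNReal.ofReal (Real.exp (r * numAbove c ω)) =
      ∏ i, ENNReal.ofReal (Real.exp (r * (Set.Ioi c).indicator 1 (ω.1 i))) := by
    intro ω
    rw [numAbove_eq, Finset.mul_sum, Real.exp_sum,
      ENNReal.ofReal_prod_of_nonneg fun _ _ => Real.exp_nonneg _]
  rw [sampleMeasure, lintegral_prod _ (by fun_prop)]
  simp_rw [e, lintegral_const, measure_univ, mul_one]
  rw [lintegral_pi_prod (κ := Fin n) μ (g := fun j => j) (fun _ _ h => h)
    (fun _ y => ENNReal.ofReal (Real.exp (r * (Set.Ioi c).indicator 1 y)))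
    (fun _ => by fun_prop), Finset.prod_const, Finset.card_univ, Fintype.card_fin,
    lintegral_exp_indicator _ measurableSet_Ioi,
    ← ENNReal.ofReal_pow (one_add_mul_nonneg r measureReal_nonneg measureReal_le_one)]
  refine ENNReal.ofReal_le_ofReal ?_
  have h1 := Real.add_one_le_exp ((Real.exp r - 1) * μ.real (Set.Ioi c))
  calc _ ≤ Real.exp ((Real.exp r - 1) * μ.real (Set.Ioi c)) ^ n := by
        have := one_add_mul_nonneg r (measureReal_nonneg (μ := μ) (s := Set.Ioi c))
          measureReal_le_one
        gcongr
        linarith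
    _ = _ := by
        rw [← Real.exp_nat_mul]
        congr 1
        ring

theorem measure_numAbove_large (μ : Measure ℝ) [IsProbabilityMeasure μ] {n : ℕ} (c : ℝ)
    {γ : ℝ} (hγ0 : 0 < γ) (hγ1 : γ ≤ 1) :
    sampleMeasure μ n {ω | (1 + γ) * (n * μ.real (Set.Ioi c)) ≤ numAbove c ω} ≤
      ENNReal.ofReal (Real.exp (-(γ ^ 2 / 4 * (n * μ.real (Set.Ioi c))))) :=
  chernoff_upper _ (measurable_numAbove c) hγ0 hγ1 (by positivity)
    fun r _ => lintegral_exp_numAbove_le μ c r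

theorem measure_numAbove_small (μ : Measure ℝ) [IsProbabilityMeasure μ] {n : ℕ} (c : ℝ)
    {γ : ℝ} (hγ0 : 0 < γ) (hγ1 : γ ≤ 1) :
    sampleMeasure μ n {ω | numAbove c ω ≤ (1 - γ) * (n * μ.real (Set.Ioi c))} ≤
      ENNReal.ofReal (Real.exp (-(γ ^ 2 / 4 * (n * μ.real (Set.Ioi c))))) :=
  chernoff_lower _ (measurable_numAbove c) hγ0 hγ1 (by positivity)
    fun r _ => lintegral_exp_numAbove_le μ c r

end PowerLawGraph

/-! ### Light cliques and heavy nonadjacent pairs. -/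

namespace PowerLawGraph

open ProbabilityTheory ENNReal

theorem measurableSet_isClique (b : ℝ) {n : ℕ} (S : Finset (Fin n)) :
    MeasurableSet {ω : Sample n | (randomGraph b n ω).IsClique (S : Set (Fin n))} := by
  have : {ω : Sample n | (randomGraph b n ω).IsClique (S : Set (Fin n))} =
      ⋂ i, ⋂ j, ⋂ (_ : i ∈ S ∧ j ∈ S ∧ i ≠ j), {ω | (randomGraph b n ω).Adj i j} := by
    ext ω
    simp only [Set.mem_ofPred_eq, Set.mem_iInter]
    exact ⟨fun h i j hij => h hij.1 hij.2.1 hij.2.2, fun h i hi j hj hij => h i j ⟨hi, hj, hij⟩⟩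
  rw [this]
  exact .iInter fun i => .iInter fun j => .iInter fun _ => measurableSet_adj b n i j

/-- Cliques of `k` vertices of weight at most `c` are unlikely. -/
theorem measure_exists_light_clique {μ : Measure ℝ} [IsProbabilityMeasure μ]
    (h0 : ∀ᵐ x ∂μ, 0 ≤ x) {b : ℝ} (hb : 0 ≤ b) {n : ℕ} {c : ℝ} (hc : 0 ≤ c) (k : ℕ) :
    sampleMeasure μ n {ω | ∃ S : Finset (Fin n), S.card = k ∧
      (randomGraph b n ω).IsClique (S : Set (Fin n)) ∧ ∀ i ∈ S, ω.1 i ≤ c} ≤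
      ENNReal.ofReal (n ^ k * edgeProb b n c c ^ (k.choose 2)) := by
  have hp := edgeProb_nonneg hb n hc hc
  have hsub : {ω : Sample n | ∃ S : Finset (Fin n), S.card = k ∧
      (randomGraph b n ω).IsClique (S : Set (Fin n)) ∧ ∀ i ∈ S, ω.1 i ≤ c} ⊆
      ⋃ S ∈ Finset.powersetCard k (Finset.univ : Finset (Fin n)),
        {ω : Sample n | (randomGraph b n ω).IsClique (S : Set (Fin n)) ∧ ∀ i ∈ S, ω.1 i ≤ c} := by
    rintro ω ⟨S, hS, h1, h2⟩
    simp only [Set.mem_iUnion]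
    exact ⟨S, by simpa using hS, h1, h2⟩
  refine (measure_mono hsub).trans ((measure_biUnion_finset_le _ _).trans ?_)
  calc _ ≤ ∑ S ∈ Finset.powersetCard k (Finset.univ : Finset (Fin n)),
        ENNReal.ofReal (edgeProb b n c c ^ (k.choose 2)) := by
        refine Finset.sum_le_sum fun S hS => ?_
        have hSk : S.card = k := (Finset.mem_powersetCard.1 hS).2
        have hm : MeasurableSet {ω : Sample n | (randomGraph b n ω).IsClique (S : Set (Fin n)) ∧
            ∀ i ∈ S, ω.1 i ≤ c} := by
          have hS : MeasurableSet {ω : Sample n | ∀ i ∈ S, ω.1 i ≤ c} := by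
            have : {ω : Sample n | ∀ i ∈ S, ω.1 i ≤ c} = ⋂ i, ⋂ (_ : i ∈ S), {ω | ω.1 i ≤ c} := by
              ext; simp
            rw [this]
            exact .iInter fun i => .iInter fun _ => measurableSet_coord_le i c
          exact (measurableSet_isClique b S).inter hS
        refine (sampleMeasure_le_lintegral μ hm (fun _ =>
          ENNReal.ofReal (edgeProb b n c c ^ (k.choose 2))) ?_).trans (by simp)
        filter_upwards [ae_pi_nonneg h0 n] with x hx
        by_cases hxc : ∀ i ∈ S, x i ≤ c
        swap
        · refine (measure_mono_null (t := ∅) ?_ (by simp)).trans_le zero_le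
          exact fun u hu => hxc hu.2
        -- Given the weights, the unordered pairs inside `S` are independent edges, each of
        -- probability at most `edgeProb b n c c`.
        calc _ ≤ (Measure.pi fun _ : Sym2 (Fin n) => unif)
              {u | ∀ e ∈ S.offDiag.image Sym2.mk.uncurry, u e < pairProb b x e} := by
              refine measure_mono fun u hu e he => ?_
              obtain ⟨⟨i, j⟩, hij, rfl⟩ := Finset.mem_image.1 he
              obtain ⟨hi, hj, hne⟩ := Finset.mem_offDiag.1 hij
              exact (hu.1 hi hj hne).2
          _ = _ := measure_forall_lt_pairProb hb hx _
          _ ≤ ∏ e ∈ S.offDiag.image Sym2.mk.uncurry, ENNReal.ofReal (edgeProb b n c c) := by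
              refine Finset.prod_le_prod' fun e he => ?_
              obtain ⟨⟨i, j⟩, hij, rfl⟩ := Finset.mem_image.1 he
              obtain ⟨hi, hj, hne⟩ := Finset.mem_offDiag.1 hij
              exact ENNReal.ofReal_le_ofReal
                (edgeProb_mono hb n (hx i) (hx j) (hxc i hi) (hxc j hj))
          _ = _ := by
              rw [Finset.prod_const, Sym2.card_image_offDiag, hSk, ENNReal.ofReal_pow hp]
    _ = (n.choose k : ℝ≥0∞) * ENNReal.ofReal (edgeProb b n c c ^ (k.choose 2)) := by
        rw [Finset.sum_const, Finset.card_powersetCard, Finset.card_univ, Fintype.card_fin,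
          nsmul_eq_mul]
    _ ≤ _ := by
        rw [ENNReal.ofReal_mul (by positivity)]
        gcongr
        rw [← ENNReal.ofReal_natCast]
        refine ENNReal.ofReal_le_ofReal ?_
        exact_mod_cast Nat.choose_le_pow n k

/-- Two nonadjacent vertices of weights larger than `c`. -/
def heavyNonedge (b : ℝ) {n : ℕ} (c : ℝ) (p : Fin n × Fin n) : Set (Sample n) :=
  {ω | p.1 ≠ p.2 ∧ c < ω.1 p.1 ∧ c < ω.1 p.2 ∧ ¬ (randomGraph b n ω).Adj p.1 p.2}

theorem measurableSet_heavyNonedge (b : ℝ) {n : ℕ} (c : ℝ) (p : Fin n × Fin n) :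
    MeasurableSet (heavyNonedge b c p) :=
  (MeasurableSet.const _).inter <| (measurableSet_coord_gt _ _).inter <|
    (measurableSet_coord_gt _ _).inter (measurableSet_adj b n _ _).compl

theorem measure_heavyNonedge {μ : Measure ℝ} [IsProbabilityMeasure μ]
    (h0 : ∀ᵐ x ∂μ, 0 ≤ x) {b : ℝ} (hb : 0 ≤ b) {n : ℕ} {c : ℝ} (hc : 0 ≤ c)
    (p : Fin n × Fin n) : sampleMeasure μ n (heavyNonedge b c p) ≤
      ENNReal.ofReal (μ.real (Set.Ioi c) ^ 2 * Real.exp (-(b * (c * c) / n))) := by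
  obtain ⟨v, w⟩ := p
  by_cases hvw : v = w
  · have : heavyNonedge b c (v, w) = ∅ := by simp [heavyNonedge, hvw]
    simp [this]
  let f : ℝ → ℝ≥0∞ := (Set.Ioi c).indicator 1
  have hf : Measurable f := measurable_one.indicator measurableSet_Ioi
  have hinj : Function.Injective ![v, w] := by
    intro i j hij
    fin_cases i <;> fin_cases j <;> simp_all
  refine (sampleMeasure_le_lintegral μ (measurableSet_heavyNonedge b c (v, w)) (fun x =>
    (∏ i : Fin 2, f (x (![v, w] i))) * ENNReal.ofReal (Real.exp (-(b * (c * c) / n)))) ?_).trans ?_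
  · filter_upwards [ae_pi_nonneg h0 n] with x hx
    by_cases hxc : c < x v ∧ c < x w
    swap
    · refine (measure_mono_null (t := ∅) ?_ (by simp)).trans_le zero_le
      exact fun u hu => hxc ⟨hu.2.1, hu.2.2.1⟩
    calc _ ≤ (Measure.pi fun _ : Sym2 (Fin n) => unif)
          ((fun u => u s(v, w)) ⁻¹' Set.Ici (edgeProb b n (x v) (x w))) := by
          refine measure_mono fun u hu => ?_
          have := hu.2.2.2
          simp only [randomGraph, not_and, not_lt] at this
          exact this hvw
      _ = unif (Set.Ici (edgeProb b n (x v) (x w))) :=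
          (measurePreserving_eval (fun _ : Sym2 (Fin n) => unif) s(v, w)).measure_preimage
            measurableSet_Ici.nullMeasurableSet
      _ = ENNReal.ofReal (Real.exp (-(b * (x v * x w) / n))) := by
          rw [unif_Ici (edgeProb_nonneg hb n (hx v) (hx w)) (edgeProb_le_one _ _ _ _), edgeProb,
            _root_.sub_sub_cancel]
      _ ≤ _ := by
          have e1 : x v ∈ Set.Ioi c := hxc.1
          have e2 : x w ∈ Set.Ioi c := hxc.2
          simp only [f, Fin.prod_univ_two, Matrix.cons_val_zero, Matrix.cons_val_one,
            Set.indicator_of_mem e1, Set.indicator_of_mem e2, Pi.one_apply, one_mul]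
          have := mul_le_mul hxc.1.le hxc.2.le hc (hx v)
          gcongr
  · rw [lintegral_mul_const _ (by fun_prop), lintegral_pi_prod (κ := Fin 2) μ hinj (fun _ => f)
      fun _ => hf, Fin.prod_univ_two, lintegral_indicator_one measurableSet_Ioi,
      ENNReal.ofReal_mul (by positivity), ENNReal.ofReal_pow measureReal_nonneg,
      ofReal_measureReal, sq]

/-- The number of ordered pairs of nonadjacent vertices of weights larger than `c`. -/
noncomputable def numNonedges (b : ℝ) {n : ℕ} (c : ℝ) (ω : Sample n) : ℝ :=
  ∑ p, (heavyNonedge b c p).indicator 1 ω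

theorem measure_numNonedges {μ : Measure ℝ} [IsProbabilityMeasure μ]
    (h0 : ∀ᵐ x ∂μ, 0 ≤ x) {b : ℝ} (hb : 0 ≤ b) {n : ℕ} {c : ℝ} (hc : 0 ≤ c) {y : ℝ} (hy : 0 < y) :
    sampleMeasure μ n {ω | y ≤ numNonedges b c ω} ≤
      ENNReal.ofReal ((n * μ.real (Set.Ioi c)) ^ 2 * Real.exp (-(b * (c * c) / n)) / y) := by
  refine (measure_le_sum_indicator _ _ _ (fun p => measurableSet_heavyNonedge b c p) hy).trans ?_
  rw [ENNReal.div_le_iff (by simpa using hy) (by simp), ← ENNReal.ofReal_mul (by positivity)]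
  calc _ ≤ ∑ p : Fin n × Fin n, _ :=
        Finset.sum_le_sum fun p _ => measure_heavyNonedge h0 hb hc p
    _ = _ := by
        rw [Finset.sum_const, Finset.card_univ, nsmul_eq_mul, ← ENNReal.ofReal_natCast,
          ← ENNReal.ofReal_mul (by positivity)]
        congr 1
        simp only [Fintype.card_prod, Fintype.card_fin, Nat.cast_mul]
        field_simp

/-- A maximal clique of the graph induced on the vertices of degree at least `d` is large, if the
degrees separate the vertices of large weight from those of small weight. -/
theorem numAbove_le_card {b : ℝ} {n : ℕ} {ω : Sample n} {d w₁ w₂ : ℝ} (hw : w₁ ≤ w₂)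
    (h1 : ∀ v, ω.1 v ≤ w₁ → deg b v ω < d) (h2 : ∀ v, w₂ < ω.1 v → d ≤ deg b v ω)
    {C : Finset (Fin n)} (hC : ∀ v ∈ C, d ≤ deg b v ω)
    (hmax : ∀ u, d ≤ deg b u ω → u ∉ C → ∃ w ∈ C, ¬ (randomGraph b n ω).Adj u w) :
    numAbove w₂ ω ≤ C.card + numNonedges b w₁ ω := by
  classical
  let A : Finset (Fin n) := Finset.univ.filter fun i => w₂ < ω.1 i
  have hA : ∀ u ∈ A \ C, ∃ w ∈ C, ¬ (randomGraph b n ω).Adj u w := by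
    intro u hu
    rw [Finset.mem_sdiff] at hu
    exact hmax u (h2 u (by simpa [A] using hu.1)) hu.2
  -- Each heavy vertex `u` missed by `C` has a nonneighbour `g u` in `C`, and `g u` has weight above
  -- `w₁` because its degree is at least `d`. The pairs `(u, g u)` are distinct.
  choose! g hg1 hg2 using hA
  have hcard : (A \ C).card ≤
      (Finset.univ.filter fun p : Fin n × Fin n => ω ∈ heavyNonedge b w₁ p).card := by
    refine Finset.card_le_card_of_injOn (fun u => (u, g u)) (fun u hu => ?_)
      fun u _ u' _ h => congrArg Prod.fst h
    have huA : w₂ < ω.1 u := by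
      have := (Finset.mem_sdiff.1 hu).1
      simpa [A] using this
    simp only [Finset.coe_filter, Finset.mem_univ, true_and, Set.mem_ofPred_eq]
    refine ⟨?_, hw.trans_lt huA, ?_, hg2 u hu⟩
    · intro h
      change u = g u at h
      exact (Finset.mem_sdiff.1 hu).2 (h ▸ hg1 u hu)
    · by_contra hle
      exact absurd (hC _ (hg1 u hu)) (not_le.2 (h1 _ (not_lt.1 hle)))
  have hsum : numNonedges b w₁ ω =
      ((Finset.univ.filter fun p : Fin n × Fin n => ω ∈ heavyNonedge b w₁ p).card : ℝ) := by
    simp [numNonedges, Set.indicator_apply, Finset.sum_boole]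
  rw [hsum, numAbove]
  have : A.card ≤ C.card + (A \ C).card := by
    have := Finset.card_le_card_sdiff_add_card (s := A) (t := C)
    omega
  exact_mod_cast (this.trans (by gcongr) : A.card ≤ C.card + _)

/-- An upper bound for the clique number. -/
theorem cliqueNum_le {b : ℝ} {n : ℕ} {ω : Sample n} {c y : ℝ}
    (h : ¬ ∃ S : Finset (Fin n), S.card = ⌈y⌉₊ ∧
      (randomGraph b n ω).IsClique (S : Set (Fin n)) ∧ ∀ i ∈ S, ω.1 i ≤ c) :
    ((randomGraph b n ω).cliqueNum : ℝ) ≤ numAbove c ω + y := by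
  obtain ⟨K, hK⟩ := (randomGraph b n ω).exists_isNClique_cliqueNum
  -- More than `y` light vertices in a largest clique would contain a light clique of exactly `⌈y⌉₊`
  -- vertices.
  have hlight : ((K.filter fun i => ¬ c < ω.1 i).card : ℝ) ≤ y := by
    by_contra! hlt
    obtain ⟨S, hS, hS'⟩ := Finset.exists_subset_card_eq (Nat.ceil_le.2 hlt.le)
    refine h ⟨S, hS', fun i hi j hj => ?_, fun i hi => ?_⟩
    · exact hK.isClique (Finset.mem_filter.1 (hS hi)).1 (Finset.mem_filter.1 (hS hj)).1
    · simpa using (Finset.mem_filter.1 (hS hi)).2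
  have hheavy : (K.filter fun i => c < ω.1 i).card ≤
      (Finset.univ.filter fun i => c < ω.1 i).card :=
    Finset.card_le_card (Finset.filter_subset_filter _ (Finset.subset_univ _))
  have := Finset.card_filter_add_card_filter_not (s := K) fun i => c < ω.1 i
  rw [← hK.card_eq, ← this, numAbove]
  push_cast
  gcongr

end PowerLawGraph

/-! ### Asymptotics at the cutoff weight. -/

namespace PowerLawGraph

open ProbabilityTheory

theorem tendsto_rpow_mul_log_rpow_atTop {p : ℝ} (hp : 0 < p) (r : ℝ) :
    Tendsto (fun n : ℕ => (n : ℝ) ^ p * Real.log n ^ r) atTop atTop := by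
  have h1 := ((isLittleO_log_rpow_rpow_atTop (-r) hp).tendsto_div_nhds_zero).comp
    tendsto_natCast_atTop_atTop
  have h2 : ∀ᶠ n : ℕ in atTop, 1 < n := eventually_gt_atTop 1
  have h3 : Tendsto (fun n : ℕ => Real.log n ^ (-r) / (n : ℝ) ^ p) atTop (𝓝[>] 0) := by
    refine tendsto_nhdsWithin_iff.2 ⟨h1, ?_⟩
    filter_upwards [h2] with n hn
    have : 0 < Real.log n := Real.log_pos (by exact_mod_cast hn)
    have : (0 : ℝ) < n := by positivity
    exact Set.mem_Ioi.2 (by positivity)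
  refine h3.inv_tendsto_nhdsGT_zero.congr' ?_
  filter_upwards [h2] with n hn
  have : 0 < Real.log n := Real.log_pos (by exact_mod_cast hn)
  simp only [Pi.inv_apply, inv_div]
  rw [Real.rpow_neg this.le, div_inv_eq_mul]

theorem tendsto_rpow_mul_log_rpow_zero {p : ℝ} (hp : p < 0) (r : ℝ) :
    Tendsto (fun n : ℕ => (n : ℝ) ^ p * Real.log n ^ r) atTop (𝓝 0) := by
  refine (tendsto_rpow_mul_log_rpow_atTop (neg_pos.2 hp) (-r)).inv_tendsto_atTop.congr' ?_
  filter_upwards [eventually_gt_atTop 1] with n hn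
  have : 0 < Real.log n := Real.log_pos (by exact_mod_cast hn)
  simp only [Pi.inv_apply, mul_inv]
  rw [Real.rpow_neg this.le, Real.rpow_neg (by positivity), inv_inv, inv_inv]

/-- The order of the smallest weight of a typical vertex of a largest clique. -/
noncomputable def cutoff (κ : ℝ) (n : ℕ) : ℝ := √(κ * (n * Real.log n))

theorem cutoff_rpow {κ : ℝ} (hκ : 0 ≤ κ) (n : ℕ) (p : ℝ) :
    cutoff κ n ^ p = κ ^ (p / 2) * ((n : ℝ) ^ (p / 2) * Real.log n ^ (p / 2)) := by
  have hL := Real.log_natCast_nonneg n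
  rw [cutoff, Real.sqrt_eq_rpow, ← Real.rpow_mul (by positivity), Real.mul_rpow hκ (by positivity),
    Real.mul_rpow (by positivity) hL]
  ring_nf

theorem cutoff_pos {κ : ℝ} (hκ : 0 < κ) {n : ℕ} (hn : 1 < n) : 0 < cutoff κ n := by
  have : 0 < Real.log n := Real.log_pos (by exact_mod_cast hn)
  have : (0 : ℝ) < n := by positivity
  exact Real.sqrt_pos.2 (by positivity)

theorem tendsto_cutoff {κ : ℝ} (hκ : 0 < κ) : Tendsto (cutoff κ) atTop atTop := by
  have := (tendsto_rpow_mul_log_rpow_atTop (p := 1 / 2) (by norm_num) (1 / 2)).const_mul_atTop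
    (by positivity : 0 < κ ^ (1 / 2 : ℝ))
  refine this.congr fun n => ?_
  rw [← cutoff_rpow hκ.le n 1, Real.rpow_one]

/-- The factor `log n` in the cutoff turns the nonadjacency probability into a power of `n`. -/
theorem exp_cutoff {κ : ℝ} (hκ : 0 ≤ κ) (b c : ℝ) {n : ℕ} (hn : 0 < n) :
    Real.exp (-(b * (c * cutoff κ n * (c * cutoff κ n)) / n)) = (n : ℝ) ^ (-(b * c ^ 2 * κ)) := by
  have hn' : (0 : ℝ) < n := by exact_mod_cast hn
  have hL := Real.log_natCast_nonneg n
  have e : cutoff κ n * cutoff κ n = κ * (n * Real.log n) := Real.mul_self_sqrt (by positivity)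
  rw [Real.rpow_def_of_pos hn']
  congr 1
  rw [show c * cutoff κ n * (c * cutoff κ n) = c ^ 2 * (cutoff κ n * cutoff κ n) by ring, e]
  field_simp

/-- The expected number of vertices of weight above the cutoff. -/
noncomputable def sizeAbove (α a κ : ℝ) (n : ℕ) : ℝ := n * (a * cutoff κ n ^ (-α))

theorem sizeAbove_eq {α a κ : ℝ} (hκ : 0 ≤ κ) {n : ℕ} (hn : 0 < n) :
    sizeAbove α a κ n =
      a * κ ^ (-α / 2) * ((n : ℝ) ^ (1 - α / 2) * Real.log n ^ (-α / 2)) := by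
  have hn' : (0 : ℝ) < n := by exact_mod_cast hn
  rw [sizeAbove, cutoff_rpow hκ, sub_eq_add_neg, ← neg_div, Real.rpow_add hn', Real.rpow_one]
  ring

theorem sizeAbove_mul_rpow {α a κ : ℝ} (hκ : 0 ≤ κ) {n : ℕ} (hn : 1 < n) (p r : ℝ) :
    sizeAbove α a κ n * ((n : ℝ) ^ p * Real.log n ^ r) =
      a * κ ^ (-α / 2) * ((n : ℝ) ^ (1 - α / 2 + p) * Real.log n ^ (-α / 2 + r)) := by
  have hn' : (0 : ℝ) < n := by positivity
  have hL : 0 < Real.log n := Real.log_pos (by exact_mod_cast hn)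
  rw [sizeAbove_eq hκ (by omega), Real.rpow_add hn', Real.rpow_add hL]
  ring

theorem tendsto_sizeAbove {α a κ : ℝ} (hα : α < 2) (ha : 0 < a) (hκ : 0 < κ) :
    Tendsto (sizeAbove α a κ) atTop atTop := by
  refine ((tendsto_rpow_mul_log_rpow_atTop (p := 1 - α / 2) (by linarith)
    (-α / 2)).const_mul_atTop (by positivity : 0 < a * κ ^ (-α / 2))).congr' ?_
  filter_upwards [eventually_gt_atTop 0] with n hn
  rw [sizeAbove_eq hκ.le hn]

section

variable {μ : Measure ℝ} {α a b x₀ κ : ℝ}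

theorem eventually_real_Ioi (hμ : IsWeightLaw μ α a x₀) (hκ : 0 < κ) {c : ℝ} (hc : 0 < c) :
    ∀ᶠ n : ℕ in atTop, n * μ.real (Set.Ioi (c * cutoff κ n)) =
      c ^ (-α) * sizeAbove α a κ n := by
  filter_upwards [((tendsto_cutoff hκ).const_mul_atTop hc).eventually_ge_atTop x₀,
    eventually_gt_atTop 1] with n h1 hn
  rw [hμ.tail _ h1, Real.mul_rpow hc.le (cutoff_pos hκ hn).le, sizeAbove]
  ring

theorem tendsto_exp_neg_sizeAbove (hα : α < 2) (ha : 0 < a) (hκ : 0 < κ) {c γ : ℝ} (hc : 0 < c)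
    (hγ : 0 < γ) :
    Tendsto (fun n => Real.exp (-(γ ^ 2 / 4 * (c ^ (-α) * sizeAbove α a κ n)))) atTop (𝓝 0) :=
  Real.tendsto_exp_neg_atTop_nhds_zero.comp
    (((tendsto_sizeAbove hα ha hκ).const_mul_atTop (by positivity)).const_mul_atTop
      (by positivity))

variable [IsProbabilityMeasure μ]

theorem tendsto_numAbove_large (hμ : IsWeightLaw μ α a x₀) (hα : α < 2) (ha : 0 < a) (hκ : 0 < κ)
    {c γ : ℝ} (hc : 0 < c) (hγ0 : 0 < γ) (hγ1 : γ ≤ 1) :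
    Tendsto (fun n : ℕ => sampleMeasure μ n {ω | (1 + γ) * (c ^ (-α) * sizeAbove α a κ n) ≤
      numAbove (c * cutoff κ n) ω}) atTop (𝓝 0) := by
  refine tendsto_measure_of_le_ofReal _ ?_ (tendsto_exp_neg_sizeAbove hα ha hκ hc hγ0)
  filter_upwards [eventually_real_Ioi hμ hκ hc] with n hn
  rw [← hn]
  exact measure_numAbove_large μ _ hγ0 hγ1

theorem tendsto_numAbove_small (hμ : IsWeightLaw μ α a x₀) (hα : α < 2) (ha : 0 < a) (hκ : 0 < κ)
    {c γ : ℝ} (hc : 0 < c) (hγ0 : 0 < γ) (hγ1 : γ ≤ 1) :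
    Tendsto (fun n : ℕ => sampleMeasure μ n {ω | numAbove (c * cutoff κ n) ω ≤
      (1 - γ) * (c ^ (-α) * sizeAbove α a κ n)}) atTop (𝓝 0) := by
  refine tendsto_measure_of_le_ofReal _ ?_ (tendsto_exp_neg_sizeAbove hα ha hκ hc hγ0)
  filter_upwards [eventually_real_Ioi hμ hκ hc] with n hn
  rw [← hn]
  exact measure_numAbove_small μ _ hγ0 hγ1

/-- The expected number is of order `N² n ^ (-c² (1 - α/2))`. Since `N` is `n ^ (1 - α/2)` up to
logarithms and `c > 1`, this is `N` times a negative power of `n`, and Markov's inequality applies.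
-/
theorem tendsto_numNonedges (hμ : IsWeightLaw μ α a x₀) (hα : α < 2) (ha : 0 < a) (hb : 0 < b)
    (hκ : κ = (1 - α / 2) / b) {c y : ℝ} (hc : 1 < c) (hy : 0 < y) :
    Tendsto (fun n : ℕ => sampleMeasure μ n {ω | y * sizeAbove α a κ n ≤
      numNonedges b (c * cutoff κ n) ω}) atTop (𝓝 0) := by
  have hβ : 0 < 1 - α / 2 := by linarith
  have hκ0 : 0 < κ := by rw [hκ]; positivity
  have hbκ : b * c ^ 2 * κ = c ^ 2 * (1 - α / 2) := by rw [hκ]; field_simp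
  have hneg : 1 - α / 2 + -(b * c ^ 2 * κ) < 0 := by
    rw [hbκ]
    have : 1 < c ^ 2 := by nlinarith
    nlinarith
  have hlim := (tendsto_rpow_mul_log_rpow_zero hneg (-α / 2 + 0)).const_mul
    ((c ^ (-α)) ^ 2 / y * (a * κ ^ (-α / 2)))
  rw [mul_zero] at hlim
  refine tendsto_measure_of_le_ofReal _ ?_ hlim
  filter_upwards [eventually_real_Ioi hμ hκ0 (zero_lt_one.trans hc), eventually_gt_atTop 1,
    (tendsto_sizeAbove hα ha hκ0).eventually_gt_atTop 0] with n hn hn1 hN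
  have hct := cutoff_pos hκ0 hn1
  refine (measure_numNonedges hμ.nonneg hb.le (by positivity) (by positivity)).trans ?_
  refine ENNReal.ofReal_le_ofReal (le_of_eq ?_)
  rw [hn, exp_cutoff hκ0.le b c (by omega), mul_assoc ((c ^ (-α)) ^ 2 / y),
    ← sizeAbove_mul_rpow hκ0.le hn1, Real.rpow_zero]
  field_simp

/-- With `q = n ^ (-c² (1 - α/2))`, the union bound is at most `exp (k log n - q k (k - 1) / 2)`. As
`c < 1`, `q N` is a positive power of `n` up to logarithms, so the second term wins for `k` of order
`N`. -/
theorem tendsto_light_clique (hμ : IsWeightLaw μ α a x₀) (hα : α < 2) (ha : 0 < a) (hb : 0 < b)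
    (hκ : κ = (1 - α / 2) / b) {c y : ℝ} (hc0 : 0 < c) (hc : c < 1) (hy : 0 < y) :
    Tendsto (fun n : ℕ => sampleMeasure μ n {ω | ∃ S : Finset (Fin n),
      S.card = ⌈y * sizeAbove α a κ n⌉₊ ∧ (randomGraph b n ω).IsClique (S : Set (Fin n)) ∧
        ∀ i ∈ S, ω.1 i ≤ c * cutoff κ n}) atTop (𝓝 0) := by
  have hβ : 0 < 1 - α / 2 := by linarith
  have hκ0 : 0 < κ := by rw [hκ]; positivity
  have hbκ : b * c ^ 2 * κ = c ^ 2 * (1 - α / 2) := by rw [hκ]; field_simp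
  have hpos : 0 < 1 - α / 2 + -(b * c ^ 2 * κ) := by
    rw [hbκ]
    have : c ^ 2 < 1 := by nlinarith
    nlinarith
  have hlim := (tendsto_rpow_mul_log_rpow_atTop hpos (-α / 2 + -1)).const_mul_atTop
    (by positivity : 0 < a * κ ^ (-α / 2))
  refine tendsto_measure_of_le_ofReal _ ?_ tendsto_inv_atTop_nhds_zero_nat
  -- The bound `2 / y` ensures `k ≥ 2`, hence `(k - 1) / 2 ≥ N y / 4`; with `8 / y` this makes `q (k
  -- - 1) / 2` at least `2 log n`.
  filter_upwards [eventually_gt_atTop 1, hlim.eventually_ge_atTop (8 / y),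
    (tendsto_sizeAbove hα ha hκ0).eventually_ge_atTop (2 / y)] with n hn1 h8 hN
  rw [← sizeAbove_mul_rpow hκ0.le hn1] at h8
  have hct := cutoff_pos hκ0 hn1
  refine (measure_exists_light_clique hμ.nonneg hb.le (by positivity) _).trans ?_
  refine ENNReal.ofReal_le_ofReal ?_
  have hn' : (0 : ℝ) < n := by positivity
  have hL : 0 < Real.log n := Real.log_pos (by exact_mod_cast hn1)
  set N := sizeAbove α a κ n
  set k := ⌈y * N⌉₊
  have hk : y * N ≤ k := Nat.le_ceil _
  rw [div_le_iff₀ hy] at hN h8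
  have hk2 : (2 : ℝ) ≤ k := by linarith
  rw [edgeProb, exp_cutoff hκ0.le b c (by omega)]
  set q := (n : ℝ) ^ (-(b * c ^ 2 * κ)) with hq
  have hq0 : 0 < q := by positivity
  have hq1 : q ≤ 1 := by
    rw [hq, Real.rpow_neg hn'.le]
    exact inv_le_one_of_one_le₀ (Real.one_le_rpow (by exact_mod_cast hn1.le) (by positivity))
  have h8' : 8 * Real.log n ≤ q * (N * y) := by
    rw [Real.rpow_neg hL.le, Real.rpow_one] at h8
    have : N * (q * (Real.log n)⁻¹) * y = q * (N * y) / Real.log n := by field_simp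
    rw [this, le_div_iff₀ hL] at h8
    exact h8
  have hbig : 2 * Real.log n ≤ q * ((k - 1) / 2) := by
    have : N * y / 4 ≤ (k - 1) / 2 := by linarith
    have := mul_le_mul_of_nonneg_left this hq0.le
    linarith
  calc (n : ℝ) ^ k * (1 - q) ^ k.choose 2
      ≤ Real.exp (k * Real.log n) * Real.exp (-q) ^ k.choose 2 := by
        have h1 : 1 - q ≤ Real.exp (-q) := by linarith [Real.add_one_le_exp (-q)]
        have h2 : Real.exp (k * Real.log n) = (n : ℝ) ^ k := by
          rw [Real.exp_nat_mul, Real.exp_log hn']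
        have h3 : 0 ≤ 1 - q := by linarith
        rw [h2]
        gcongr
    _ = Real.exp (k * Real.log n - k * (q * ((k - 1) / 2))) := by
        rw [← Real.exp_nat_mul, ← Real.exp_add, Nat.cast_choose_two]
        congr 1
        ring
    _ ≤ Real.exp (-Real.log n) := by
        gcongr
        have h1 := mul_le_mul_of_nonneg_left hbig (by positivity : (0 : ℝ) ≤ k)
        have h2 : 1 * Real.log n ≤ k * Real.log n := by gcongr; linarith
        linarith
    _ = (n : ℝ)⁻¹ := by rw [Real.exp_neg, Real.exp_log hn']

end

end PowerLawGraph

/-! ### Separation by degrees and the two cases of the theorem. -/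

namespace PowerLawGraph

open ProbabilityTheory

variable {μ : Measure ℝ} {α a b x₀ κ : ℝ} [IsProbabilityMeasure μ]

theorem IsWeightLaw.exists_tail_le (hμ : IsWeightLaw μ α a x₀) (hx₀ : 0 < x₀) (ha : 0 ≤ a)
    (hα : 2 ≤ α) :
    ∃ K : ℝ, 0 ≤ K ∧ ∀ x : ℝ, 0 < x → μ (Set.Ioi x) ≤ ENNReal.ofReal (K / x ^ 2) := by
  refine ⟨a * x₀ ^ (2 - α) + x₀ ^ 2, by positivity, fun x hx => ?_⟩
  rw [← ofReal_measureReal]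
  refine ENNReal.ofReal_le_ofReal ?_
  rw [le_div_iff₀ (by positivity)]
  by_cases h : x₀ ≤ x
  · rw [hμ.tail x h]
    have e : x ^ (-α) * x ^ 2 = x ^ (2 - α) := by
      rw [← Real.rpow_natCast x 2, ← Real.rpow_add hx]
      congr 1
      push_cast
      ring
    have : x ^ (2 - α) ≤ x₀ ^ (2 - α) := Real.rpow_le_rpow_of_nonpos hx₀ h (by linarith)
    calc a * x ^ (-α) * x ^ 2 = a * x ^ (2 - α) := by rw [mul_assoc, e]
      _ ≤ a * x₀ ^ (2 - α) := by gcongr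
      _ ≤ _ := by have := sq_nonneg x₀; linarith
  · have h1 : μ.real (Set.Ioi x) ≤ 1 := measureReal_le_one
    have h2 : x ^ 2 ≤ x₀ ^ 2 := by
      have := (not_le.1 h).le
      gcongr
    have h3 : 0 ≤ a * x₀ ^ (2 - α) := by positivity
    nlinarith [sq_nonneg x]

/-- Mean degrees at the cutoff are at least of order `n ^ (1 - α/2) (log n) ^ (α/2)`. Exceeding any
multiple of `log n` is what a union bound over all vertices needs; the first conjunct is the side
condition of `exists_meanProb_growth`. -/
theorem eventually_le_meanProb (hμ : IsWeightLaw μ α a x₀) (hα : α < 2) (ha : 0 < a)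
    (hb : 0 < b) (hκ : 0 < κ) {c : ℝ} (hc : 0 < c) (y : ℝ) :
    ∀ᶠ n : ℕ in atTop, x₀ ≤ 1 / (2 * (b * (c * cutoff κ n) / n)) ∧
      y * Real.log n ≤ (n - 1) * meanProb μ (b * (c * cutoff κ n) / n) := by
  have he : 0 < 1 - Real.exp (-1) := sub_pos.2 (Real.exp_lt_one_iff.2 (by norm_num))
  have h1 := (tendsto_rpow_mul_log_rpow_atTop (p := 1 / 2) (by norm_num) (-1 / 2)).const_mul_atTop
    (by positivity : 0 < (2 * b * c)⁻¹ * κ ^ (-1 / 2 : ℝ))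
  have h2 := (tendsto_rpow_mul_log_rpow_atTop (p := 1 - α / 2) (by linarith)
    (α / 2 - 1)).const_mul_atTop
    (by positivity : 0 < (1 - Real.exp (-1)) * a * (b * c) ^ α * κ ^ (α / 2) / 2)
  filter_upwards [h1.eventually_ge_atTop x₀, h2.eventually_ge_atTop y,
    eventually_gt_atTop 1] with n g1 g2 hn
  have hn' : (0 : ℝ) < n := by positivity
  have hn2 : (2 : ℝ) ≤ n := by exact_mod_cast hn
  have hL : 0 < Real.log n := Real.log_pos (by exact_mod_cast hn)
  have hct := cutoff_pos hκ hn
  have e1 : 1 / (2 * (b * (c * cutoff κ n) / n)) =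
      (2 * b * c)⁻¹ * κ ^ (-1 / 2 : ℝ) * ((n : ℝ) ^ (1 / 2 : ℝ) * Real.log n ^ (-1 / 2 : ℝ)) := by
    have h3 : (cutoff κ n)⁻¹ =
        κ ^ (-1 / 2 : ℝ) * ((n : ℝ) ^ (-1 / 2 : ℝ) * Real.log n ^ (-1 / 2 : ℝ)) := by
      rw [← cutoff_rpow hκ.le, Real.rpow_neg_one]
    have h4 : (n : ℝ) ^ (1 / 2 : ℝ) = n * (n : ℝ) ^ (-1 / 2 : ℝ) := by
      nth_rw 2 [← Real.rpow_one (n : ℝ)]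
      rw [← Real.rpow_add hn']
      norm_num
    rw [h4]
    calc _ = (2 * b * c)⁻¹ * (cutoff κ n)⁻¹ * n := by field_simp
      _ = _ := by rw [h3]; ring
  have hx : x₀ ≤ 1 / (2 * (b * (c * cutoff κ n) / n)) := e1 ▸ g1
  refine ⟨hx, ?_⟩
  set s := b * (c * cutoff κ n) / n with hs
  have hs0 : 0 < s := by positivity
  have h5 := le_meanProb hμ hs0 (hx.trans (one_div_le_one_div_of_le hs0 (by linarith)))
  have e2 : n * s ^ α = (b * c) ^ α * κ ^ (α / 2) *
      ((n : ℝ) ^ (1 - α / 2) * Real.log n ^ (α / 2)) := by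
    have h6 : s = (b * c) * cutoff κ n / n := by rw [hs]; ring
    have h7 : (n : ℝ) ^ (1 - α / 2) = n * (n : ℝ) ^ (α / 2) / n ^ α := by
      nth_rw 2 [← Real.rpow_one (n : ℝ)]
      rw [← Real.rpow_add hn', ← Real.rpow_sub hn']
      congr 1
      ring
    rw [h6, Real.div_rpow (by positivity) hn'.le, Real.mul_rpow (by positivity) hct.le,
      cutoff_rpow hκ.le, h7]
    ring
  calc y * Real.log n ≤ (1 - Real.exp (-1)) * a * (b * c) ^ α * κ ^ (α / 2) / 2 *
        ((n : ℝ) ^ (1 - α / 2) * Real.log n ^ (α / 2 - 1)) * Real.log n := by gcongr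
    _ = n / 2 * ((1 - Real.exp (-1)) * (a * s ^ α)) := by
        rw [show (n : ℝ) / 2 * ((1 - Real.exp (-1)) * (a * s ^ α)) =
          (1 - Real.exp (-1)) * a / 2 * (n * s ^ α) by ring, e2, Real.rpow_sub hL, Real.rpow_one]
        field_simp
    _ ≤ (n - 1) * ((1 - Real.exp (-1)) * (a * s ^ α)) := by
        gcongr
        linarith
    _ ≤ _ := by
        gcongr
        linarith

/-- Degrees separate vertices of weights below and above two multiples of the cutoff. -/
theorem exists_tendsto_deg (hμ : IsWeightLaw μ α a x₀) (hα0 : 0 < α) (hα : α < 2) (ha : 0 < a)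
    (hb : 0 < b) (hκ : 0 < κ) {c₁ c₂ : ℝ} (hc₁ : 0 < c₁) (hc : c₁ < c₂) :
    ∃ d : ℕ → ℝ, Tendsto (fun n : ℕ => sampleMeasure μ n
      {ω | ¬ ((∀ v, ω.1 v ≤ c₁ * cutoff κ n → deg b v ω < d n) ∧
        ∀ v, c₂ * cutoff κ n < ω.1 v → d n ≤ deg b v ω)}) atTop (𝓝 0) := by
  obtain ⟨γ, hγ, hgrowth⟩ := exists_meanProb_growth hα0 hμ (k := c₂ / c₁)
    ((one_lt_div hc₁).2 hc)
  -- This `η` solves `1 + η = (1 - η) (1 + γ)`, so a single threshold `(1 + η) m₁` lies above the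
  -- light degrees and below the heavy ones.
  set η := γ / (2 + γ) with hη
  have hη0 : 0 < η := by positivity
  have hη1 : η ≤ 1 := by rw [hη, div_le_one (by positivity)]; linarith
  have hηγ : 1 + η ≤ (1 - η) * (1 + γ) := by
    have : η * (2 + γ) = γ := by rw [hη]; field_simp
    nlinarith
  let m₁ : ℕ → ℝ := fun n => (n - 1) * meanProb μ (b * (c₁ * cutoff κ n) / n)
  let m₂ : ℕ → ℝ := fun n => (n - 1) * meanProb μ (b * (c₂ * cutoff κ n) / n)
  let U : (n : ℕ) → Set (Sample n) := fun n => ⋃ v, {ω | (1 + η) * m₁ n ≤ deg b v ω ∧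
    ω.1 v ≤ c₁ * cutoff κ n}
  let V : (n : ℕ) → Set (Sample n) := fun n => ⋃ v, {ω | deg b v ω ≤ (1 - η) * m₂ n ∧
    c₂ * cutoff κ n ≤ ω.1 v}
  -- An exponent of at least `2 log n` gives each vertex failure probability at most `n ^ (-2)`,
  -- hence `1 / n` in total.
  have hev : ∀ᶠ n : ℕ in atTop, 1 < n ∧ η ^ 2 / 4 * m₁ n ≥ 2 * Real.log n ∧
      (1 + γ) * m₁ n ≤ m₂ n ∧ 0 ≤ m₁ n := by
    filter_upwards [eventually_le_meanProb hμ hα ha hb hκ hc₁ (2 / (η ^ 2 / 4)),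
      eventually_gt_atTop 1] with n ⟨h1, h2⟩ hn
    have hct := cutoff_pos hκ hn
    have hn' : (1 : ℝ) < n := by exact_mod_cast hn
    refine ⟨hn, ?_, ?_, ?_⟩
    · have := mul_le_mul_of_nonneg_left h2 (by positivity : 0 ≤ η ^ 2 / 4)
      refine le_trans (le_of_eq ?_) this
      field_simp
    · have h3 := hgrowth (b * (c₁ * cutoff κ n) / n) (by positivity) h1
      have e : c₂ / c₁ * (b * (c₁ * cutoff κ n) / n) = b * (c₂ * cutoff κ n) / n := by
        field_simp
      rw [e] at h3
      have := mul_le_mul_of_nonneg_left h3 (by linarith : 0 ≤ (n : ℝ) - 1)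
      simp only [m₁, m₂]
      linarith
    · exact mul_nonneg (by linarith) (meanProb_nonneg hμ.nonneg (by positivity))
  have hbound : ∀ n : ℕ, 1 < n → ∀ m : ℝ, 2 * Real.log n ≤ η ^ 2 / 4 * m →
      (n : ℝ) * Real.exp (-(η ^ 2 / 4 * m)) ≤ (n : ℝ)⁻¹ := by
    intro n hn m hm
    have hn' : (0 : ℝ) < n := by positivity
    calc (n : ℝ) * Real.exp (-(η ^ 2 / 4 * m))
        ≤ Real.exp (Real.log n) * Real.exp (-(2 * Real.log n)) := by
          rw [Real.exp_log hn']
          gcongr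
      _ = Real.exp (-Real.log n) := by rw [← Real.exp_add]; ring_nf
      _ = _ := by rw [Real.exp_neg, Real.exp_log hn']
  have hU : Tendsto (fun n => sampleMeasure μ n (U n)) atTop (𝓝 0) := by
    refine tendsto_measure_of_le_ofReal _ ?_ tendsto_inv_atTop_nhds_zero_nat
    filter_upwards [hev] with n ⟨hn, h1, _⟩
    have hct := cutoff_pos hκ hn
    refine (measure_iUnion_fintype_le _ _).trans ((Finset.sum_le_sum fun v _ =>
      measure_deg_large hμ.nonneg hb.le v (by positivity) hη0 hη1).trans ?_)
    rw [Finset.sum_const, Finset.card_univ, Fintype.card_fin, nsmul_eq_mul,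
      ← ENNReal.ofReal_natCast, ← ENNReal.ofReal_mul (by positivity)]
    exact ENNReal.ofReal_le_ofReal (hbound n hn _ h1)
  have hV : Tendsto (fun n => sampleMeasure μ n (V n)) atTop (𝓝 0) := by
    refine tendsto_measure_of_le_ofReal _ ?_ tendsto_inv_atTop_nhds_zero_nat
    filter_upwards [hev] with n ⟨hn, h1, h2, h3⟩
    have hct := cutoff_pos hκ hn
    have hc₂ := hc₁.trans hc
    refine (measure_iUnion_fintype_le _ _).trans ((Finset.sum_le_sum fun v _ =>
      measure_deg_small hμ.nonneg hb.le v (by positivity) hη0 hη1).trans ?_)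
    rw [Finset.sum_const, Finset.card_univ, Fintype.card_fin, nsmul_eq_mul,
      ← ENNReal.ofReal_natCast, ← ENNReal.ofReal_mul (by positivity)]
    refine ENNReal.ofReal_le_ofReal (hbound n hn _ (h1.trans ?_))
    have : m₁ n ≤ m₂ n := by nlinarith
    exact mul_le_mul_of_nonneg_left this (by positivity)
  refine ⟨fun n => (1 + η) * m₁ n, tendsto_of_tendsto_of_tendsto_of_le_of_le' tendsto_const_nhds
    (tendsto_measure_union _ hU hV) (Eventually.of_forall fun _ => zero_le) ?_⟩
  filter_upwards [hev] with n ⟨hn, h1, h2, h3⟩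
  refine measure_mono fun ω hω => ?_
  simp only [Set.mem_ofPred_eq, not_and_or, not_forall, not_lt, not_le] at hω
  rcases hω with ⟨v, hv, hd⟩ | ⟨v, hv, hd⟩
  · exact Or.inl (Set.mem_iUnion.2 ⟨v, hd, hv⟩)
  · refine Or.inr (Set.mem_iUnion.2 ⟨v, hd.le.trans ?_, hv.le⟩)
    calc (1 + η) * m₁ n ≤ (1 - η) * (1 + γ) * m₁ n := by gcongr
      _ = (1 - η) * ((1 + γ) * m₁ n) := by ring
      _ ≤ _ := mul_le_mul_of_nonneg_left h2 (by linarith)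

/-- As `δ → 0` the two sides tend to `1 - ε` and `1`. In units of `N`, the factor after `1 - ε`
bounds the clique number from above, and the right side bounds the size of the clique found from
below. -/
theorem exists_comparison_parameter (α : ℝ) {ε : ℝ} (hε : 0 < ε) : ∃ δ > 0, δ < 1 ∧
    (1 - ε) * ((1 + δ) * (1 - δ) ^ (-α) + δ) < (1 - δ) * (1 + 2 * δ) ^ (-α) - δ := by
  have hcont : ContinuousAt (fun δ : ℝ => (1 - δ) * (1 + 2 * δ) ^ (-α) - δ -
      (1 - ε) * ((1 + δ) * (1 - δ) ^ (-α) + δ)) 0 := by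
    have h1 : ContinuousAt (fun δ : ℝ => (1 + 2 * δ) ^ (-α)) 0 :=
      ContinuousAt.rpow_const (by fun_prop) (Or.inl (by norm_num))
    have h2 : ContinuousAt (fun δ : ℝ => (1 - δ) ^ (-α)) 0 :=
      ContinuousAt.rpow_const (by fun_prop) (Or.inl (by norm_num))
    fun_prop
  have h0 := hcont.eventually (lt_mem_nhds (a := 0) (by simp; linarith))
  have h1 : ∀ᶠ δ : ℝ in 𝓝[>] 0, 0 < δ ∧ δ < 1 := Ioo_mem_nhdsGT one_pos
  obtain ⟨δ, h2, h3, h4⟩ := ((h0.filter_mono nhdsWithin_le_nhds).and h1).exists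
  exact ⟨δ, h3, h4, by linarith⟩

open Classical in
/-- For `α < 2`, an algorithm that finds a clique as large as some maximal clique of the graph
induced on the vertices of degree at least `d`, for every `d`, finds a clique of almost largest
size. -/
theorem tendsto_greedy (hμ : IsWeightLaw μ α a x₀) (hα0 : 0 < α) (hα : α < 2) (ha : 0 < a)
    (hb : 0 < b) (f : (n : ℕ) → SimpleGraph (Fin n) → Finset (Fin n))
    (hf : ∀ n (G : SimpleGraph (Fin n)), G.IsClique (f n G : Set (Fin n)) ∧
      ∀ d : ℕ, ∃ C : Finset (Fin n), C.card ≤ (f n G).card ∧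
        (∀ u ∈ C, d ≤ (Finset.univ.filter fun w => G.Adj u w).card) ∧
        ∀ u, d ≤ (Finset.univ.filter fun w => G.Adj u w).card → u ∉ C → ∃ w ∈ C, ¬ G.Adj u w)
    {ε : ℝ} (hε : 0 < ε) :
    Tendsto (fun n : ℕ => sampleMeasure μ n
      {ω | (randomGraph b n ω).IsClique (f n (randomGraph b n ω) : Set (Fin n)) ∧
        (1 - ε) * ((randomGraph b n ω).cliqueNum : ℝ) ≤ ((f n (randomGraph b n ω)).card : ℝ)})
      atTop (𝓝 1) := by
  obtain ⟨δ, hδ0, hδ1, hδ⟩ := exists_comparison_parameter α hε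
  obtain ⟨κ, hκ⟩ : ∃ κ, κ = (1 - α / 2) / b := ⟨_, rfl⟩
  have hκ0 : 0 < κ := by
    have : 0 < 1 - α / 2 := by linarith
    rw [hκ]; positivity
  have hc0 : 0 < 1 - δ := by linarith
  obtain ⟨d, hd⟩ := exists_tendsto_deg (c₁ := 1 + δ) (c₂ := 1 + 2 * δ) hμ hα0 hα ha hb hκ0
    (by linarith) (by linarith)
  have h1 := tendsto_numAbove_large hμ hα ha hκ0 hc0 hδ0 hδ1.le
  have h2 := tendsto_numAbove_small hμ hα ha hκ0 (by linarith : 0 < 1 + 2 * δ) hδ0 hδ1.le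
  have h3 := tendsto_numNonedges hμ hα ha hb hκ (by linarith : 1 < 1 + δ) hδ0
  have h4 := tendsto_light_clique hμ hα ha hb hκ hc0 (by linarith) hδ0
  refine tendsto_measure_one _ _ _ ?_ (tendsto_measure_union _ hd (tendsto_measure_union _
    (tendsto_measure_union _ h1 h2) (tendsto_measure_union _ h3 h4)))
  filter_upwards [eventually_gt_atTop 1, (tendsto_sizeAbove hα ha hκ0).eventually_gt_atTop 0]
    with n hn hN
  intro ω hω
  by_contra hB
  simp only [Set.mem_union, not_or] at hB
  obtain ⟨b0, ⟨b1, b2⟩, b3, b4⟩ := hB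
  simp only [Set.mem_ofPred_eq, not_le, not_not] at b0 b1 b2 b3
  refine hω ⟨(hf n _).1, ?_⟩
  have hct := cutoff_pos hκ0 hn
  -- Degrees are integers, so the real threshold `d n` may be rounded up; the algorithm need not
  -- know it, since it does well for every threshold.
  obtain ⟨C, hC1, hC2, hC3⟩ := (hf n (randomGraph b n ω)).2 ⌈d n⌉₊
  have hlow := numAbove_le_card (C := C) (w₁ := (1 + δ) * cutoff κ n)
    (w₂ := (1 + 2 * δ) * cutoff κ n) (by gcongr; linarith) b0.1 b0.2
    (fun v hv => Nat.ceil_le.1 (hC2 v hv)) fun u hu hu' => hC3 u (Nat.ceil_le.2 hu) hu'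
  have hupp := cliqueNum_le b4
  set N := sizeAbove α a κ n
  have hC1' : (C.card : ℝ) ≤ ((f n (randomGraph b n ω)).card : ℝ) := by exact_mod_cast hC1
  by_cases hε1 : ε ≤ 1
  · have u1 : ((randomGraph b n ω).cliqueNum : ℝ) ≤ ((1 + δ) * (1 - δ) ^ (-α) + δ) * N := by
      linarith
    have u2 := mul_le_mul_of_nonneg_left u1 (sub_nonneg.2 hε1)
    have u3 := mul_lt_mul_of_pos_right hδ hN
    linarith
  · have : (1 - ε) * ((randomGraph b n ω).cliqueNum : ℝ) ≤ 0 :=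
      mul_nonpos_of_nonpos_of_nonneg (by linarith) (Nat.cast_nonneg _)
    exact this.trans (Nat.cast_nonneg _)

end PowerLawGraph

theorem corollary3 (α : ℝ) (hα : 0 < α) :
    ∃ (A : RAM.Program) (f : (n : ℕ) → SimpleGraph (Fin n) → Finset (Fin n)),
      RAM.ComputesInPolyTime A f ∧
      ∀ (a b x₀ : ℝ) (μ : Measure ℝ) [IsProbabilityMeasure μ],
        0 < a → 0 < b → 0 < x₀ → PowerLawGraph.IsWeightLaw μ α a x₀ →
        ∀ ε : ℝ, 0 < ε →
          Tendsto
            (fun n : ℕ => PowerLawGraph.sampleMeasure μ n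
              {ω | (PowerLawGraph.randomGraph b n ω).IsClique
                    (f n (PowerLawGraph.randomGraph b n ω) : Set (Fin n)) ∧
                  (1 - ε) * ((PowerLawGraph.randomGraph b n ω).cliqueNum : ℝ) ≤
                    ((f n (PowerLawGraph.randomGraph b n ω)).card : ℝ)})
            atTop (𝓝 1) := by
  -- The choice of program uses only `α`; the parameters `a`, `b`, `x₀` and the law are introduced
  -- afterwards.
  by_cases h2 : α < 2
  · obtain ⟨A, f, hA, hf⟩ := RAM.exists_greedyCliques
    exact ⟨A, f, hA, fun a b x₀ μ _ ha hb _ hμ ε hε =>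
      PowerLawGraph.tendsto_greedy hμ hα h2 ha hb f hf hε⟩
  · obtain ⟨A, f, hA, hf⟩ := RAM.exists_enumCliques
    refine ⟨A, f, hA, fun a b x₀ μ _ ha hb hx₀ hμ ε hε => ?_⟩
    obtain ⟨K, hK, htail⟩ := hμ.exists_tail_le hx₀ ha.le (not_lt.1 h2)
    -- Whenever there are few cliques the output is a clique of largest size, which is stronger than
    -- required.
    refine tendsto_of_tendsto_of_tendsto_of_le_of_le
      (PowerLawGraph.tendsto_card_cliques hμ.nonneg hK htail hb.le) tendsto_const_nhds
      (fun n => measure_mono fun ω hω => ?_) fun n => prob_le_one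
    refine ⟨(hf n _).1, ?_⟩
    have h := (hf n _).2 hω
    have h' : ((PowerLawGraph.randomGraph b n ω).cliqueNum : ℝ) ≤
      (f n (PowerLawGraph.randomGraph b n ω)).card := by exact_mod_cast h
    nlinarith [Nat.cast_nonneg (α := ℝ) (PowerLawGraph.randomGraph b n ω).cliqueNum]
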